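/- Let $L>0$, $\alpha>0$, $\omega>0$ and $\tau>0$. Write $L^2_{per}$ and $H^s_{per}$ for the Lebesgue and Sobolev spaces of $L$-periodic functions. Let $\mathcal Y_\tau$ be the set of even complex-valued functions $u\in H^1_{per}$ with $\int_0^L|u|^{\alpha+2}\,dx=\tau$, and let $\mathcal B_\omega(u)=\frac12\int_0^L\big(|u_x|^2+\omega|u|^2\big)\,dx$. Let $\varphi$ be an even, positive, nonconstant $L$-periodic solution of $$-\varphi''+\omega\varphi-|\varphi|^\alpha\varphi=0$$ that lies in $\mathcal Y_\tau$ and minimizes $\mathcal B_\omega$ over $\mathcal Y_\tau$. Consider the operator $$\mathcal L=\begin{pmatrix}\mathcal L_1&0\\0&\mathcal L_2\end{pmatrix},\qquad \mathcal L_1=-\partial_x^2+\omega-(\alpha+1)|\varphi|^\alpha,\qquad \mathcal L_2=-\partial_x^2+\omega-|\varphi|^\alpha,$$ in $L^2_{per}\times L^2_{per}$ with domain $H^2_{per}\times H^2_{per}$, over the real or over the complex scalars. Then: (i) $\mathcal L$ has exactly one negative eigenvalue $-\lambda$, and it is simple (its eigenspace is one-dimensional); (ii) $0$ is a double eigenvalue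 of $\mathcal L$, and its eigenspace is spanned by the linearly independent elements $(\varphi',0)$ and $(0,\varphi)$; (iii) the remainder of the spectrum of $\mathcal L$ is a discrete set of eigenvalues: every point of the spectrum other than $-\lambda$ and $0$ is a positive eigenvalue of finite multiplicity, and every bounded set contains only finitely many points of the spectrum. -/

import Mathlib

namespace TransverseNLS

open MeasureTheory Set

section Sobolev

open scoped ContDiff

/-! ### Periodic Lebesgue and Sobolev spaces -/

/-- `L²_per`: the square integrable `L`-periodic functions, identified with `L²(0, L)` by restriction
to the period `(0, L]`.  The scalar field `𝕜` is `ℝ` or `ℂ`. -/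
abbrev L2per (𝕜 : Type*) [RCLike 𝕜] (L : ℝ) : Type _ :=
  Lp 𝕜 2 (volume.restrict (Ioc (0 : ℝ) L))

/-- `g` is the derivative of `f` in the sense of `L`-periodic distributions: the test functions are
the smooth `L`-periodic functions. (Periodicity of the test functions, rather than vanishing at the
end points, is what encodes the periodic boundary condition for `f`.) -/
def HasPerWeakDeriv {𝕜 : Type*} [RCLike 𝕜] (L : ℝ) (f g : ℝ → 𝕜) : Prop :=
  ∀ ψ : ℝ → ℝ, ContDiff ℝ ∞ ψ → Function.Periodic ψ L →
    ∫ x in (0 : ℝ)..L, deriv ψ x • f x = -∫ x in (0 : ℝ)..L, ψ x • g x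

/-- Extending a smooth function with compact support in `(0, L)` periodically gives a smooth
function. -/
theorem exists_periodic_extension {L : ℝ} (hL : 0 < L) {ψ : ℝ → ℝ} (hψ : ContDiff ℝ ∞ ψ)
    (hs : tsupport ψ ⊆ Ioo 0 L) :
    ∃ Ψ : ℝ → ℝ, ContDiff ℝ ∞ Ψ ∧ Function.Periodic Ψ L ∧ ∀ x ∈ Ioo 0 L, Ψ x = ψ x := by
  have hmem : ∀ x, Int.fract (x / L) * L ∈ Ico 0 L := fun x =>
    ⟨mul_nonneg (Int.fract_nonneg _) hL.le, by
      have := mul_lt_mul_of_pos_right (Int.fract_lt_one (x / L)) hL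
      simpa using this⟩
  refine ⟨fun x => ψ (Int.fract (x / L) * L), ?_, ?_, ?_⟩
  · rw [contDiff_iff_contDiffAt]
    intro x
    -- near every point the extension is a translate of `ψ` or zero
    by_cases hx : Int.fract (x / L) = 0
    · have hK : IsClosed (tsupport ψ) := isClosed_tsupport ψ
      have h0 : (fun y => ψ y) =ᶠ[nhds 0] fun _ => 0 :=
        notMem_tsupport_iff_eventuallyEq.mp (fun h => lt_irrefl _ (hs h).1)
      have h1 : (fun y => ψ y) =ᶠ[nhds L] fun _ => 0 :=
        notMem_tsupport_iff_eventuallyEq.mp (fun h => lt_irrefl _ (hs h).2)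
      obtain ⟨ε, hε, he⟩ := Metric.eventually_nhds_iff.mp h0
      obtain ⟨δ, hδ, hd⟩ := Metric.eventually_nhds_iff.mp h1
      have hz : (fun y => ψ (Int.fract (y / L) * L)) =ᶠ[nhds x] fun _ => 0 := by
        rw [Filter.EventuallyEq, Metric.eventually_nhds_iff]
        refine ⟨min (min ε δ) L, by positivity, fun y hy => ?_⟩
        have hxL : x = ⌊x / L⌋ * L := by
          have h := Int.floor_add_fract (x / L)
          rw [hx, add_zero] at h
          rw [h]; field_simp
        rw [Real.dist_eq, lt_min_iff, lt_min_iff] at hy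
        obtain ⟨⟨h1, h2⟩, h3⟩ := hy
        rw [abs_lt] at h1 h2 h3
        by_cases hxy : x ≤ y
        · have hf : ⌊y / L⌋ = ⌊x / L⌋ := by
            rw [Int.floor_eq_iff]
            constructor
            · rw [le_div_iff₀ hL]; linarith
            · rw [div_lt_iff₀ hL]; linarith
          have : Int.fract (y / L) * L = y - x := by
            rw [Int.fract, hf, sub_mul, div_mul_cancel₀ _ hL.ne']; linarith
          rw [this]
          apply he
          rw [Real.dist_eq, abs_lt]
          constructor <;> linarith
        · push Not at hxy
          have hf : ⌊y / L⌋ = ⌊x / L⌋ - 1 := by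
            rw [Int.floor_eq_iff]
            push_cast
            constructor
            · rw [le_div_iff₀ hL]; linarith
            · rw [div_lt_iff₀ hL]; linarith
          have : Int.fract (y / L) * L = y - x + L := by
            rw [Int.fract, hf, sub_mul, div_mul_cancel₀ _ hL.ne']; push_cast; linarith
          rw [this]
          apply hd
          rw [Real.dist_eq, abs_lt]
          constructor <;> linarith
      exact contDiffAt_const.congr_of_eventuallyEq hz
    · have hfl : ∀ᶠ y in nhds x, ⌊y / L⌋ = ⌊x / L⌋ := by
        have hlt : (⌊x / L⌋ : ℝ) < x / L := lt_of_le_of_ne (Int.floor_le _) (by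
          intro h; apply hx; rw [Int.fract]; linarith)
        have hc : Filter.Tendsto (fun y : ℝ => y / L) (nhds x) (nhds (x / L)) :=
          (continuous_id.div_const L).continuousAt
        filter_upwards [hc.eventually (lt_mem_nhds hlt),
          hc.eventually (gt_mem_nhds (Int.lt_floor_add_one (x / L)))] with y h1 h2
        exact Int.floor_eq_iff.mpr ⟨h1.le, h2⟩
      have : (fun y => ψ (Int.fract (y / L) * L)) =ᶠ[nhds x]
          fun y => ψ ((y / L - ⌊x / L⌋) * L) := by
        filter_upwards [hfl] with y hy
        rw [Int.fract, hy]
      refine ContDiffAt.congr_of_eventuallyEq ?_ this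
      have h2 : ContDiff ℝ ∞ fun y => ψ ((y / L - ⌊x / L⌋) * L) := by fun_prop
      exact h2.contDiffAt
  · intro x
    have : (x + L) / L = x / L + 1 := by field_simp
    simp only [this, Int.fract_add_one]
  · intro x hx
    have : Int.fract (x / L) = x / L := Int.fract_eq_self.mpr
      ⟨div_nonneg hx.1.le hL.le, (div_lt_one hL).mpr hx.2⟩
    simp only [this, div_mul_cancel₀ _ hL.ne']

theorem L2per_intervalIntegrable {𝕜 : Type*} [RCLike 𝕜] {L : ℝ} (hL : 0 < L) (f : L2per 𝕜 L) :
    IntervalIntegrable f volume 0 L := by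
  rw [intervalIntegrable_iff_integrableOn_Ioc_of_le hL.le]
  exact (Lp.memLp f).integrable (by norm_num)

/-- An `L²_per` function is determined by its integrals against smooth periodic functions. -/
theorem eq_zero_of_periodic_tests {𝕜 : Type*} [RCLike 𝕜] {L : ℝ} (hL : 0 < L) (g : L2per 𝕜 L)
    (h : ∀ ψ : ℝ → ℝ, ContDiff ℝ ∞ ψ → Function.Periodic ψ L →
      ∫ x in (0 : ℝ)..L, ψ x • g x = 0) : g = 0 := by
  have hint : IntegrableOn g (Ioc 0 L) volume := (Lp.memLp g).integrable (by norm_num)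
  have hae : ∀ᵐ x ∂(volume : Measure ℝ), x ∈ Ioo 0 L → g x = 0 := by
    refine isOpen_Ioo.ae_eq_zero_of_integral_contDiff_smul_eq_zero
      (hint.mono_set Ioo_subset_Ioc_self).locallyIntegrableOn ?_
    intro ψ hψ _ hs
    obtain ⟨Ψ, hΨ, hP, he⟩ := exists_periodic_extension hL hψ hs
    have h1 := h Ψ hΨ hP
    rw [intervalIntegral.integral_of_le hL.le, integral_Ioc_eq_integral_Ioo] at h1
    rw [← h1, ← setIntegral_eq_integral_of_forall_compl_eq_zero (s := Ioo 0 L)]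
    · exact setIntegral_congr_fun measurableSet_Ioo fun x hx => by simp only [he x hx]
    · intro x hx
      rw [image_eq_zero_of_notMem_tsupport (fun hh => hx (hs hh)), zero_smul]
  rw [Lp.eq_zero_iff_ae_eq_zero]
  have hset : ae (volume.restrict (Ioc (0 : ℝ) L)) = ae (volume.restrict (Ioo (0 : ℝ) L)) := by
    rw [Measure.restrict_congr_set (Ioo_ae_eq_Ioc (μ := (volume : Measure ℝ)) (a := 0) (b := L))]
  rw [hset]
  exact (ae_restrict_iff' measurableSet_Ioo).mpr hae

theorem intervalIntegrable_smul {𝕜 : Type*} [RCLike 𝕜] {L : ℝ} (hL : 0 < L) {ψ : ℝ → ℝ}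
    (hψ : Continuous ψ) (f : L2per 𝕜 L) :
    IntervalIntegrable (fun x => ψ x • f x) volume 0 L :=
  (L2per_intervalIntegrable hL f).continuousOn_smul hψ.continuousOn

theorem integral_smul_congr {𝕜 : Type*} [RCLike 𝕜] {L : ℝ} (hL : 0 < L) (ψ : ℝ → ℝ)
    {f g : ℝ → 𝕜} (h : f =ᵐ[volume.restrict (Ioc (0 : ℝ) L)] g) :
    ∫ x in (0 : ℝ)..L, ψ x • f x = ∫ x in (0 : ℝ)..L, ψ x • g x := by
  rw [intervalIntegral.integral_of_le hL.le, intervalIntegral.integral_of_le hL.le]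
  refine integral_congr_ae ?_
  filter_upwards [h] with x hx
  rw [hx]

theorem integral_smul_add {𝕜 : Type*} [RCLike 𝕜] {L : ℝ} (hL : 0 < L) {ψ : ℝ → ℝ}
    (hψ : Continuous ψ) (f g : L2per 𝕜 L) :
    ∫ x in (0 : ℝ)..L, ψ x • (f + g : L2per 𝕜 L) x =
      (∫ x in (0 : ℝ)..L, ψ x • f x) + ∫ x in (0 : ℝ)..L, ψ x • g x := by
  rw [integral_smul_congr hL ψ (Lp.coeFn_add f g), ← intervalIntegral.integral_add
    (intervalIntegrable_smul hL hψ f) (intervalIntegrable_smul hL hψ g)]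
  simp only [Pi.add_apply, smul_add]

theorem integral_smul_smul {𝕜 : Type*} [RCLike 𝕜] {L : ℝ} (hL : 0 < L) (ψ : ℝ → ℝ)
    (c : 𝕜) (f : L2per 𝕜 L) :
    ∫ x in (0 : ℝ)..L, ψ x • (c • f : L2per 𝕜 L) x = c • ∫ x in (0 : ℝ)..L, ψ x • f x := by
  rw [integral_smul_congr hL ψ (Lp.coeFn_smul c f), ← intervalIntegral.integral_smul]
  simp only [Pi.smul_apply, smul_comm c]

namespace HasPerWeakDeriv

variable {𝕜 : Type*} [RCLike 𝕜] {L : ℝ}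

theorem add (hL : 0 < L) {f f' g g' : L2per 𝕜 L} (hf : HasPerWeakDeriv L f f')
    (hg : HasPerWeakDeriv L g g') :
    HasPerWeakDeriv L (f + g : L2per 𝕜 L) (f' + g' : L2per 𝕜 L) := by
  intro ψ hψ hP
  rw [integral_smul_add hL (hψ.continuous_deriv (by norm_num)), integral_smul_add hL hψ.continuous,
    hf ψ hψ hP, hg ψ hψ hP, neg_add]

theorem smul (hL : 0 < L) (c : 𝕜) {f f' : L2per 𝕜 L} (hf : HasPerWeakDeriv L f f') :
    HasPerWeakDeriv L (c • f : L2per 𝕜 L) (c • f' : L2per 𝕜 L) := by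
  intro ψ hψ hP
  rw [integral_smul_smul hL, integral_smul_smul hL, hf ψ hψ hP, smul_neg]

theorem zero (hL : 0 < L) : HasPerWeakDeriv L (0 : L2per 𝕜 L) (0 : L2per 𝕜 L) := by
  intro ψ _ _
  rw [integral_smul_congr hL _ (Lp.coeFn_zero 𝕜 2 _), integral_smul_congr hL _ (Lp.coeFn_zero 𝕜 2 _)]
  simp

/-- The weak derivative is unique. -/
theorem unique (hL : 0 < L) {f f₁ f₂ : L2per 𝕜 L} (h₁ : HasPerWeakDeriv L f f₁)
    (h₂ : HasPerWeakDeriv L f f₂) : f₁ = f₂ := by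
  rw [← sub_eq_zero]
  refine eq_zero_of_periodic_tests hL _ fun ψ hψ hP => ?_
  have h := integral_smul_add hL hψ.continuous (f₁ - f₂) f₂
  rw [sub_add_cancel] at h
  have h3 : ∫ x in (0 : ℝ)..L, ψ x • f₁ x = ∫ x in (0 : ℝ)..L, ψ x • f₂ x := by
    rw [← neg_inj, ← h₁ ψ hψ hP, ← h₂ ψ hψ hP]
  rw [h3] at h
  simpa using h

end HasPerWeakDeriv

/-- `g` is the second derivative of `f` in the sense of periodic distributions, and the first
derivative of `f` is square integrable too. -/
def HasSecondDeriv {𝕜 : Type*} [RCLike 𝕜] {L : ℝ} (f g : L2per 𝕜 L) : Prop :=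
  ∃ f₁ : L2per 𝕜 L, HasPerWeakDeriv L f f₁ ∧ HasPerWeakDeriv L f₁ g

theorem HasSecondDeriv.unique {𝕜 : Type*} [RCLike 𝕜] {L : ℝ} (hL : 0 < L) {f g h : L2per 𝕜 L}
    (hg : HasSecondDeriv f g) (hh : HasSecondDeriv f h) : g = h := by
  obtain ⟨f₁, h1, h2⟩ := hg
  obtain ⟨f₁', h1', h2'⟩ := hh
  obtain rfl := h1.unique hL h1'
  exact h2.unique hL h2'

theorem HasSecondDeriv.add {𝕜 : Type*} [RCLike 𝕜] {L : ℝ} (hL : 0 < L) {f g f₂ g₂ : L2per 𝕜 L}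
    (hf : HasSecondDeriv f f₂) (hg : HasSecondDeriv g g₂) : HasSecondDeriv (f + g) (f₂ + g₂) := by
  obtain ⟨f₁, h1, h2⟩ := hf
  obtain ⟨g₁, h1', h2'⟩ := hg
  exact ⟨f₁ + g₁, h1.add hL h1', h2.add hL h2'⟩

theorem HasSecondDeriv.smul {𝕜 : Type*} [RCLike 𝕜] {L : ℝ} (hL : 0 < L) (c : 𝕜)
    {f f₂ : L2per 𝕜 L} (hf : HasSecondDeriv f f₂) : HasSecondDeriv (c • f) (c • f₂) := by
  obtain ⟨f₁, h1, h2⟩ := hf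
  exact ⟨c • f₁, h1.smul hL c, h2.smul hL c⟩

/-- `H²_per` as a subspace of `L²_per`: the periodic functions whose first and second periodic
weak derivatives are square integrable. -/
def H2per (𝕜 : Type*) [RCLike 𝕜] {L : ℝ} (hL : 0 < L) : Submodule 𝕜 (L2per 𝕜 L) where
  carrier := {f | ∃ f₂ : L2per 𝕜 L, HasSecondDeriv f f₂}
  add_mem' := fun ⟨f₂, hf⟩ ⟨g₂, hg⟩ => ⟨f₂ + g₂, hf.add hL hg⟩
  zero_mem' := ⟨0, 0, HasPerWeakDeriv.zero hL, HasPerWeakDeriv.zero hL⟩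
  smul_mem' := fun c _ ⟨f₂, hf⟩ => ⟨c • f₂, hf.smul hL c⟩

theorem exists_hasSecondDeriv {𝕜 : Type*} [RCLike 𝕜] {L : ℝ} {hL : 0 < L} (f : H2per 𝕜 hL) :
    ∃ f₂ : L2per 𝕜 L, HasSecondDeriv (f : L2per 𝕜 L) f₂ := f.2

/-- The second derivative `∂ₓ² : H²_per → L²_per`. -/
noncomputable def secondDeriv (𝕜 : Type*) [RCLike 𝕜] {L : ℝ} (hL : 0 < L) :
    H2per 𝕜 hL →ₗ[𝕜] L2per 𝕜 L where
  toFun f := (exists_hasSecondDeriv f).choose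
  map_add' f g := (exists_hasSecondDeriv (f + g)).choose_spec.unique hL
    ((exists_hasSecondDeriv f).choose_spec.add hL (exists_hasSecondDeriv g).choose_spec)
  map_smul' c f := (exists_hasSecondDeriv (c • f)).choose_spec.unique hL
    ((exists_hasSecondDeriv f).choose_spec.smul hL c)

/-- The defining property of `secondDeriv`. -/
theorem secondDeriv_eq_iff {𝕜 : Type*} [RCLike 𝕜] {L : ℝ} (hL : 0 < L) (f : H2per 𝕜 hL)
    (g : L2per 𝕜 L) : secondDeriv 𝕜 hL f = g ↔ HasSecondDeriv (f : L2per 𝕜 L) g :=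
  ⟨fun h => h ▸ (exists_hasSecondDeriv f).choose_spec,
    fun h => (exists_hasSecondDeriv f).choose_spec.unique hL h⟩

end Sobolev

/-! ### Hill operators -/

theorem memLp_mul {𝕜 : Type*} [RCLike 𝕜] {L : ℝ} {q : ℝ → ℝ} (hq : Continuous q)
    (f : L2per 𝕜 L) :
    MemLp (fun x => q x • f x) 2 (volume.restrict (Ioc (0 : ℝ) L)) := by
  obtain ⟨C, hC⟩ := (isCompact_Icc (a := (0 : ℝ)) (b := L)).exists_bound_of_continuousOn
    hq.continuousOn
  refine MemLp.of_le_mul (c := C) (Lp.memLp f)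
    (hq.aestronglyMeasurable.smul (Lp.aestronglyMeasurable f)) ?_
  filter_upwards [ae_restrict_mem measurableSet_Ioc] with x hx
  rw [norm_smul]
  exact mul_le_mul_of_nonneg_right (hC x (Ioc_subset_Icc_self hx)) (norm_nonneg _)

/-- Multiplication of an `L²_per` function by a continuous real function `q`. -/
noncomputable def mulPot (𝕜 : Type*) [RCLike 𝕜] (L : ℝ) {q : ℝ → ℝ} (hq : Continuous q) :
    L2per 𝕜 L →ₗ[𝕜] L2per 𝕜 L where
  toFun f := (memLp_mul hq f).toLp _
  map_add' f g := by
    rw [← MemLp.toLp_add]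
    refine (MemLp.toLp_eq_toLp_iff _ _).mpr ?_
    filter_upwards [Lp.coeFn_add f g] with x hx
    simp only [hx, Pi.add_apply, smul_add]
  map_smul' c f := by
    rw [RingHom.id_apply, ← MemLp.toLp_const_smul]
    refine (MemLp.toLp_eq_toLp_iff _ _).mpr ?_
    filter_upwards [Lp.coeFn_smul c f] with x hx
    simp only [hx, Pi.smul_apply, smul_comm c]

/-- The Hill operator `-∂ₓ² + q` in `L²_per` with domain `H²_per`. -/
noncomputable def hill (𝕜 : Type*) [RCLike 𝕜] {L : ℝ} (hL : 0 < L) {q : ℝ → ℝ}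
    (hq : Continuous q) : L2per 𝕜 L →ₗ.[𝕜] L2per 𝕜 L where
  domain := H2per 𝕜 hL
  toFun := -secondDeriv 𝕜 hL + (mulPot 𝕜 L hq).comp (H2per 𝕜 hL).subtype

/-- The diagonal operator `diag(A, B)` with domain `D(A) × D(B)`. -/
def diagOp {𝕜 E F : Type*} [Ring 𝕜] [AddCommGroup E] [Module 𝕜 E] [AddCommGroup F] [Module 𝕜 F]
    (A : E →ₗ.[𝕜] E) (B : F →ₗ.[𝕜] F) : (E × F) →ₗ.[𝕜] (E × F) where
  domain := A.domain.prod B.domain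
  toFun :=
    { toFun := fun w => (A ⟨w.1.1, w.2.1⟩, B ⟨w.1.2, w.2.2⟩)
      map_add' := fun v w => Prod.ext (A.map_add ⟨v.1.1, v.2.1⟩ ⟨w.1.1, w.2.1⟩)
        (B.map_add ⟨v.1.2, v.2.2⟩ ⟨w.1.2, w.2.2⟩)
      map_smul' := fun c w => Prod.ext (A.map_smul c ⟨w.1.1, w.2.1⟩)
        (B.map_smul c ⟨w.1.2, w.2.2⟩) }

theorem continuous_abs_rpow {φ : ℝ → ℝ} (hφ : Continuous φ) {α : ℝ} (hα : 0 < α) :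
    Continuous fun x => |φ x| ^ α :=
  hφ.abs.rpow_const fun _ => Or.inr hα.le

/-- `𝓛₁ = -∂ₓ² + ω - (α + 1)|φ|^α`. -/
noncomputable def opL1 (𝕜 : Type*) [RCLike 𝕜] {L : ℝ} (hL : 0 < L) (ω : ℝ) {α : ℝ} (hα : 0 < α)
    {φ : ℝ → ℝ} (hφ : Continuous φ) : L2per 𝕜 L →ₗ.[𝕜] L2per 𝕜 L :=
  hill 𝕜 hL (q := fun x => ω - (α + 1) * |φ x| ^ α)
    (continuous_const.sub (continuous_const.mul (continuous_abs_rpow hφ hα)))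

/-- `𝓛₂ = -∂ₓ² + ω - |φ|^α`. -/
noncomputable def opL2 (𝕜 : Type*) [RCLike 𝕜] {L : ℝ} (hL : 0 < L) (ω : ℝ) {α : ℝ} (hα : 0 < α)
    {φ : ℝ → ℝ} (hφ : Continuous φ) : L2per 𝕜 L →ₗ.[𝕜] L2per 𝕜 L :=
  hill 𝕜 hL (q := fun x => ω - |φ x| ^ α) (continuous_const.sub (continuous_abs_rpow hφ hα))

/-- `𝓛 = diag(𝓛₁, 𝓛₂)` in `L²_per × L²_per` with domain `H²_per × H²_per`. (Only the topology of the
product matters for the spectrum, so the product is not given its Hilbert norm.) -/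
noncomputable def opL (𝕜 : Type*) [RCLike 𝕜] {L : ℝ} (hL : 0 < L) (ω : ℝ) {α : ℝ} (hα : 0 < α)
    {φ : ℝ → ℝ} (hφ : Continuous φ) :
    (L2per 𝕜 L × L2per 𝕜 L) →ₗ.[𝕜] (L2per 𝕜 L × L2per 𝕜 L) :=
  diagOp (opL1 𝕜 hL ω hα hφ) (opL2 𝕜 hL ω hα hφ)

/-! ### Spectrum of an unbounded operator -/

section Spectrum

variable {𝕜 E : Type*} [RCLike 𝕜] [NormedAddCommGroup E] [NormedSpace 𝕜 E]

/-- The resolvent set of `A`: those `z` for which `A - z : D(A) → E` has a bounded two-sided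
inverse `R : E → D(A)`. -/
def resolventSetOp (A : E →ₗ.[𝕜] E) : Set 𝕜 :=
  {z | ∃ R : E →L[𝕜] E, (∀ y : E, ∃ h : R y ∈ A.domain, A ⟨R y, h⟩ - z • R y = y) ∧
    ∀ x : A.domain, R (A x - z • (x : E)) = x}

/-- The spectrum of `A`. -/
def spectrumOp (A : E →ₗ.[𝕜] E) : Set 𝕜 := (resolventSetOp A)ᶜ

/-- The eigenspace `ker (A - z)`, as a subspace of `E`. -/
def eigenspaceOp (A : E →ₗ.[𝕜] E) (z : 𝕜) : Submodule 𝕜 E :=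
  (LinearMap.ker (A.toFun - z • A.domain.subtype)).map A.domain.subtype

/-- `z` is an eigenvalue of `A`. -/
def IsEigenvalueOp (A : E →ₗ.[𝕜] E) (z : 𝕜) : Prop := eigenspaceOp A z ≠ ⊥

theorem mem_eigenspaceOp {A : E →ₗ.[𝕜] E} {z : 𝕜} {x : E} :
    x ∈ eigenspaceOp A z ↔ ∃ h : x ∈ A.domain, A ⟨x, h⟩ = z • x := by
  simp only [eigenspaceOp, Submodule.mem_map, LinearMap.mem_ker, LinearMap.sub_apply,
    LinearMap.smul_apply, Submodule.subtype_apply, sub_eq_zero]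
  constructor
  · rintro ⟨y, hy, rfl⟩
    exact ⟨y.2, hy⟩
  · rintro ⟨h, hx⟩
    exact ⟨⟨x, h⟩, hx, rfl⟩

end Spectrum

/-! ### The constrained minimization problem -/

/-- `u : ℝ → ℂ` is an even function in the complex space `ℍ¹_per`, with weak derivative `ux`. -/
structure IsEvenH1per (L : ℝ) (u ux : ℝ → ℂ) : Prop where
  periodic : Function.Periodic u L
  even : Function.Even u
  memLp : MemLp u 2 (volume.restrict (Ioc (0 : ℝ) L))
  memLp_deriv : MemLp ux 2 (volume.restrict (Ioc (0 : ℝ) L))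
  weakDeriv : HasPerWeakDeriv L u ux

/-- `𝓑_ω(u) = ½ ∫₀ᴸ |uₓ|² + ω|u|²`. -/
noncomputable def energyB (L ω : ℝ) (u ux : ℝ → ℂ) : ℝ :=
  (1 / 2) * ∫ x in (0 : ℝ)..L, (‖ux x‖ ^ 2 + ω * ‖u x‖ ^ 2)

/-- `u`, with weak derivative `ux`, lies in the constraint set `𝒴_τ` of even functions in `ℍ¹_per`
with `∫₀ᴸ |u|^(α+2) = τ`. -/
def IsAdmissible (L α τ : ℝ) (u ux : ℝ → ℂ) : Prop :=
  IsEvenH1per L u ux ∧ ∫ x in (0 : ℝ)..L, ‖u x‖ ^ (α + 2) = τ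

/-- `u`, with weak derivative `ux`, minimizes `𝓑_ω` over `𝒴_τ`. -/
def IsEvenMinimizer (L ω α τ : ℝ) (u ux : ℝ → ℂ) : Prop :=
  IsAdmissible L α τ u ux ∧
    ∀ v vx : ℝ → ℂ, IsAdmissible L α τ v vx → energyB L ω u ux ≤ energyB L ω v vx

/-- `φ` is an even positive `L`-periodic classical solution of `-φ'' + ωφ - |φ|^α φ = 0`. -/
structure IsEvenPositiveWave (L ω α : ℝ) (φ : ℝ → ℝ) : Prop where
  contDiff : ContDiff ℝ 2 φ
  periodic : Function.Periodic φ L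
  even : Function.Even φ
  pos : ∀ x, 0 < φ x
  ode : ∀ x, -deriv (deriv φ) x + ω * φ x - |φ x| ^ α * φ x = 0

end TransverseNLS

/-!
All spectral statements are reduced to real classical solutions of the periodic problem
`y'' = (q - μ) y`, where `q` is one of the potentials `pot₁`, `pot₂` of `𝓛₁`, `𝓛₂`, and these are
then treated by the calculus of variations and by ordinary differential equations.

*Functional analysis.* The form domain of `-∂ₓ² + q + c`, for `c` large, embeds compactly into
`L²_per`, because a function is a constant plus the primitive of its weak derivative and taking
primitives is compact (`isCompactOperator_kernelOp`). If `ι` is this embedding then `ι ι†` is a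
compact positive resolvent (`exists_resolvent_hill`). Hence the spectrum consists of real eigenvalues
of finite multiplicity without finite accumulation point (`HasCompactResolvent.finite_eigenvalues`),
and a weak eigenfunction is classical (`mem_eigenspaceOp_hill`).

*Negative eigenvalues of `𝓛₁`.* There is one, since `𝓛₁ φ = -α |φ|^α φ` makes the quadratic form
negative at `φ` (`HasCompactResolvent.exists_neg_eigenvalue`). Even functions in `H¹_per` correspond
to arbitrary functions on the half period `[0, L/2]`, by reflection. So minimality of `φ` among *even*
functions says that the form of `𝓛₁` on the half period, without boundary conditions, is nonnegative
on a subspace of codimension one (`IsEvenMinimizer.secondVariation_nonneg`). This leaves room for a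
single Neumann eigenfunction with negative eigenvalue. It also excludes odd eigenfunctions: these
and `φ'` satisfy Dirichlet conditions on the half period and would span a plane on which the form is
nonpositive; a null vector in the plane would be a multiple of `φ'` with `φ'' = 0` at the ends
(`IsEvenMinimizer.dirichlet_eq_zero`, `IsEvenMinimizer.negative_unique`).

*The kernel of `𝓛₁`.* Besides `φ'` there could be an even element `e`. It is excluded by the
monotonicity of the period of the oscillator `φ'' = ωφ - φ^(α+1)` in its energy. With the force
`h(t) = t^(α+1) - ωt` and its potential `W`, the quotient `W / h²` is convex by a criterion of Schaaf
(`exists_convex_quotient`), and a Lyapunov function built from `e`, `φ'` and this quotient is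
monotone but vanishes at both ends of the half period
(`IsEvenPositiveWave.kernel_linearization`).

*The operator `𝓛₂`.* Its kernel contains the positive function `φ`, so its form is
`∫ |(y/φ)'|² φ²`, which excludes negative eigenvalues (`IsEvenPositiveWave.pot₂_negative_eq_zero`).
By Rolle's theorem `(y/φ)'` has a zero for every periodic `y`; hence the Wronskian of a kernel element
`y` with `φ` vanishes, and `y` is a multiple of `φ` (`IsEvenPositiveWave.pot₂_kernel`).
-/

namespace TransverseNLS

open MeasureTheory Set

/-! ### Linear second order equations -/

/-- `y` is a real solution of `y'' = q y` on `[0, b]` with derivative `y'`. Both functions are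
defined on the whole line and `y` is `C¹` there, so that no one-sided derivatives are needed at the
end points. -/
structure IsSol (b : ℝ) (q y y' : ℝ → ℝ) : Prop where
  hasDerivAt : ∀ x, HasDerivAt y (y' x) x
  continuous_deriv : Continuous y'
  hasDerivAt_deriv : ∀ x ∈ Icc 0 b, HasDerivAt y' (q x * y x) x

namespace IsSol

variable {b : ℝ} {q y y' z z' : ℝ → ℝ}

theorem continuous (h : IsSol b q y y') : Continuous y :=
  continuous_iff_continuousAt.mpr fun x => (h.hasDerivAt x).continuousAt

theorem mono {c : ℝ} (h : IsSol b q y y') (hc : c ≤ b) : IsSol c q y y' :=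
  ⟨h.hasDerivAt, h.continuous_deriv, fun x hx => h.hasDerivAt_deriv x ⟨hx.1, hx.2.trans hc⟩⟩

theorem add (hy : IsSol b q y y') (hz : IsSol b q z z') :
    IsSol b q (fun x => y x + z x) (fun x => y' x + z' x) where
  hasDerivAt x := (hy.hasDerivAt x).add (hz.hasDerivAt x)
  continuous_deriv := hy.continuous_deriv.add hz.continuous_deriv
  hasDerivAt_deriv x hx := by
    exact ((hy.hasDerivAt_deriv x hx).fun_add (hz.hasDerivAt_deriv x hx)).congr_deriv (by ring)

theorem const_mul (c : ℝ) (hy : IsSol b q y y') :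
    IsSol b q (fun x => c * y x) (fun x => c * y' x) where
  hasDerivAt x := (hy.hasDerivAt x).const_mul c
  continuous_deriv := hy.continuous_deriv.const_mul c
  hasDerivAt_deriv x hx := by
    exact ((hy.hasDerivAt_deriv x hx).const_mul c).congr_deriv (by ring)

theorem linComb (c d : ℝ) (hy : IsSol b q y y') (hz : IsSol b q z z') :
    IsSol b q (fun x => c * y x + d * z x) (fun x => c * y' x + d * z' x) :=
  (hy.const_mul c).add (hz.const_mul d)

theorem reflect (hy : IsSol b q y y') (hq : ∀ x, q (b - x) = q x) :
    IsSol b q (fun x => y (b - x)) (fun x => -y' (b - x)) where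
  hasDerivAt x := by
    exact (HasDerivAt.comp x (hy.hasDerivAt (b - x)) ((hasDerivAt_id x).const_sub b)).congr_deriv
      (by ring)
  continuous_deriv := (hy.continuous_deriv.comp (continuous_const.sub continuous_id)).neg
  hasDerivAt_deriv x hx := by
    have h := (HasDerivAt.comp x (hy.hasDerivAt_deriv (b - x)
      ⟨by linarith [hx.2], by linarith [hx.1]⟩) ((hasDerivAt_id x).const_sub b)).fun_neg
    rw [hq] at h
    exact h.congr_deriv (by ring)

/-- A solution with vanishing Cauchy data at `0` vanishes: `y² + y'²` satisfies a Gronwall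
inequality. -/
theorem eq_zero (hy : IsSol b q y y') (hq : Continuous q) (h0 : y 0 = 0) (h0' : y' 0 = 0) :
    ∀ x ∈ Icc 0 b, y x = 0 ∧ y' x = 0 := by
  obtain ⟨C, hC⟩ := (isCompact_Icc (a := (0 : ℝ)) (b := b)).exists_bound_of_continuousOn
    hq.continuousOn
  have hd : ∀ x ∈ Icc 0 b, HasDerivAt (fun x => (y x ^ 2 + y' x ^ 2) * Real.exp (-(1 + C) * x))
      ((2 * (1 + q x) * (y x * y' x) - (1 + C) * (y x ^ 2 + y' x ^ 2)) *
        Real.exp (-(1 + C) * x)) x := by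
    intro x hx
    have he : HasDerivAt (fun x => Real.exp (-(1 + C) * x))
        (Real.exp (-(1 + C) * x) * (-(1 + C) * 1)) x :=
      ((hasDerivAt_id x).const_mul (-(1 + C))).exp
    exact ((((hy.hasDerivAt x).fun_pow 2).fun_add
      ((hy.hasDerivAt_deriv x hx).fun_pow 2)).fun_mul he).congr_deriv (by push_cast; ring)
  have hanti : AntitoneOn (fun x => (y x ^ 2 + y' x ^ 2) * Real.exp (-(1 + C) * x))
      (Icc 0 b) := by
    refine antitoneOn_of_deriv_nonpos (convex_Icc 0 b)
      (fun x hx => (hd x hx).continuousAt.continuousWithinAt)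
      (fun x hx => (hd x (interior_subset hx)).differentiableAt.differentiableWithinAt)
      fun x hx => ?_
    have hx' := interior_subset hx
    rw [(hd x hx').deriv]
    refine mul_nonpos_of_nonpos_of_nonneg ?_ (Real.exp_pos _).le
    have h1 := hC x hx'
    rw [Real.norm_eq_abs] at h1
    have h2 : |1 + q x| ≤ 1 + C := (abs_add_le _ _).trans (by simpa using h1)
    have h3 : 2 * |y x * y' x| ≤ y x ^ 2 + y' x ^ 2 := by
      rw [abs_mul, ← sq_abs (y x), ← sq_abs (y' x)]
      nlinarith [sq_nonneg (|y x| - |y' x|)]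
    have h4 : 2 * (1 + q x) * (y x * y' x) ≤ |1 + q x| * (2 * |y x * y' x|) := by
      calc 2 * (1 + q x) * (y x * y' x) ≤ |2 * (1 + q x) * (y x * y' x)| := le_abs_self _
        _ = |1 + q x| * (2 * |y x * y' x|) := by
          rw [abs_mul, abs_mul, abs_two]; ring
    have h5 : |1 + q x| * (2 * |y x * y' x|) ≤ (1 + C) * (y x ^ 2 + y' x ^ 2) :=
      mul_le_mul h2 h3 (by positivity) ((abs_nonneg _).trans h2)
    linarith
  intro x hx
  have h1 := hanti ⟨le_rfl, hx.1.trans hx.2⟩ hx hx.1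
  simp only [h0, h0', ne_eq, OfNat.ofNat_ne_zero, not_false_eq_true, zero_pow, add_zero,
    zero_mul] at h1
  have h2 : y x ^ 2 + y' x ^ 2 ≤ 0 := by
    by_contra h
    push Not at h
    exact absurd h1 (not_le.mpr (mul_pos h (Real.exp_pos _)))
  constructor <;> nlinarith [sq_nonneg (y x), sq_nonneg (y' x)]

/-- The Wronskian of two solutions is constant. -/
theorem wronskian_eq (hy : IsSol b q y y') (hz : IsSol b q z z') :
    ∀ x ∈ Icc 0 b, y' x * z x - y x * z' x = y' 0 * z 0 - y 0 * z' 0 := by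
  have hd : ∀ x ∈ Icc 0 b, HasDerivAt (fun x => y' x * z x - y x * z' x) 0 x := fun x hx =>
    (((hy.hasDerivAt_deriv x hx).fun_mul (hz.hasDerivAt x)).fun_sub
      ((hy.hasDerivAt x).fun_mul (hz.hasDerivAt_deriv x hx))).congr_deriv (by ring)
  exact constant_of_has_deriv_right_zero
    (fun x hx => (hd x hx).continuousAt.continuousWithinAt)
    fun x hx => (hd x (Ico_subset_Icc_self hx)).hasDerivWithinAt

end IsSol

/-! ### Convexity of the potential over the squared force -/

/-- The nonlinear force `t^(α+1) - ω t`: the wave equation is `φ'' = -force α ω φ`. -/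
noncomputable def force (α ω t : ℝ) : ℝ := t * (t ^ α - ω)

/-- The derivative `(α+1) t^α - ω` of the force. -/
noncomputable def forceDeriv (α ω t : ℝ) : ℝ := (α + 1) * t ^ α - ω

/-- The equilibrium `ω^(1/α)`, the positive zero of the force. -/
noncomputable def equilibrium (α ω : ℝ) : ℝ := ω ^ (1 / α)

/-- The potential of the force, normalized to vanish at the equilibrium. -/
noncomputable def potential (α ω t : ℝ) : ℝ :=
  t ^ 2 * (t ^ α / (α + 2) - ω / 2) + equilibrium α ω ^ 2 * (ω * α / (2 * (α + 2)))

section Convexity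

variable {α ω t : ℝ}

theorem equilibrium_pos (hω : 0 < ω) : 0 < equilibrium α ω := Real.rpow_pos_of_pos hω _

theorem equilibrium_rpow (hω : 0 < ω) (hα : 0 < α) : equilibrium α ω ^ α = ω := by
  rw [equilibrium, ← Real.rpow_mul hω.le, one_div, inv_mul_cancel₀ hα.ne', Real.rpow_one]

theorem hasDerivAt_rpow_div (ht : 0 < t) : HasDerivAt (fun t : ℝ => t ^ α) (α * t ^ α / t) t :=
  (Real.hasDerivAt_rpow_const (Or.inl ht.ne')).congr_deriv (by
    rw [Real.rpow_sub_one ht.ne']; ring)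

theorem hasDerivAt_force (ht : 0 < t) : HasDerivAt (force α ω) (forceDeriv α ω t) t :=
  ((hasDerivAt_id t).fun_mul ((hasDerivAt_rpow_div ht).sub_const ω)).congr_deriv (by
    simp only [forceDeriv, id]; field_simp; ring)

theorem hasDerivAt_forceDeriv (ht : 0 < t) :
    HasDerivAt (forceDeriv α ω) (α * (α + 1) * t ^ α / t) t :=
  (((hasDerivAt_rpow_div ht).const_mul (α + 1)).sub_const ω).congr_deriv (by ring)

theorem hasDerivAt_potential (hα : 0 < α) (ht : 0 < t) :
    HasDerivAt (potential α ω) (force α ω t) t :=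
  ((((hasDerivAt_id t).fun_pow 2).fun_mul (((hasDerivAt_rpow_div ht).div_const (α + 2)).sub_const
    (ω / 2))).add_const _).congr_deriv (by
      simp only [force, id]; field_simp; ring)

theorem force_equilibrium (hω : 0 < ω) (hα : 0 < α) : force α ω (equilibrium α ω) = 0 := by
  rw [force, equilibrium_rpow hω hα, sub_self, mul_zero]

theorem forceDeriv_equilibrium (hω : 0 < ω) (hα : 0 < α) :
    forceDeriv α ω (equilibrium α ω) = α * ω := by
  rw [forceDeriv, equilibrium_rpow hω hα]; ring

theorem potential_equilibrium (hω : 0 < ω) (hα : 0 < α) :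
    potential α ω (equilibrium α ω) = 0 := by
  rw [potential, equilibrium_rpow hω hα]; field_simp; ring

theorem rpow_lt_of_lt_equilibrium (hω : 0 < ω) (hα : 0 < α) (ht : 0 < t)
    (h : t < equilibrium α ω) : t ^ α < ω := by
  rw [← equilibrium_rpow hω hα]; exact Real.rpow_lt_rpow ht.le h hα

theorem lt_rpow_of_equilibrium_lt (hω : 0 < ω) (hα : 0 < α)
    (h : equilibrium α ω < t) : ω < t ^ α := by
  conv_lhs => rw [← equilibrium_rpow hω hα]
  exact Real.rpow_lt_rpow (equilibrium_pos hω).le h hα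

theorem force_ne_zero (hω : 0 < ω) (hα : 0 < α) (ht : 0 < t) (h : t ≠ equilibrium α ω) :
    force α ω t ≠ 0 := by
  refine mul_ne_zero ht.ne' (sub_ne_zero.mpr ?_)
  rcases lt_or_gt_of_ne h with h | h
  · exact (rpow_lt_of_lt_equilibrium hω hα ht h).ne
  · exact (lt_rpow_of_equilibrium_lt hω hα h).ne'

/-- A `C¹` function on `(0, ∞)` that vanishes at the equilibrium and whose derivative on the segment
from the equilibrium to `t` has the sign of the force is positive at `t`. -/
theorem pos_of_deriv_sign (ht : 0 < t) (hne : t ≠ equilibrium α ω)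
    {f f' : ℝ → ℝ} (h0 : f (equilibrium α ω) = 0)
    (hd : ∀ s ∈ uIcc (equilibrium α ω) t, HasDerivAt f (f' s) s)
    (hneg : ∀ s, 0 < s → t < s → s < equilibrium α ω → f' s < 0)
    (hpos : ∀ s, equilibrium α ω < s → s < t → 0 < f' s) : 0 < f t := by
  rcases lt_or_gt_of_ne hne with h | h
  · rw [uIcc_of_ge h.le] at hd
    have : StrictAntiOn f (Icc t (equilibrium α ω)) := by
      refine strictAntiOn_of_deriv_neg (convex_Icc _ _)
        (fun x hx => (hd x hx).continuousAt.continuousWithinAt) fun x hx => ?_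
      rw [(hd x (interior_subset hx)).deriv]
      rw [interior_Icc] at hx
      exact hneg x (ht.trans hx.1) hx.1 hx.2
    have := this (left_mem_Icc.mpr h.le) (right_mem_Icc.mpr h.le) h
    rwa [h0] at this
  · rw [uIcc_of_le h.le] at hd
    have : StrictMonoOn f (Icc (equilibrium α ω) t) := by
      refine strictMonoOn_of_deriv_pos (convex_Icc _ _)
        (fun x hx => (hd x hx).continuousAt.continuousWithinAt) fun x hx => ?_
      rw [(hd x (interior_subset hx)).deriv]
      rw [interior_Icc] at hx
      exact hpos x hx.1 hx.2
    have := this (left_mem_Icc.mpr h.le) (right_mem_Icc.mpr h.le) h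
    rwa [h0] at this

theorem potential_pos (hω : 0 < ω) (hα : 0 < α) (ht : 0 < t) (hne : t ≠ equilibrium α ω) :
    0 < potential α ω t := by
  have hmem : ∀ s ∈ uIcc (equilibrium α ω) t, 0 < s := fun s hs =>
    (lt_min (equilibrium_pos hω) ht).trans_le hs.1
  refine pos_of_deriv_sign (f' := force α ω) ht hne (potential_equilibrium hω hα)
    (fun s hs => hasDerivAt_potential hα (hmem s hs)) ?_ ?_
  · intro s hs _ h
    exact mul_neg_of_pos_of_neg hs (sub_neg.mpr (rpow_lt_of_lt_equilibrium hω hα hs h))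
  · intro s h _
    exact mul_pos ((equilibrium_pos hω).trans h) (sub_pos.mpr (lt_rpow_of_equilibrium_lt hω hα h))

/-- The quantity `6 h'² - 2 h h''` for the force `h`. -/
noncomputable def schaafDenom (α ω t : ℝ) : ℝ :=
  6 * forceDeriv α ω t ^ 2 - 2 * (α * (α + 1) * t ^ α * (t ^ α - ω))

theorem schaafDenom_pos (hω : 0 < ω) (hα : 0 < α) (ht : 0 < t) (h : 0 < forceDeriv α ω t) :
    0 < schaafDenom α ω t := by
  rw [schaafDenom]
  unfold forceDeriv at *
  have hv : 0 < t ^ α := Real.rpow_pos_of_pos ht α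
  generalize t ^ α = v at *
  rcases le_or_gt v ω with hvω | hvω
  · have : 0 ≤ α * (α + 1) * v * (ω - v) := mul_nonneg (by positivity) (sub_nonneg.mpr hvω)
    nlinarith [pow_pos h 2]
  · obtain ⟨m, rfl⟩ : ∃ m, v = m + ω := ⟨v - ω, by ring⟩
    have hm : 0 < m := by linarith
    have e : 6 * ((α + 1) * (m + ω) - ω) ^ 2 - 2 * (α * (α + 1) * (m + ω) * (m + ω - ω)) =
        4 * α ^ 2 * m ^ 2 + 10 * α * m ^ 2 + 6 * m ^ 2 + 10 * α * (α + 1) * m * ω +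
          6 * α ^ 2 * ω ^ 2 := by ring
    rw [e]
    positivity

/-- The derivative of `W - 3 h² h' / (6 h'² - 2 h h'')` is a positive multiple of `h³`. -/
theorem hasDerivAt_schaaf (hα : 0 < α) (ht : 0 < t) (hD : 0 < schaafDenom α ω t) :
    HasDerivAt (fun t => potential α ω t - 3 * force α ω t ^ 2 * forceDeriv α ω t /
        schaafDenom α ω t)
      (2 * force α ω t ^ 3 * (α * (α + 1) * t ^ α / t ^ 2 * ((2 * α + 3) * ((α + 1) * t ^ α) +
        3 * (α - 1) * ω)) / schaafDenom α ω t ^ 2) t := by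
  have hden : HasDerivAt (schaafDenom α ω)
      (12 * forceDeriv α ω t * (α * (α + 1) * t ^ α / t) - 2 * (α * (α + 1) * (α * t ^ α / t) *
        (t ^ α - ω) + α * (α + 1) * t ^ α * (α * t ^ α / t))) t :=
    ((((hasDerivAt_forceDeriv ht).fun_pow 2).const_mul 6).fun_sub
      ((((hasDerivAt_rpow_div ht).const_mul (α * (α + 1))).fun_mul
        ((hasDerivAt_rpow_div ht).sub_const ω)).const_mul 2)).congr_deriv (by push_cast; ring)
  have hnum := (((hasDerivAt_force (α := α) (ω := ω) ht).fun_pow 2).const_mul 3).fun_mul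
    (hasDerivAt_forceDeriv (α := α) (ω := ω) ht)
  refine ((hasDerivAt_potential hα ht).fun_sub (hnum.fun_div hden hD.ne')).congr_deriv ?_
  have hD' := hD.ne'
  rw [← sub_eq_zero]
  field_simp
  unfold schaafDenom force forceDeriv
  generalize t ^ α = v
  push_cast
  ring

/-- Positivity of `h⁴ (W / h²)''`, that is, convexity of `W / h²`, where `W` is the potential of the
force `h`. Where `h' > 0` this follows from Schaaf's condition `5 h''² > 3 h' h'''`; where
`h' ≤ 0` every term has the right sign. -/
theorem convexity_pos (hω : 0 < ω) (hα : 0 < α) (ht : 0 < t) (hne : t ≠ equilibrium α ω) :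
    0 < potential α ω t * schaafDenom α ω t - 3 * force α ω t ^ 2 * forceDeriv α ω t := by
  have hW := potential_pos hω hα ht hne
  rcases le_or_gt (forceDeriv α ω t) 0 with h | h
  · have hv : 0 < t ^ α := Real.rpow_pos_of_pos ht α
    have hlt : t ^ α < ω := by
      unfold forceDeriv at h
      nlinarith [mul_pos hα hv]
    have h1 : 0 < schaafDenom α ω t := by
      have : 0 < α * (α + 1) * t ^ α * (ω - t ^ α) :=
        mul_pos (by positivity) (sub_pos.mpr hlt)
      rw [schaafDenom]
      nlinarith [sq_nonneg (forceDeriv α ω t)]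
    have h2 := mul_pos hW h1
    have h3 : force α ω t ^ 2 * forceDeriv α ω t ≤ 0 := mul_nonpos_of_nonneg_of_nonpos
      (sq_nonneg _) h
    linarith
  · have hE := equilibrium_pos (α := α) hω
    have hmem : ∀ s ∈ uIcc (equilibrium α ω) t, 0 < s ∧ 0 < forceDeriv α ω s := by
      intro s hs
      have h0 : 0 < s := (lt_min hE ht).trans_le hs.1
      refine ⟨h0, ?_⟩
      have h1 : min (equilibrium α ω) t ^ α ≤ s ^ α :=
        Real.rpow_le_rpow (lt_min hE ht).le hs.1 hα.le
      have h2 : 0 < forceDeriv α ω (min (equilibrium α ω) t) := by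
        rcases min_choice (equilibrium α ω) t with e | e <;> rw [e]
        · rw [forceDeriv_equilibrium hω hα]; positivity
        · exact h
      unfold forceDeriv at *
      nlinarith
    have hS : ∀ s ∈ uIcc (equilibrium α ω) t, 0 < α * (α + 1) * s ^ α / s ^ 2 *
        ((2 * α + 3) * ((α + 1) * s ^ α) + 3 * (α - 1) * ω) / schaafDenom α ω s ^ 2 := by
      intro s hs
      obtain ⟨h0, h1⟩ := hmem s hs
      have hv : 0 < s ^ α := Real.rpow_pos_of_pos h0 α
      have h2 := schaafDenom_pos hω hα h0 h1
      have h3 : 0 < (2 * α + 3) * ((α + 1) * s ^ α) + 3 * (α - 1) * ω := by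
        unfold forceDeriv at h1
        nlinarith [mul_pos hα hω]
      positivity
    have key := pos_of_deriv_sign (t := t) (α := α) ht hne
      (f := fun t => potential α ω t - 3 * force α ω t ^ 2 * forceDeriv α ω t /
        schaafDenom α ω t) (by
          simp only [potential_equilibrium hω hα, force_equilibrium hω hα]; simp)
      (fun s hs => hasDerivAt_schaaf hα (hmem s hs).1
        (schaafDenom_pos hω hα (hmem s hs).1 (hmem s hs).2)) ?_ ?_
    · have h2 := schaafDenom_pos hω hα ht h
      simp only [sub_pos] at key
      rw [div_lt_iff₀ h2] at key
      linarith
    · intro s hs h1 h2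
      have hs' := hS s (by rw [uIcc_of_ge (h1.trans h2).le]; exact ⟨h1.le, h2.le⟩)
      have hf : force α ω s < 0 :=
        mul_neg_of_pos_of_neg hs (sub_neg.mpr (rpow_lt_of_lt_equilibrium hω hα hs h2))
      have hf3 : force α ω s ^ 3 < 0 := Odd.pow_neg (by decide) hf
      rw [mul_div_assoc]
      exact mul_neg_of_neg_of_pos (by linarith) hs'
    · intro s h1 h2
      have hs' := hS s (by rw [uIcc_of_le (h1.trans h2).le]; exact ⟨h1.le, h2.le⟩)
      have hf : 0 < force α ω s := mul_pos (hE.trans h1)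
        (sub_pos.mpr (lt_rpow_of_equilibrium_lt hω hα h1))
      rw [mul_div_assoc]
      positivity

theorem analyticAt_rpow_const (ht : 0 < t) : AnalyticAt ℝ (fun t : ℝ => t ^ α) t := by
  have h : AnalyticAt ℝ (fun t : ℝ => Real.exp (Real.log t * α)) t :=
    analyticAt_rexp.comp ((analyticAt_log ht).mul analyticAt_const)
  refine h.congr ?_
  filter_upwards [lt_mem_nhds ht] with s hs
  rw [Real.rpow_def_of_pos hs]

theorem analyticAt_dslope {f : ℝ → ℝ} {a b : ℝ} (ha : AnalyticAt ℝ f a) (hb : AnalyticAt ℝ f b) :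
    AnalyticAt ℝ (dslope f a) b := by
  rcases eq_or_ne b a with rfl | h
  · obtain ⟨p, hp⟩ := ha
    exact ⟨_, hp.has_fpower_series_dslope_fslope⟩
  · have : AnalyticAt ℝ (slope f a) b :=
      ((analyticAt_id.sub analyticAt_const).inv (sub_ne_zero.mpr h)).smul
        (hb.sub analyticAt_const)
    exact this.congr (dslope_eventuallyEq_slope_of_ne f h).symm

/-- The quotient `R = W / h²` extends to a convex `C²` function on `(0, ∞)`, strictly convex away from
the equilibrium, which satisfies `h R' + 2 h' R = 1`. The extension across the equilibrium is the
quotient of iterated difference quotients of the analytic functions `W` and `h`. -/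
theorem exists_convex_quotient (hω : 0 < ω) (hα : 0 < α) : ∃ R R₁ R₂ : ℝ → ℝ,
    (∀ t, 0 < t → HasDerivAt R (R₁ t) t) ∧ (∀ t, 0 < t → HasDerivAt R₁ (R₂ t) t) ∧
    (∀ t, 0 < t → force α ω t * R₁ t + 2 * forceDeriv α ω t * R t = 1) ∧
    (∀ t, 0 < t → 0 ≤ R₂ t) ∧ ∀ t, 0 < t → t ≠ equilibrium α ω → 0 < R₂ t := by
  set e := equilibrium α ω with he
  have hE : 0 < e := equilibrium_pos hω
  have hWan : ∀ t, 0 < t → AnalyticAt ℝ (potential α ω) t := fun t ht =>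
    (((analyticAt_id.pow 2).mul (((analyticAt_rpow_const ht).div_const).sub
      analyticAt_const)).add analyticAt_const)
  have hhan : ∀ t, 0 < t → AnalyticAt ℝ (force α ω) t := fun t ht =>
    analyticAt_id.mul ((analyticAt_rpow_const ht).sub analyticAt_const)
  have hW1 : dslope (potential α ω) e e = 0 := by
    rw [dslope_same, (hasDerivAt_potential hα hE).deriv, force_equilibrium hω hα]
  have hh1 : dslope (force α ω) e e ≠ 0 := by
    rw [dslope_same, (hasDerivAt_force hE).deriv, forceDeriv_equilibrium hω hα]
    positivity
  have hhne : ∀ t, 0 < t → dslope (force α ω) e t ≠ 0 := by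
    intro t ht
    rcases eq_or_ne t e with rfl | h
    · exact hh1
    · rw [dslope_of_ne _ h, slope_def_field, force_equilibrium hω hα, sub_zero]
      exact div_ne_zero (force_ne_zero hω hα ht h) (sub_ne_zero.mpr h)
  let R : ℝ → ℝ := fun t => dslope (dslope (potential α ω) e) e t / dslope (force α ω) e t ^ 2
  have hRan : ∀ t, 0 < t → AnalyticAt ℝ R t := fun t ht =>
    (analyticAt_dslope (analyticAt_dslope (hWan e hE) (hWan e hE))
      (analyticAt_dslope (hWan e hE) (hWan t ht))).div
      ((analyticAt_dslope (hhan e hE) (hhan t ht)).pow 2) (pow_ne_zero 2 (hhne t ht))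
  have hRmul : ∀ t, 0 < t → R t * force α ω t ^ 2 = potential α ω t := by
    intro t ht
    rcases eq_or_ne t e with rfl | h
    · rw [force_equilibrium hω hα, potential_equilibrium hω hα]; simp
    · have h' := sub_ne_zero.mpr h
      have hf := force_ne_zero hω hα ht h
      have e1 : dslope (dslope (potential α ω) e) e t = potential α ω t / (t - e) ^ 2 := by
        rw [dslope_of_ne _ h, slope_def_field, hW1, dslope_of_ne _ h, slope_def_field,
          potential_equilibrium hω hα]
        field_simp
        ring
      have e2 : dslope (force α ω) e t = force α ω t / (t - e) := by
        rw [dslope_of_ne _ h, slope_def_field, force_equilibrium hω hα, sub_zero]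
      simp only [R, e1, e2]
      field_simp
  have hd1 : ∀ t, 0 < t → HasDerivAt R (deriv R t) t := fun t ht =>
    (hRan t ht).differentiableAt.hasDerivAt
  have hd2 : ∀ t, 0 < t → HasDerivAt (deriv R) (deriv (deriv R) t) t := fun t ht =>
    (hRan t ht).deriv.differentiableAt.hasDerivAt
  have hpunct : ∀ᶠ t in nhdsWithin e {e}ᶜ, 0 < t ∧ t ≠ e := by
    filter_upwards [nhdsWithin_le_nhds (lt_mem_nhds hE), self_mem_nhdsWithin] with t h1 h2
    exact ⟨h1, h2⟩
  have hode' : ∀ t, 0 < t → t ≠ e →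
      force α ω t * deriv R t + 2 * forceDeriv α ω t * R t = 1 := by
    intro t ht hne
    have h1 := (hd1 t ht).fun_mul ((hasDerivAt_force (α := α) (ω := ω) ht).fun_pow 2)
    have h2 : (fun t => R t * force α ω t ^ 2) =ᶠ[nhds t] potential α ω := by
      filter_upwards [lt_mem_nhds ht] with s hs
      exact hRmul s hs
    have h3 := (h1.congr_of_eventuallyEq h2.symm).unique (hasDerivAt_potential hα ht)
    have hf := force_ne_zero hω hα ht hne
    refine mul_left_cancel₀ hf ?_
    push_cast at h3
    linear_combination h3
  have hode : ∀ t, 0 < t → force α ω t * deriv R t + 2 * forceDeriv α ω t * R t = 1 := by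
    intro t ht
    rcases eq_or_ne t e with rfl | hne
    · have hc : ContinuousAt (fun t => force α ω t * deriv R t + 2 * forceDeriv α ω t * R t) e :=
        ((hhan e ht).continuousAt.mul (hd2 e ht).continuousAt).add
          ((continuousAt_const.mul (hasDerivAt_forceDeriv ht).continuousAt).mul
            (hd1 e ht).continuousAt)
      refine tendsto_nhds_unique (l := nhdsWithin e {e}ᶜ) (hc.tendsto.mono_left nhdsWithin_le_nhds)
        (tendsto_const_nhds.congr' ?_)
      filter_upwards [hpunct] with s hs
      exact (hode' s hs.1 hs.2).symm
    · exact hode' t ht hne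
  have hR2 : ∀ t, 0 < t → t ≠ e → 0 < deriv (deriv R) t := by
    intro t ht hne
    have h1 := ((hasDerivAt_force (α := α) (ω := ω) ht).fun_mul (hd2 t ht)).fun_add
      (((hasDerivAt_forceDeriv (α := α) (ω := ω) ht).const_mul 2).fun_mul (hd1 t ht))
    have h2 : (fun t => force α ω t * deriv R t + 2 * forceDeriv α ω t * R t) =ᶠ[nhds t]
        fun _ => 1 := by
      filter_upwards [lt_mem_nhds ht] with s hs
      exact hode s hs
    have h3 := (h1.congr_of_eventuallyEq h2.symm).unique (hasDerivAt_const t 1)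
    have h4 := convexity_pos hω hα ht hne
    have hf := force_ne_zero hω hα ht hne
    have h5 : α * (α + 1) * t ^ α / t * force α ω t = α * (α + 1) * t ^ α * (t ^ α - ω) := by
      rw [force]; field_simp
    have h6 : potential α ω t * schaafDenom α ω t - 3 * force α ω t ^ 2 * forceDeriv α ω t =
        force α ω t ^ 4 * deriv (deriv R) t := by
      rw [← hRmul t ht, schaafDenom, ← h5]
      linear_combination (-force α ω t ^ 3) * h3 + 3 * force α ω t ^ 2 * forceDeriv α ω t *
        hode t ht
    rw [h6] at h4
    exact pos_of_mul_pos_right h4 (by positivity)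
  refine ⟨R, deriv R, deriv (deriv R), hd1, hd2, hode, fun t ht => ?_, hR2⟩
  rcases eq_or_ne t e with rfl | hne
  · refine ge_of_tendsto (x := nhdsWithin e {e}ᶜ)
      ((hRan e ht).deriv.deriv.continuousAt.tendsto.mono_left nhdsWithin_le_nhds) ?_
    filter_upwards [hpunct] with s hs
    exact (hR2 s hs.1 hs.2).le
  · exact (hR2 t ht hne).le

end Convexity

/-! ### The wave and the kernel of its linearization -/

/-- The potential of `𝓛₁`. -/
noncomputable abbrev pot₁ (ω α : ℝ) (φ : ℝ → ℝ) : ℝ → ℝ := fun x => ω - (α + 1) * |φ x| ^ α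

/-- The potential of `𝓛₂`. -/
noncomputable abbrev pot₂ (ω α : ℝ) (φ : ℝ → ℝ) : ℝ → ℝ := fun x => ω - |φ x| ^ α

namespace IsEvenPositiveWave

variable {L ω α : ℝ} {φ : ℝ → ℝ}

theorem hasDerivAt (hφ : IsEvenPositiveWave L ω α φ) (x : ℝ) : HasDerivAt φ (deriv φ x) x :=
  (hφ.contDiff.differentiable (by norm_num) x).hasDerivAt

theorem continuous (hφ : IsEvenPositiveWave L ω α φ) : Continuous φ := hφ.contDiff.continuous

theorem continuous_deriv (hφ : IsEvenPositiveWave L ω α φ) : Continuous (deriv φ) :=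
  hφ.contDiff.continuous_deriv (by norm_num)

theorem hasDerivAt_deriv (hφ : IsEvenPositiveWave L ω α φ) (x : ℝ) :
    HasDerivAt (deriv φ) (-force α ω (φ x)) x := by
  have h1 : ContDiff ℝ 1 (deriv φ) := hφ.contDiff.deriv'
  have h := (h1.differentiable (by norm_num) x).hasDerivAt
  have e := hφ.ode x
  rw [abs_of_pos (hφ.pos x)] at e
  exact h.congr_deriv (by rw [force]; linarith)

theorem hasDerivAt_comp (hφ : IsEvenPositiveWave L ω α φ) {f f' : ℝ → ℝ}
    (hf : ∀ t, 0 < t → HasDerivAt f (f' t) t) (x : ℝ) :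
    HasDerivAt (fun x => f (φ x)) (f' (φ x) * deriv φ x) x :=
  (hf (φ x) (hφ.pos x)).comp x (hφ.hasDerivAt x)

theorem pot₁_eq (hφ : IsEvenPositiveWave L ω α φ) (x : ℝ) :
    pot₁ ω α φ x = -forceDeriv α ω (φ x) := by
  rw [pot₁, forceDeriv, abs_of_pos (hφ.pos x)]; ring

theorem continuous_pot₁ (hφ : IsEvenPositiveWave L ω α φ) (hα : 0 < α) :
    Continuous (pot₁ ω α φ) :=
  continuous_const.sub (continuous_const.mul (continuous_abs_rpow hφ.continuous hα))

theorem continuous_pot₂ (hφ : IsEvenPositiveWave L ω α φ) (hα : 0 < α) :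
    Continuous (pot₂ ω α φ) :=
  continuous_const.sub (continuous_abs_rpow hφ.continuous hα)

theorem continuous_force (hφ : IsEvenPositiveWave L ω α φ) :
    Continuous fun x => force α ω (φ x) :=
  continuous_iff_continuousAt.mpr fun x =>
    (hφ.hasDerivAt_comp (fun _ ht => hasDerivAt_force ht) x).continuousAt

theorem isSol_deriv (hφ : IsEvenPositiveWave L ω α φ) (b : ℝ) :
    IsSol b (pot₁ ω α φ) (deriv φ) (fun x => -force α ω (φ x)) where
  hasDerivAt := hφ.hasDerivAt_deriv
  continuous_deriv := hφ.continuous_force.neg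
  hasDerivAt_deriv x _ :=
    (hφ.hasDerivAt_comp (fun _ ht => hasDerivAt_force ht) x).fun_neg.congr_deriv (by
      rw [hφ.pot₁_eq]; ring)

theorem isSol_self (hφ : IsEvenPositiveWave L ω α φ) (b : ℝ) :
    IsSol b (pot₂ ω α φ) φ (deriv φ) where
  hasDerivAt := hφ.hasDerivAt
  continuous_deriv := hφ.continuous_deriv
  hasDerivAt_deriv x _ := (hφ.hasDerivAt_deriv x).congr_deriv (by
    rw [force, pot₂, abs_of_pos (hφ.pos x)]; ring)

theorem apply_sub (hφ : IsEvenPositiveWave L ω α φ) (x : ℝ) : φ (L - x) = φ x := by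
  rw [← hφ.even, neg_sub, ← hφ.periodic, sub_add_cancel]

theorem pot₁_sub (hφ : IsEvenPositiveWave L ω α φ) (x : ℝ) :
    pot₁ ω α φ (L - x) = pot₁ ω α φ x := by
  simp only [pot₁, hφ.apply_sub]

theorem deriv_sub (hφ : IsEvenPositiveWave L ω α φ) (x : ℝ) :
    deriv φ (L - x) = -deriv φ x := by
  have h : HasDerivAt (fun x => φ (L - x)) (deriv φ (L - x) * -1) x :=
    (hφ.hasDerivAt (L - x)).comp x ((hasDerivAt_id x).const_sub L)
  have h2 : (fun x => φ (L - x)) = φ := funext hφ.apply_sub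
  rw [h2] at h
  have := h.unique (hφ.hasDerivAt x)
  linarith

theorem deriv_periodic (hφ : IsEvenPositiveWave L ω α φ) : Function.Periodic (deriv φ) L := by
  intro x
  have h : HasDerivAt (fun x => φ (x + L)) (deriv φ (x + L)) x :=
    (hφ.hasDerivAt (x + L)).comp_add_const x L
  have h2 : (fun x => φ (x + L)) = φ := funext hφ.periodic
  rw [h2] at h
  exact h.unique (hφ.hasDerivAt x)

theorem deriv_zero (hφ : IsEvenPositiveWave L ω α φ) : deriv φ 0 = 0 := by
  have h1 := hφ.deriv_sub 0
  have h2 := hφ.deriv_periodic 0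
  rw [sub_zero] at h1
  rw [zero_add] at h2
  linarith

theorem deriv_half (hφ : IsEvenPositiveWave L ω α φ) : deriv φ (L / 2) = 0 := by
  have h := hφ.deriv_sub (L / 2)
  rw [sub_half] at h
  linarith

/-- A nonconstant wave is not at equilibrium at a critical point; otherwise `φ'`, which solves the
linearized equation, would have vanishing Cauchy data there. -/
theorem force_ne_zero (hφ : IsEvenPositiveWave L ω α φ) (hL : 0 < L) (hα : 0 < α)
    (hnc : ∃ x y, φ x ≠ φ y) : force α ω (φ 0) ≠ 0 := by
  intro h0
  have hz := (hφ.isSol_deriv L).eq_zero (hφ.continuous_pot₁ hα) hφ.deriv_zero (by simp [h0])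
  have hc : ∀ x ∈ Icc 0 L, φ x = φ 0 := constant_of_has_deriv_right_zero
    hφ.continuous.continuousOn fun x hx => by
      have h := hφ.hasDerivAt x
      rw [(hz x (Ico_subset_Icc_self hx)).1] at h
      exact h.hasDerivWithinAt
  obtain ⟨x, y, hxy⟩ := hnc
  obtain ⟨x', hx', ex⟩ := hφ.periodic.exists_mem_Ico₀ hL x
  obtain ⟨y', hy', ey⟩ := hφ.periodic.exists_mem_Ico₀ hL y
  exact hxy (by rw [ex, ey, hc _ (Ico_subset_Icc_self hx'), hc _ (Ico_subset_Icc_self hy')])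

/-- The linearized equation has no nonzero solution satisfying Neumann conditions on the half
period. This is the monotonicity of the period with respect to the energy, in the guise of an
identity: with `R = W / h²` and the constant Wronskian `B = e' φ' - e φ''`, the function
`e' R h - e φ' / 2 + B φ' R' / 2` vanishes at both ends, while its derivative is
`B φ'² R'' / 2`. -/
theorem neumann_kernel_eq_zero (hφ : IsEvenPositiveWave L ω α φ) (hL : 0 < L) (hω : 0 < ω)
    (hα : 0 < α) (hnc : ∃ x y, φ x ≠ φ y) {e e' : ℝ → ℝ} (he : IsSol (L / 2) (pot₁ ω α φ) e e')
    (h0 : e' 0 = 0) (h1 : e' (L / 2) = 0) : e 0 = 0 := by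
  obtain ⟨R, R₁, R₂, hR, hR₁, hid, hnn, hpos⟩ := exists_convex_quotient (α := α) hω hα
  have hf0 := hφ.force_ne_zero hL hα hnc
  by_contra hne
  set B := e 0 * force α ω (φ 0) with hB
  have hB0 : B ≠ 0 := mul_ne_zero hne hf0
  have hW : ∀ x ∈ Icc 0 (L / 2), e' x * deriv φ x + e x * force α ω (φ x) = B := by
    intro x hx
    have h := he.wronskian_eq (hφ.isSol_deriv (L / 2)) x hx
    rw [hφ.deriv_zero] at h
    linarith
  let Z : ℝ → ℝ := fun x => B⁻¹ * (e' x * (R (φ x) * force α ω (φ x)) - 1 / 2 * (e x * deriv φ x))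
    + 1 / 2 * (deriv φ x * R₁ (φ x))
  have hZ : ∀ x ∈ Icc 0 (L / 2), HasDerivAt Z (1 / 2 * (deriv φ x ^ 2 * R₂ (φ x))) x := by
    intro x hx
    have d1 := (he.hasDerivAt_deriv x hx).fun_mul ((hφ.hasDerivAt_comp hR x).fun_mul
      (hφ.hasDerivAt_comp (fun t ht => hasDerivAt_force (α := α) (ω := ω) ht) x))
    have d2 := ((he.hasDerivAt x).fun_mul (hφ.hasDerivAt_deriv x)).const_mul (1 / 2)
    have d3 := ((hφ.hasDerivAt_deriv x).fun_mul (hφ.hasDerivAt_comp hR₁ x)).const_mul (1 / 2)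
    refine (((d1.fun_sub d2).const_mul B⁻¹).fun_add d3).congr_deriv ?_
    have i1 := hid (φ x) (hφ.pos x)
    have i2 := hW x hx
    rw [hφ.pot₁_eq]
    have hBB : B⁻¹ * B = 1 := inv_mul_cancel₀ hB0
    generalize force α ω (φ x) = f at *
    generalize forceDeriv α ω (φ x) = f' at *
    generalize R₁ (φ x) = r₁ at *
    generalize R (φ x) = r at *
    linear_combination (1 / 2) * f * r₁ * hBB + B⁻¹ * (1 / 2) * (f * r₁) * i2 +
      B⁻¹ * (1 / 2) * (e' x * deriv φ x - e x * f) * i1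
  have hend : Z 0 = 0 ∧ Z (L / 2) = 0 := by
    simp [Z, h0, h1, hφ.deriv_zero, hφ.deriv_half]
  have hmono : MonotoneOn Z (Icc 0 (L / 2)) := by
    refine monotoneOn_of_deriv_nonneg (convex_Icc _ _)
      (fun x hx => (hZ x hx).continuousAt.continuousWithinAt)
      (fun x hx => (hZ x (interior_subset hx)).differentiableAt.differentiableWithinAt)
      fun x hx => ?_
    rw [(hZ x (interior_subset hx)).deriv]
    have := hnn (φ x) (hφ.pos x)
    positivity
  have hZ0 : ∀ x ∈ Icc 0 (L / 2), Z x = 0 := fun x hx => le_antisymm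
    (hend.2 ▸ hmono hx (right_mem_Icc.mpr (by linarith)) hx.2)
    (hend.1 ▸ hmono (left_mem_Icc.mpr (by linarith)) hx hx.1)
  -- near `0` the wave is away from the equilibrium, so `φ' = 0` there
  have hφ0 : φ 0 ≠ equilibrium α ω := fun h => hf0 (by rw [h, force_equilibrium hω hα])
  have hev : ∀ᶠ x in nhdsWithin 0 (Ioi 0), deriv φ x = 0 := by
    filter_upwards [nhdsWithin_le_nhds (hφ.continuous.continuousAt.eventually_ne hφ0),
      Ioo_mem_nhdsGT (show (0 : ℝ) < L / 2 by linarith)] with x hx hxI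
    have hx' := Ioo_subset_Icc_self hxI
    have h2 : Z =ᶠ[nhds x] fun _ => 0 := by
      filter_upwards [Ioo_mem_nhds hxI.1 hxI.2] with y hy
      exact hZ0 y (Ioo_subset_Icc_self hy)
    have h3 := ((hZ x hx').congr_of_eventuallyEq h2.symm).unique (hasDerivAt_const x 0)
    have h4 := hpos (φ x) (hφ.pos x) hx
    by_contra hc
    have : 0 < deriv φ x ^ 2 := by positivity
    nlinarith [mul_pos this h4]
  have hd := (hφ.hasDerivAt_deriv 0).hasDerivWithinAt (s := Ici 0)
  have hd' : HasDerivWithinAt (deriv φ) 0 (Ici 0) 0 := by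
    refine (hasDerivWithinAt_const (0 : ℝ) (Ici 0) (0 : ℝ)).congr_of_eventuallyEq ?_ hφ.deriv_zero
    rw [← Ioi_insert, nhdsWithin_insert]
    exact Filter.eventually_sup.mpr ⟨by simpa using hφ.deriv_zero, hev⟩
  have := (uniqueDiffWithinAt_Ici (0 : ℝ)).eq_deriv _ hd hd'
  exact hf0 (by linarith)

/-- The periodic solutions of the linearized equation are the multiples of `φ'`. -/
theorem kernel_linearization (hφ : IsEvenPositiveWave L ω α φ) (hL : 0 < L) (hω : 0 < ω)
    (hα : 0 < α) (hnc : ∃ x y, φ x ≠ φ y) {y y' : ℝ → ℝ} (hy : IsSol L (pot₁ ω α φ) y y')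
    (h0 : y L = y 0) (h1 : y' L = y' 0) : ∃ c : ℝ, ∀ x ∈ Icc 0 L, y x = c * deriv φ x := by
  have hf0 := hφ.force_ne_zero hL hα hnc
  have he := (hy.add (hy.reflect hφ.pot₁_sub)).mono (show L / 2 ≤ L by linarith)
  have hy0 : y 0 = 0 := by
    have := hφ.neumann_kernel_eq_zero hL hω hα hnc he (by simp [h1]) (by simp [sub_half])
    simp only [sub_zero, h0] at this
    linarith
  refine ⟨y' 0 / -force α ω (φ 0), fun x hx => ?_⟩
  have hz := ((hy.linComb 1 (-(y' 0 / -force α ω (φ 0))) (hφ.isSol_deriv L)).eq_zero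
    (hφ.continuous_pot₁ hα) (by simp [hy0, hφ.deriv_zero]) (by field_simp; ring) x hx).1
  linarith

end IsEvenPositiveWave

/-! ### Even test functions and the second variation -/

/-- The distance to the lattice `Lℤ`: the `L`-periodic even function equal to `x` on
`[0, L/2]`. -/
noncomputable def tent (L x : ℝ) : ℝ := L / (2 * Real.pi) *
  Real.arccos (Real.cos (2 * Real.pi * x / L))

section Tent

variable {L : ℝ}

theorem tent_periodic (hL : 0 < L) : Function.Periodic (tent L) L := by
  intro x
  have : 2 * Real.pi * (x + L) / L = 2 * Real.pi * x / L + 2 * Real.pi := by field_simp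
  simp only [tent, this, Real.cos_add_two_pi]

theorem tent_even : Function.Even (tent L) := by
  intro x
  have : 2 * Real.pi * (-x) / L = -(2 * Real.pi * x / L) := by ring
  simp only [tent, this, Real.cos_neg]

theorem continuous_tent : Continuous (tent L) :=
  continuous_const.mul (Real.continuous_arccos.comp (Real.continuous_cos.comp
    ((continuous_const.mul continuous_id).div_const L)))

theorem tent_of_le (hL : 0 < L) {x : ℝ} (h0 : 0 ≤ x) (h1 : x ≤ L / 2) : tent L x = x := by
  have hpi := Real.pi_pos
  rw [tent, Real.arccos_cos (by positivity) (by rw [div_le_iff₀ hL]; nlinarith)]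
  field_simp

theorem tent_of_ge (hL : 0 < L) {x : ℝ} (h0 : L / 2 ≤ x) (h1 : x ≤ L) : tent L x = L - x := by
  have h := tent_of_le hL (x := L - x) (by linarith) (by linarith)
  rw [← h, ← tent_even (L - x), neg_sub, ← tent_periodic hL (x - L), sub_add_cancel]

/-- The integral over a period of a function symmetric about `L/2`. -/
theorem integral_of_symm (hL : 0 < L) {f g : ℝ → ℝ} (hf : Continuous f)
    (h1 : ∀ x ∈ Ioo 0 (L / 2), g x = f x) (h2 : ∀ x ∈ Ioo (L / 2) L, g x = f (L - x)) :
    ∫ x in (0 : ℝ)..L, g x = 2 * ∫ x in (0 : ℝ)..(L / 2), f x := by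
  have i1 : IntervalIntegrable g volume 0 (L / 2) :=
    (hf.intervalIntegrable 0 (L / 2)).congr_uIoo fun x hx => by
      rw [uIoo_of_le (by linarith)] at hx; exact (h1 x hx).symm
  have i2 : IntervalIntegrable g volume (L / 2) L :=
    ((hf.comp (continuous_const.sub continuous_id)).intervalIntegrable (L / 2) L).congr_uIoo
      fun x hx => by
        rw [uIoo_of_le (by linarith)] at hx; exact (h2 x hx).symm
  have e1 : ∫ x in (0 : ℝ)..(L / 2), g x = ∫ x in (0 : ℝ)..(L / 2), f x :=
    intervalIntegral.integral_congr_uIoo fun x hx => by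
      rw [uIoo_of_le (by linarith)] at hx; exact h1 x hx
  have e2 : ∫ x in (L / 2)..L, g x = ∫ x in (0 : ℝ)..(L / 2), f x := by
    rw [intervalIntegral.integral_congr_uIoo (g := fun x => f (L - x)) fun x hx => by
      rw [uIoo_of_le (by linarith)] at hx; exact h2 x hx]
    rw [intervalIntegral.integral_comp_sub_left f L, sub_self, sub_half]
  rw [← intervalIntegral.integral_add_adjacent_intervals i1 i2, e1, e2]
  ring

/-- Reflecting an arbitrary `C¹` function on the half period gives an even periodic `H¹`
function; no boundary condition is needed. -/
theorem isEvenH1per_comp_tent (hL : 0 < L) {U U' : ℝ → ℝ} (hU : ∀ x, HasDerivAt U (U' x) x)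
    (hU' : Continuous U') :
    IsEvenH1per L (fun x => (U (tent L x) : ℂ))
      (fun x => ((if x ≤ L / 2 then U' x else -U' (L - x) : ℝ) : ℂ)) := by
  have hUc : Continuous U := continuous_iff_continuousAt.mpr fun x => (hU x).continuousAt
  have hm : Measurable fun x => if x ≤ L / 2 then U' x else -U' (L - x) :=
    Measurable.ite measurableSet_Iic hU'.measurable
      (hU'.comp (continuous_const.sub continuous_id)).neg.measurable
  have hvc : Continuous fun x => (U (tent L x) : ℂ) :=
    Complex.continuous_ofReal.comp (hUc.comp continuous_tent)
  have hfin : IsFiniteMeasure (volume.restrict (Ioc (0 : ℝ) L)) := ⟨by simp⟩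
  refine ⟨fun x => by simp only [tent_periodic hL x], fun x => by simp only [tent_even x], ?_, ?_, ?_⟩
  · obtain ⟨C, hC⟩ := (isCompact_Icc (a := (0 : ℝ)) (b := L)).exists_bound_of_continuousOn
      hvc.continuousOn
    refine MemLp.of_bound hvc.aestronglyMeasurable C ?_
    filter_upwards [ae_restrict_mem measurableSet_Ioc] with x hx
    exact hC x (Ioc_subset_Icc_self hx)
  · obtain ⟨C, hC⟩ := (isCompact_Icc (a := (0 : ℝ)) (b := L)).exists_bound_of_continuousOn
      hU'.continuousOn
    refine MemLp.of_bound (Complex.measurable_ofReal.comp hm).aestronglyMeasurable C ?_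
    filter_upwards [ae_restrict_mem measurableSet_Ioc] with x hx
    rw [Complex.norm_real]
    split_ifs
    · exact hC x (Ioc_subset_Icc_self hx)
    · rw [norm_neg]
      exact hC (L - x) ⟨by linarith [hx.2], by linarith [hx.1]⟩
  · intro ψ hψ hP
    have hψd : ∀ x, HasDerivAt ψ (deriv ψ x) x := fun x =>
      (hψ.differentiable (by simp) x).hasDerivAt
    have hψ' : Continuous (deriv ψ) := hψ.continuous_deriv (by simp)
    have hle : (0 : ℝ) ≤ L / 2 := by linarith
    have hle' : L / 2 ≤ L := by linarith
    have key : (∫ x in (0 : ℝ)..L, deriv ψ x * U (tent L x)) =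
        -∫ x in (0 : ℝ)..L, ψ x * (if x ≤ L / 2 then U' x else -U' (L - x)) := by
      have c1 : Continuous fun x => deriv ψ x * U (tent L x) :=
        hψ'.mul (hUc.comp continuous_tent)
      have c2 : Continuous fun x => ψ x * U' x := hψ.continuous.mul hU'
      have c3 : Continuous fun x => ψ x * -U' (L - x) :=
        hψ.continuous.mul (hU'.comp (continuous_const.sub continuous_id)).neg
      have e1 : EqOn (fun x => ψ x * U' x)
          (fun x => ψ x * (if x ≤ L / 2 then U' x else -U' (L - x))) (uIoo 0 (L / 2)) := by
        intro x hx
        rw [uIoo_of_le hle] at hx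
        simp only [if_pos hx.2.le]
      have e2 : EqOn (fun x => ψ x * -U' (L - x))
          (fun x => ψ x * (if x ≤ L / 2 then U' x else -U' (L - x))) (uIoo (L / 2) L) := by
        intro x hx
        rw [uIoo_of_le hle'] at hx
        simp only [if_neg (not_le.mpr hx.1)]
      have p1 : (∫ x in (0 : ℝ)..(L / 2), (deriv ψ x * U x + ψ x * U' x)) =
          ψ (L / 2) * U (L / 2) - ψ 0 * U 0 :=
        intervalIntegral.integral_deriv_mul_eq_sub (fun x _ => hψd x) (fun x _ => hU x)
          (hψ'.intervalIntegrable _ _) (hU'.intervalIntegrable _ _)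
      have p2 : (∫ x in (L / 2)..L, (deriv ψ x * U (L - x) + ψ x * -U' (L - x))) =
          ψ L * U 0 - ψ (L / 2) * U (L / 2) := by
        have := intervalIntegral.integral_deriv_mul_eq_sub (a := L / 2) (b := L)
          (u := ψ) (v := fun x => U (L - x)) (u' := deriv ψ) (v' := fun x => -U' (L - x))
          (fun x _ => hψd x) (fun x _ => (((hU (L - x)).comp x
            ((hasDerivAt_id x).const_sub L)).congr_deriv (by ring)))
          (hψ'.intervalIntegrable _ _)
          ((hU'.comp (continuous_const.sub continuous_id)).neg.intervalIntegrable _ _)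
        simpa [sub_half] using this
      rw [← intervalIntegral.integral_add_adjacent_intervals (c1.intervalIntegrable 0 (L / 2))
        (c1.intervalIntegrable (L / 2) L), ← intervalIntegral.integral_add_adjacent_intervals
        ((c2.intervalIntegrable 0 (L / 2)).congr_uIoo e1)
        ((c3.intervalIntegrable (L / 2) L).congr_uIoo e2),
        ← intervalIntegral.integral_congr_uIoo e1, ← intervalIntegral.integral_congr_uIoo e2]
      have d1 : ∫ x in (0 : ℝ)..(L / 2), deriv ψ x * U (tent L x) =
          ∫ x in (0 : ℝ)..(L / 2), deriv ψ x * U x :=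
        intervalIntegral.integral_congr_uIoo fun x hx => by
          rw [uIoo_of_le hle] at hx
          simp only [tent_of_le hL hx.1.le hx.2.le]
      have d2 : ∫ x in (L / 2)..L, deriv ψ x * U (tent L x) =
          ∫ x in (L / 2)..L, deriv ψ x * U (L - x) :=
        intervalIntegral.integral_congr_uIoo fun x hx => by
          rw [uIoo_of_le hle'] at hx
          simp only [tent_of_ge hL hx.1.le hx.2.le]
      have c4 : Continuous fun x => deriv ψ x * U x := hψ'.mul hUc
      have c5 : Continuous fun x => deriv ψ x * U (L - x) :=
        hψ'.mul (hUc.comp (continuous_const.sub continuous_id))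
      rw [d1, d2]
      rw [intervalIntegral.integral_add (c4.intervalIntegrable _ _)
        (c2.intervalIntegrable _ _)] at p1
      rw [intervalIntegral.integral_add (c5.intervalIntegrable _ _)
        (c3.intervalIntegrable _ _)] at p2
      have hp : ψ L = ψ 0 := by simpa using hP 0
      rw [hp] at p2
      linarith
    have := congrArg (fun r : ℝ => (r : ℂ)) key
    simp only [Complex.ofReal_neg, ← intervalIntegral.integral_ofReal] at this
    simpa only [Complex.real_smul, ← Complex.ofReal_mul] using this

end Tent

/-- The weak form of `y'' = q y`. -/
theorem IsSol.integral_eq {b : ℝ} {q y y' w w' : ℝ → ℝ} (hb : 0 ≤ b) (hy : IsSol b q y y')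
    (hq : Continuous q) (hw : ∀ x, HasDerivAt w (w' x) x) (hw' : Continuous w') :
    ∫ x in (0 : ℝ)..b, (y' x * w' x + q x * (y x * w x)) = y' b * w b - y' 0 * w 0 := by
  have hwc : Continuous w := continuous_iff_continuousAt.mpr fun x => (hw x).continuousAt
  have h := intervalIntegral.integral_deriv_mul_eq_sub (a := 0) (b := b) (u := y') (v := w)
    (u' := fun x => q x * y x) (v' := w')
    (fun x hx => hy.hasDerivAt_deriv x (by rwa [uIcc_of_le hb] at hx)) (fun x _ => hw x)
    ((hq.mul hy.continuous).intervalIntegrable _ _) (hw'.intervalIntegrable _ _)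
  rw [← h]
  refine intervalIntegral.integral_congr fun x _ => ?_
  ring

/-- A function on `[0, 1]` whose second derivative is at least `C`. -/
theorem add_half_le_of_deriv2_ge {g g' g'' : ℝ → ℝ} {C : ℝ}
    (hg : ∀ s ∈ Icc (0 : ℝ) 1, HasDerivAt g (g' s) s)
    (hg' : ∀ s ∈ Icc (0 : ℝ) 1, HasDerivAt g' (g'' s) s) (hC : ∀ s ∈ Icc (0 : ℝ) 1, C ≤ g'' s) :
    g 0 + g' 0 + C / 2 ≤ g 1 := by
  have d1 : ∀ s ∈ Icc (0 : ℝ) 1, HasDerivAt (fun s => g' s - C * s) (g'' s - C) s := fun s hs =>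
    ((hg' s hs).fun_sub ((hasDerivAt_id s).const_mul C)).congr_deriv (by ring)
  have m1 : MonotoneOn (fun s => g' s - C * s) (Icc 0 1) :=
    monotoneOn_of_deriv_nonneg (convex_Icc _ _)
      (fun s hs => (d1 s hs).continuousAt.continuousWithinAt)
      (fun s hs => (d1 s (interior_subset hs)).differentiableAt.differentiableWithinAt)
      fun s hs => by
        rw [(d1 s (interior_subset hs)).deriv]
        exact sub_nonneg.mpr (hC s (interior_subset hs))
  have d2 : ∀ s ∈ Icc (0 : ℝ) 1, HasDerivAt (fun s => g s - g' 0 * s - C / 2 * s ^ 2)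
      (g' s - g' 0 - C * s) s := fun s hs =>
    (((hg s hs).fun_sub ((hasDerivAt_id s).const_mul (g' 0))).fun_sub
      (((hasDerivAt_id s).fun_pow 2).const_mul (C / 2))).congr_deriv (by simp; ring)
  have m2 : MonotoneOn (fun s => g s - g' 0 * s - C / 2 * s ^ 2) (Icc 0 1) :=
    monotoneOn_of_deriv_nonneg (convex_Icc _ _)
      (fun s hs => (d2 s hs).continuousAt.continuousWithinAt)
      (fun s hs => (d2 s (interior_subset hs)).differentiableAt.differentiableWithinAt)
      fun s hs => by
        have hs' := interior_subset hs
        rw [(d2 s hs').deriv]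
        have := m1 (left_mem_Icc.mpr zero_le_one) hs' hs'.1
        simp only [mul_zero, sub_zero] at this
        linarith
  have := m2 (left_mem_Icc.mpr zero_le_one) (right_mem_Icc.mpr zero_le_one) zero_le_one
  simp only [mul_zero, sub_zero, mul_one, one_pow, ne_eq, OfNat.ofNat_ne_zero, not_false_eq_true,
    zero_pow] at this
  linarith

/-- Quadratic lower bound for the power `α + 2`. -/
theorem rpow_add_ge {α a d δ : ℝ} (hα : 0 < α) (ha : 0 < a) (hδ : δ < 1) (hd : |d| ≤ δ * a) :
    a ^ (α + 2) + (α + 2) * (a ^ (α + 1) * d) +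
      (α + 2) * (α + 1) / 2 * ((1 - δ) ^ α * (a ^ α * d ^ 2)) ≤ (a + d) ^ (α + 2) := by
  have hδ0 : 0 ≤ δ := by
    by_contra h
    push Not at h
    nlinarith [abs_nonneg d]
  have hlow : ∀ s ∈ Icc (0 : ℝ) 1, (1 - δ) * a ≤ a + s * d := by
    intro s hs
    have : -(δ * a) ≤ s * d := by
      have h1 : |s * d| ≤ δ * a := by
        rw [abs_mul, abs_of_nonneg hs.1]
        exact (mul_le_of_le_one_left (abs_nonneg d) hs.2).trans hd
      exact (abs_le.mp h1).1
    linarith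
  have hpos : ∀ s ∈ Icc (0 : ℝ) 1, 0 < a + s * d := fun s hs =>
    (mul_pos (sub_pos.mpr hδ) ha).trans_le (hlow s hs)
  have hlin : ∀ s : ℝ, HasDerivAt (fun s => a + s * d) d s := fun s =>
    (((hasDerivAt_id s).mul_const d).const_add a).congr_deriv (by ring)
  have h := add_half_le_of_deriv2_ge (g := fun s => (a + s * d) ^ (α + 2))
    (g' := fun s => (α + 2) * d * (a + s * d) ^ (α + 1))
    (g'' := fun s => (α + 2) * d * ((α + 1) * d * (a + s * d) ^ α))
    (C := (α + 2) * (α + 1) * ((1 - δ) ^ α * (a ^ α * d ^ 2))) ?_ ?_ ?_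
  · simp only [zero_mul, add_zero, one_mul] at h
    linarith
  · intro s hs
    refine ((hlin s).rpow_const (Or.inl (hpos s hs).ne')).congr_deriv ?_
    rw [show α + 2 - 1 = α + 1 by ring]; ring
  · intro s hs
    refine (((hlin s).rpow_const (p := α + 1) (Or.inl (hpos s hs).ne')).const_mul
      ((α + 2) * d)).congr_deriv ?_
    rw [show α + 1 - 1 = α by ring]; ring
  · intro s hs
    have h1 : ((1 - δ) * a) ^ α ≤ (a + s * d) ^ α :=
      Real.rpow_le_rpow (mul_pos (sub_pos.mpr hδ) ha).le (hlow s hs) hα.le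
    rw [Real.mul_rpow (sub_pos.mpr hδ).le ha.le] at h1
    have h2 : 0 ≤ (α + 2) * (α + 1) * d ^ 2 := by positivity
    nlinarith [mul_le_mul_of_nonneg_left h1 h2]

namespace IsEvenMinimizer

variable {L ω α τ : ℝ} {φ : ℝ → ℝ}

theorem mass_eq (hmin : IsEvenMinimizer L ω α τ (fun x => (φ x : ℂ))
    (fun x => ((deriv φ x : ℝ) : ℂ))) (hL : 0 < L) (hα : 0 < α)
    (hφ : IsEvenPositiveWave L ω α φ) :
    2 * ∫ x in (0 : ℝ)..(L / 2), φ x ^ (α + 2) = τ := by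
  rw [← hmin.1.2]
  refine (integral_of_symm hL
    (hφ.continuous.rpow_const fun x => Or.inr (by linarith)) ?_ ?_).symm
  · intro x _
    rw [Complex.norm_real, Real.norm_of_nonneg (hφ.pos x).le]
  · intro x _
    rw [Complex.norm_real, Real.norm_of_nonneg (hφ.pos x).le, hφ.apply_sub]

theorem energyB_eq (hL : 0 < L) {u ux : ℝ → ℂ} {U U' : ℝ → ℝ} (hU : Continuous U)
    (hU' : Continuous U') (h1 : ∀ x ∈ Ioo 0 (L / 2), ‖u x‖ = |U x| ∧ ‖ux x‖ = |U' x|)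
    (h2 : ∀ x ∈ Ioo (L / 2) L, ‖u x‖ = |U (L - x)| ∧ ‖ux x‖ = |U' (L - x)|) :
    energyB L ω u ux = ∫ x in (0 : ℝ)..(L / 2), (U' x ^ 2 + ω * U x ^ 2) := by
  rw [energyB, integral_of_symm hL (f := fun x => U' x ^ 2 + ω * U x ^ 2)
    ((hU'.pow 2).add (continuous_const.mul (hU.pow 2)))]
  · ring
  · intro x hx
    rw [(h1 x hx).1, (h1 x hx).2, sq_abs, sq_abs]
  · intro x hx
    rw [(h2 x hx).1, (h2 x hx).2, sq_abs, sq_abs]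

/-- On the half period the wave minimizes the energy among all `C¹` functions of the same mass. -/
theorem half_energy_le (hmin : IsEvenMinimizer L ω α τ (fun x => (φ x : ℂ))
    (fun x => ((deriv φ x : ℝ) : ℂ))) (hL : 0 < L) (hα : 0 < α)
    (hφ : IsEvenPositiveWave L ω α φ) {U U' : ℝ → ℝ} (hU : ∀ x, HasDerivAt U (U' x) x)
    (hU' : Continuous U') (hm : 2 * ∫ x in (0 : ℝ)..(L / 2), |U x| ^ (α + 2) = τ) :
    ∫ x in (0 : ℝ)..(L / 2), (deriv φ x ^ 2 + ω * φ x ^ 2) ≤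
      ∫ x in (0 : ℝ)..(L / 2), (U' x ^ 2 + ω * U x ^ 2) := by
  have hUc : Continuous U := continuous_iff_continuousAt.mpr fun x => (hU x).continuousAt
  have hE := hmin.2 _ _ ⟨isEvenH1per_comp_tent hL hU hU', ?_⟩
  · rw [energyB_eq hL hφ.continuous hφ.continuous_deriv, energyB_eq hL hUc hU'] at hE
    · exact hE
    · intro x hx
      simp only [tent_of_le hL hx.1.le hx.2.le, if_pos hx.2.le, Complex.norm_real,
        Real.norm_eq_abs, and_self]
    · intro x hx
      simp only [tent_of_ge hL hx.1.le hx.2.le, if_neg (not_le.mpr hx.1), Complex.norm_real,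
        Real.norm_eq_abs, abs_neg, and_self]
    · intro x _
      simp only [Complex.norm_real, Real.norm_eq_abs, and_self]
    · intro x _
      simp only [Complex.norm_real, Real.norm_eq_abs, hφ.apply_sub, hφ.deriv_sub, abs_neg, and_self]
  · rw [← hm]
    refine integral_of_symm hL (f := fun x => |U x| ^ (α + 2))
      (hUc.abs.rpow_const fun x => Or.inr (by linarith)) ?_ ?_
    · intro x hx
      simp only [tent_of_le hL hx.1.le hx.2.le, Complex.norm_real, Real.norm_eq_abs]
    · intro x hx
      simp only [tent_of_ge hL hx.1.le hx.2.le, Complex.norm_real, Real.norm_eq_abs]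

/-- The second variation of the constrained problem: the quadratic form of `𝓛₁` on the half period
is nonnegative on the functions orthogonal to `φ^(α+1)`. -/
theorem secondVariation_nonneg (hmin : IsEvenMinimizer L ω α τ (fun x => (φ x : ℂ))
    (fun x => ((deriv φ x : ℝ) : ℂ))) (hL : 0 < L) (hα : 0 < α) (hτ : 0 < τ)
    (hφ : IsEvenPositiveWave L ω α φ) {u u' : ℝ → ℝ} (hu : ∀ x, HasDerivAt u (u' x) x)
    (hu' : Continuous u') (horth : ∫ x in (0 : ℝ)..(L / 2), φ x ^ (α + 1) * u x = 0) :
    0 ≤ ∫ x in (0 : ℝ)..(L / 2), (u' x ^ 2 + pot₁ ω α φ x * u x ^ 2) := by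
  have hℓ : (0 : ℝ) ≤ L / 2 := by linarith
  have huc : Continuous u := continuous_iff_continuousAt.mpr fun x => (hu x).continuousAt
  have hφc := hφ.continuous
  have hφd := hφ.continuous_deriv
  have hpow : ∀ {β : ℝ}, 0 ≤ β → Continuous fun x => φ x ^ β := fun hβ =>
    hφc.rpow_const fun x => Or.inr hβ
  have hpα := hpow hα.le
  have hpα1 := hpow (show 0 ≤ α + 1 by linarith)
  have hpα2 := hpow (show 0 ≤ α + 2 by linarith)
  have e1 : ∀ x, φ x ^ (α + 1) = φ x ^ α * φ x := fun x => Real.rpow_add_one (hφ.pos x).ne' α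
  have e2 : ∀ x, φ x ^ (α + 2) = φ x ^ α * φ x ^ 2 := fun x => by
    rw [Real.rpow_add (hφ.pos x), Real.rpow_two]
  set m := ∫ x in (0 : ℝ)..(L / 2), φ x ^ (α + 2) with hm
  have hmτ : 2 * m = τ := hmin.mass_eq hL hα hφ
  have hm0 : 0 < m := by linarith
  -- the weak equation, tested with `φ` and with `u`
  have hweak : ∀ {w w' : ℝ → ℝ}, (∀ x, HasDerivAt w (w' x) x) → Continuous w' →
      ∫ x in (0 : ℝ)..(L / 2), (deriv φ x * w' x + ω * (φ x * w x)) =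
        ∫ x in (0 : ℝ)..(L / 2), φ x ^ (α + 1) * w x := by
    intro w w' hw hw'
    have hwc : Continuous w := continuous_iff_continuousAt.mpr fun x => (hw x).continuousAt
    have h := (hφ.isSol_self (L / 2)).integral_eq hℓ (hφ.continuous_pot₂ hα) hw hw'
    rw [hφ.deriv_zero, hφ.deriv_half, zero_mul, zero_mul, sub_zero] at h
    rw [← sub_eq_zero, ← intervalIntegral.integral_sub]
    · refine Eq.trans (intervalIntegral.integral_congr fun x _ => ?_) h
      simp only [pot₂, abs_of_pos (hφ.pos x), e1]
      ring
    · exact (Continuous.add (hφd.mul hw')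
        (continuous_const.mul (hφc.mul hwc))).intervalIntegrable _ _
    · exact (hpα1.mul hwc).intervalIntegrable _ _
  have hJφ : ∫ x in (0 : ℝ)..(L / 2), (deriv φ x ^ 2 + ω * φ x ^ 2) = m := by
    have h := hweak hφ.hasDerivAt hφd
    rw [hm]
    convert h using 3 with x x
    · ring
    · rw [e1, e2]; ring
  have hJx := hweak hu hu'
  rw [horth] at hJx
  set b := ∫ x in (0 : ℝ)..(L / 2), (u' x ^ 2 + ω * u x ^ 2) with hb
  set A := ∫ x in (0 : ℝ)..(L / 2), φ x ^ α * u x ^ 2 with hA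
  have hJ : ∀ ε : ℝ, ∫ x in (0 : ℝ)..(L / 2), ((deriv φ x + ε * u' x) ^ 2 +
      ω * (φ x + ε * u x) ^ 2) = m + ε ^ 2 * b := by
    intro ε
    have h1 : Continuous fun x => deriv φ x ^ 2 + ω * φ x ^ 2 :=
      (hφd.pow 2).add (continuous_const.mul (hφc.pow 2))
    have h2 : Continuous fun x => 2 * ε * (deriv φ x * u' x + ω * (φ x * u x)) :=
      continuous_const.mul ((hφd.mul hu').add (continuous_const.mul (hφc.mul huc)))
    have h3 : Continuous fun x => ε ^ 2 * (u' x ^ 2 + ω * u x ^ 2) :=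
      continuous_const.mul ((hu'.pow 2).add (continuous_const.mul (huc.pow 2)))
    have h12 : Continuous fun x => deriv φ x ^ 2 + ω * φ x ^ 2 +
        2 * ε * (deriv φ x * u' x + ω * (φ x * u x)) := h1.add h2
    have h4 : ∫ x in (0 : ℝ)..(L / 2), ((deriv φ x ^ 2 + ω * φ x ^ 2) +
        2 * ε * (deriv φ x * u' x + ω * (φ x * u x)) + ε ^ 2 * (u' x ^ 2 + ω * u x ^ 2)) =
        m + ε ^ 2 * b := by
      rw [intervalIntegral.integral_add (h12.intervalIntegrable _ _)
        (h3.intervalIntegrable _ _), intervalIntegral.integral_add (h1.intervalIntegrable _ _)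
        (h2.intervalIntegrable _ _), intervalIntegral.integral_const_mul,
        intervalIntegral.integral_const_mul, hJφ, hJx]
      ring
    rw [← h4]
    refine intervalIntegral.integral_congr fun x _ => ?_
    ring
  -- a constant bounding `|u| / φ`
  obtain ⟨K, hK0, hK⟩ : ∃ K : ℝ, 0 < K ∧ ∀ x ∈ Icc 0 (L / 2), |u x| ≤ K * φ x := by
    obtain ⟨C, hC⟩ := (isCompact_Icc (a := (0 : ℝ)) (b := L / 2)).exists_bound_of_continuousOn
      (huc.div hφc fun x => (hφ.pos x).ne').continuousOn
    refine ⟨max C 1, by positivity, fun x hx => ?_⟩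
    have h := hC x hx
    rw [Pi.div_apply, norm_div, Real.norm_eq_abs, Real.norm_of_nonneg (hφ.pos x).le,
      div_le_iff₀ (hφ.pos x)] at h
    exact h.trans (mul_le_mul_of_nonneg_right (le_max_left _ _) (hφ.pos x).le)
  have hN : ∀ ε : ℝ, 0 < ε → ε * K < 1 →
      m + (α + 2) * (α + 1) / 2 * ((1 - ε * K) ^ α * (ε ^ 2 * A)) ≤
        ∫ x in (0 : ℝ)..(L / 2), |φ x + ε * u x| ^ (α + 2) := by
    intro ε hε hεK
    have c0 : Continuous fun x => (α + 2) * ε * (φ x ^ (α + 1) * u x) :=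
      continuous_const.mul (hpα1.mul huc)
    have c1 : Continuous fun x => φ x ^ (α + 2) + (α + 2) * ε * (φ x ^ (α + 1) * u x) :=
      hpα2.add c0
    have c2 : Continuous fun x => (α + 2) * (α + 1) / 2 * ((1 - ε * K) ^ α * ε ^ 2) *
        (φ x ^ α * u x ^ 2) := continuous_const.mul (hpα.mul (huc.pow 2))
    have c3 : Continuous fun x => |φ x + ε * u x| ^ (α + 2) :=
      (hφc.add (continuous_const.mul huc)).abs.rpow_const fun x => Or.inr (by linarith)
    have h := intervalIntegral.integral_mono_on hℓ ((c1.add c2).intervalIntegrable _ _)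
      (c3.intervalIntegrable _ _) (μ := volume) fun x hx => by
        have hd : |ε * u x| ≤ ε * K * φ x := by
          rw [abs_mul, abs_of_pos hε, mul_assoc]
          exact mul_le_mul_of_nonneg_left (hK x hx) hε.le
        have h0 : 0 < φ x + ε * u x := by
          have := (abs_le.mp hd).1
          nlinarith [hφ.pos x]
        have := rpow_add_ge hα (hφ.pos x) hεK hd
        rw [abs_of_pos h0]
        refine le_trans (le_of_eq ?_) this
        simp only [Pi.add_apply]
        ring
    refine le_trans (le_of_eq ?_) h
    simp only [Pi.add_apply]
    rw [intervalIntegral.integral_add (c1.intervalIntegrable _ _) (c2.intervalIntegrable _ _),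
      intervalIntegral.integral_add (hpα2.intervalIntegrable _ _)
        (c0.intervalIntegrable _ _),
      intervalIntegral.integral_const_mul, intervalIntegral.integral_const_mul, horth]
    ring
  have hA0 : 0 ≤ A := intervalIntegral.integral_nonneg hℓ fun x _ =>
    mul_nonneg (Real.rpow_nonneg (hφ.pos x).le α) (sq_nonneg _)
  -- rescaling to the constraint
  have hmain : ∀ ε : ℝ, 0 < ε → ε * K < 1 →
      1 + (α + 2) * (α + 1) / 2 * ((1 - ε * K) ^ α * (ε ^ 2 * (A / m))) ≤
        (1 + ε ^ 2 * (b / m)) ^ ((α + 2) / 2) := by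
    intro ε hε hεK
    set N := ∫ x in (0 : ℝ)..(L / 2), |φ x + ε * u x| ^ (α + 2) with hNdef
    have h1 := hN ε hε hεK
    have hNm : m ≤ N := by
      refine le_trans ?_ h1
      have : 0 ≤ (1 - ε * K) ^ α := Real.rpow_nonneg (by linarith) α
      have : 0 ≤ (α + 2) * (α + 1) / 2 * ((1 - ε * K) ^ α * (ε ^ 2 * A)) := by positivity
      linarith
    have hN0 : 0 < N := hm0.trans_le hNm
    set s := (m / N) ^ (1 / (α + 2)) with hs
    have hs0 : 0 < s := Real.rpow_pos_of_pos (div_pos hm0 hN0) _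
    have hspow : s ^ (α + 2) = m / N := by
      rw [hs, ← Real.rpow_mul (div_pos hm0 hN0).le, one_div, inv_mul_cancel₀ (by linarith),
        Real.rpow_one]
    have h2 := hmin.half_energy_le hL hα hφ (U := fun x => s * (φ x + ε * u x))
      (U' := fun x => s * (deriv φ x + ε * u' x))
      (fun x => ((hφ.hasDerivAt x).fun_add ((hu x).const_mul ε)).const_mul s)
      (continuous_const.mul (hφd.add (continuous_const.mul hu'))) (by
        have : ∀ x, |s * (φ x + ε * u x)| ^ (α + 2) = m / N * |φ x + ε * u x| ^ (α + 2) := by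
          intro x
          rw [abs_mul, abs_of_pos hs0, Real.mul_rpow hs0.le (abs_nonneg _), hspow]
        simp only [this]
        rw [intervalIntegral.integral_const_mul, ← hNdef, div_mul_cancel₀ _ hN0.ne', hmτ])
    have h3 : ∀ x, (s * (deriv φ x + ε * u' x)) ^ 2 + ω * (s * (φ x + ε * u x)) ^ 2 =
        s ^ 2 * ((deriv φ x + ε * u' x) ^ 2 + ω * (φ x + ε * u x) ^ 2) := fun x => by ring
    simp only [h3] at h2
    rw [intervalIntegral.integral_const_mul, hJ, hJφ] at h2
    -- `m ≤ s² (m + ε² b)`, raised to the power `(α+2)/2`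
    have h4 : 1 ≤ s ^ 2 * (1 + ε ^ 2 * (b / m)) := by
      have : s ^ 2 * (m + ε ^ 2 * b) = m * (s ^ 2 * (1 + ε ^ 2 * (b / m))) := by
        field_simp
      rw [this] at h2
      exact le_of_mul_le_mul_left (by linarith) hm0
    have hX : 0 < 1 + ε ^ 2 * (b / m) := by
      by_contra hc
      push Not at hc
      nlinarith [sq_nonneg s]
    have h5 : 1 ≤ (s ^ 2 * (1 + ε ^ 2 * (b / m))) ^ ((α + 2) / 2) :=
      Real.one_le_rpow h4 (by linarith)
    rw [Real.mul_rpow (sq_nonneg s) hX.le, ← Real.rpow_natCast s 2, ← Real.rpow_mul hs0.le] at h5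
    rw [show ((2 : ℕ) : ℝ) * ((α + 2) / 2) = α + 2 by push_cast; ring, hspow] at h5
    have h6 : N / m ≤ (1 + ε ^ 2 * (b / m)) ^ ((α + 2) / 2) := by
      rw [div_le_iff₀ hm0]
      rw [div_mul_eq_mul_div, le_div_iff₀ hN0] at h5
      linarith
    refine le_trans ?_ h6
    rw [le_div_iff₀ hm0]
    refine le_trans (le_of_eq ?_) h1
    field_simp
  -- divide by `ε²` and let `ε → 0`
  have hlim1 : Filter.Tendsto (fun ε : ℝ => ((1 + ε ^ 2 * (b / m)) ^ ((α + 2) / 2) - 1) / ε ^ 2)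
      (nhdsWithin 0 (Ioi 0)) (nhds ((α + 2) / 2 * (b / m))) := by
    have hd : HasDerivAt (fun r : ℝ => (1 + r * (b / m)) ^ ((α + 2) / 2))
        ((α + 2) / 2 * (b / m)) 0 := by
      have h := ((((hasDerivAt_id (0 : ℝ)).mul_const (b / m)).const_add 1).rpow_const
        (p := (α + 2) / 2) (Or.inl (by simp)))
      exact h.congr_deriv (by simp; ring)
    have ht := hd.tendsto_slope
    have hsq : Filter.Tendsto (fun ε : ℝ => ε ^ 2) (nhdsWithin 0 (Ioi 0))
        (nhdsWithin 0 {0}ᶜ) := by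
      refine tendsto_nhdsWithin_iff.mpr ⟨?_, ?_⟩
      · have : Filter.Tendsto (fun ε : ℝ => ε ^ 2) (nhds 0) (nhds (0 ^ 2)) :=
          (continuous_pow 2).tendsto 0
        rw [zero_pow two_ne_zero] at this
        exact this.mono_left nhdsWithin_le_nhds
      · filter_upwards [self_mem_nhdsWithin] with ε hε
        exact pow_ne_zero 2 (ne_of_gt hε)
    refine (ht.comp hsq).congr fun ε => ?_
    simp [slope_def_field]
  have hlim2 : Filter.Tendsto (fun ε : ℝ => (α + 2) * (α + 1) / 2 * ((1 - ε * K) ^ α * (A / m)))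
      (nhdsWithin 0 (Ioi 0)) (nhds ((α + 2) * (α + 1) / 2 * (A / m))) := by
    have hc : Continuous fun ε : ℝ => (α + 2) * (α + 1) / 2 * ((1 - ε * K) ^ α * (A / m)) :=
      continuous_const.mul (((continuous_const.sub (continuous_id.mul continuous_const)).rpow_const
        fun _ => Or.inr hα.le).mul continuous_const)
    have h := hc.tendsto 0
    simp only [zero_mul, sub_zero, Real.one_rpow, one_mul] at h
    exact h.mono_left nhdsWithin_le_nhds
  have hle := le_of_tendsto_of_tendsto hlim2 hlim1 (by
    filter_upwards [Ioo_mem_nhdsGT (show (0 : ℝ) < K⁻¹ by positivity)] with ε hε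
    have h := hmain ε hε.1 (by
      have := mul_lt_mul_of_pos_right hε.2 hK0
      rwa [inv_mul_cancel₀ hK0.ne'] at this)
    rw [le_div_iff₀ (pow_pos hε.1 2)]
    linarith)
  have hfin : (α + 1) * A ≤ b := by
    have h1 : (α + 2) * (α + 1) / 2 * (A / m) = (α + 2) / (2 * m) * ((α + 1) * A) := by
      field_simp
    have h2 : (α + 2) / 2 * (b / m) = (α + 2) / (2 * m) * b := by field_simp
    rw [h1, h2] at hle
    exact le_of_mul_le_mul_left hle (by positivity)
  have hsplit : ∫ x in (0 : ℝ)..(L / 2), (u' x ^ 2 + pot₁ ω α φ x * u x ^ 2) =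
      b - (α + 1) * A := by
    rw [hb, hA, ← intervalIntegral.integral_const_mul, ← intervalIntegral.integral_sub]
    · refine intervalIntegral.integral_congr fun x _ => ?_
      simp only [pot₁, abs_of_pos (hφ.pos x)]
      ring
    · exact ((hu'.pow 2).add (continuous_const.mul (huc.pow 2))).intervalIntegrable _ _
    · exact (continuous_const.mul (hpα.mul (huc.pow 2))).intervalIntegrable _ _
  rw [hsplit]
  linarith

end IsEvenMinimizer

/-! ### Nonpositive periodic eigenfunctions of the two Hill operators -/

namespace IsSol

variable {b : ℝ} {q y y' z z' : ℝ → ℝ}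

theorem deriv_zero_eq_zero (hb : 0 < b) (hy : IsSol b q y y') (h : ∀ x ∈ Icc 0 b, y x = 0) :
    y' 0 = 0 := by
  have h0 : (0 : ℝ) ∈ Icc 0 b := left_mem_Icc.mpr hb.le
  have h1 : HasDerivWithinAt y 0 (Icc 0 b) 0 :=
    (hasDerivWithinAt_const (0 : ℝ) (Icc 0 b) (0 : ℝ)).congr h (h 0 h0)
  exact (uniqueDiffOn_Icc hb 0 h0).eq_deriv _ (hy.hasDerivAt 0).hasDerivWithinAt h1

theorem integral_sq_pos (hb : 0 < b) (hy : IsSol b q y y') (h : ∃ x ∈ Icc 0 b, y x ≠ 0) :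
    0 < ∫ x in (0 : ℝ)..b, y x ^ 2 := by
  obtain ⟨c, hc, hne⟩ := h
  exact intervalIntegral.integral_pos hb (hy.continuous.pow 2).continuousOn
    (fun x _ => sq_nonneg _) ⟨c, hc, by positivity⟩

/-- The quadratic form of `-∂² + q` evaluated on an eigenfunction. -/
theorem form_eq {μ : ℝ} (hb : 0 ≤ b) (hy : IsSol b (fun x => q x - μ) y y') (hq : Continuous q)
    {w w' : ℝ → ℝ} (hw : ∀ x, HasDerivAt w (w' x) x) (hw' : Continuous w') :
    ∫ x in (0 : ℝ)..b, (y' x * w' x + q x * (y x * w x)) =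
      y' b * w b - y' 0 * w 0 + μ * ∫ x in (0 : ℝ)..b, y x * w x := by
  have hwc : Continuous w := continuous_iff_continuousAt.mpr fun x => (hw x).continuousAt
  have c1 : Continuous fun x => y' x * w' x + (q x - μ) * (y x * w x) :=
    (hy.continuous_deriv.mul hw').add ((hq.sub continuous_const).mul (hy.continuous.mul hwc))
  have c2 : Continuous fun x => μ * (y x * w x) := continuous_const.mul (hy.continuous.mul hwc)
  rw [← hy.integral_eq hb (hq.sub continuous_const) hw hw', ← intervalIntegral.integral_const_mul,
    ← intervalIntegral.integral_add (c1.intervalIntegrable _ _) (c2.intervalIntegrable _ _)]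
  refine intervalIntegral.integral_congr fun x _ => ?_
  ring

theorem eq_zero_of_one_le (hb : 0 < b) (hy : IsSol b q y y') (hq : Continuous q)
    (h1 : ∀ x, 1 ≤ q x) (hp : y b = y 0) (hp' : y' b = y' 0) : ∀ x ∈ Icc 0 b, y x = 0 := by
  by_contra! hne
  have hpos := hy.integral_sq_pos hb hne
  have h := hy.integral_eq hb.le hq hy.hasDerivAt hy.continuous_deriv
  rw [hp, hp', sub_self] at h
  have c : Continuous fun x => y' x * y' x + q x * (y x * y x) :=
    (hy.continuous_deriv.mul hy.continuous_deriv).add (hq.mul (hy.continuous.mul hy.continuous))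
  have hle := intervalIntegral.integral_mono_on (μ := volume) hb.le
    ((hy.continuous.pow 2).intervalIntegrable 0 b) (c.intervalIntegrable 0 b) fun x _ => by
      simp only [Pi.pow_apply]
      nlinarith [mul_self_nonneg (y' x), mul_nonneg (sub_nonneg.mpr (h1 x)) (mul_self_nonneg (y x))]
  simp only [Pi.pow_apply] at hle
  linarith

end IsSol

theorem integral_form_linComb {b : ℝ} {q u u' w w' : ℝ → ℝ} (hq : Continuous q)
    (hu : Continuous u) (hu' : Continuous u') (hw : Continuous w) (hw' : Continuous w')
    (s t : ℝ) :
    ∫ x in (0 : ℝ)..b, ((s * u' x + t * w' x) ^ 2 + q x * (s * u x + t * w x) ^ 2) =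
      s ^ 2 * (∫ x in (0 : ℝ)..b, (u' x * u' x + q x * (u x * u x))) +
      2 * s * t * (∫ x in (0 : ℝ)..b, (u' x * w' x + q x * (u x * w x))) +
      t ^ 2 * ∫ x in (0 : ℝ)..b, (w' x * w' x + q x * (w x * w x)) := by
  have c1 : Continuous fun x => s ^ 2 * (u' x * u' x + q x * (u x * u x)) :=
    continuous_const.mul ((hu'.mul hu').add (hq.mul (hu.mul hu)))
  have c2 : Continuous fun x => 2 * s * t * (u' x * w' x + q x * (u x * w x)) :=
    continuous_const.mul ((hu'.mul hw').add (hq.mul (hu.mul hw)))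
  have c3 : Continuous fun x => t ^ 2 * (w' x * w' x + q x * (w x * w x)) :=
    continuous_const.mul ((hw'.mul hw').add (hq.mul (hw.mul hw)))
  have c12 : Continuous fun x => s ^ 2 * (u' x * u' x + q x * (u x * u x)) +
      2 * s * t * (u' x * w' x + q x * (u x * w x)) := c1.add c2
  rw [← intervalIntegral.integral_const_mul, ← intervalIntegral.integral_const_mul,
    ← intervalIntegral.integral_const_mul, ← intervalIntegral.integral_add
    (c1.intervalIntegrable _ _) (c2.intervalIntegrable _ _), ← intervalIntegral.integral_add
    (c12.intervalIntegrable _ _) (c3.intervalIntegrable _ _)]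
  refine intervalIntegral.integral_congr fun x _ => ?_
  ring

theorem integral_mul_linComb {b : ℝ} {p u w : ℝ → ℝ} (hp : Continuous p) (hu : Continuous u)
    (hw : Continuous w) (s t : ℝ) :
    ∫ x in (0 : ℝ)..b, p x * (s * u x + t * w x) =
      s * (∫ x in (0 : ℝ)..b, p x * u x) + t * ∫ x in (0 : ℝ)..b, p x * w x := by
  have c1 : Continuous fun x => s * (p x * u x) := continuous_const.mul (hp.mul hu)
  have c2 : Continuous fun x => t * (p x * w x) := continuous_const.mul (hp.mul hw)
  rw [← intervalIntegral.integral_const_mul, ← intervalIntegral.integral_const_mul,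
    ← intervalIntegral.integral_add (c1.intervalIntegrable _ _) (c2.intervalIntegrable _ _)]
  refine intervalIntegral.integral_congr fun x _ => ?_
  ring

namespace IsEvenMinimizer

variable {L ω α τ : ℝ} {φ : ℝ → ℝ}

theorem continuous_weight (hφ : IsEvenPositiveWave L ω α φ) (hα : 0 < α) :
    Continuous fun x => φ x ^ (α + 1) :=
  hφ.continuous.rpow_const fun x => Or.inr (by linarith)

/-- The quadratic form of `𝓛₁` on the half period is nonnegative on every `C¹` combination
orthogonal to `φ^(α+1)`. -/
theorem form_linComb_nonneg (hmin : IsEvenMinimizer L ω α τ (fun x => (φ x : ℂ))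
    (fun x => ((deriv φ x : ℝ) : ℂ))) (hL : 0 < L) (hα : 0 < α) (hτ : 0 < τ)
    (hφ : IsEvenPositiveWave L ω α φ) {u u' w w' : ℝ → ℝ} (hu : ∀ x, HasDerivAt u (u' x) x)
    (hu' : Continuous u') (hw : ∀ x, HasDerivAt w (w' x) x) (hw' : Continuous w') {s t : ℝ}
    (h : s * (∫ x in (0 : ℝ)..(L / 2), φ x ^ (α + 1) * u x) +
      t * (∫ x in (0 : ℝ)..(L / 2), φ x ^ (α + 1) * w x) = 0) :
    0 ≤ s ^ 2 * (∫ x in (0 : ℝ)..(L / 2), (u' x * u' x + pot₁ ω α φ x * (u x * u x))) +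
      2 * s * t * (∫ x in (0 : ℝ)..(L / 2), (u' x * w' x + pot₁ ω α φ x * (u x * w x))) +
      t ^ 2 * ∫ x in (0 : ℝ)..(L / 2), (w' x * w' x + pot₁ ω α φ x * (w x * w x)) := by
  have huc : Continuous u := continuous_iff_continuousAt.mpr fun x => (hu x).continuousAt
  have hwc : Continuous w := continuous_iff_continuousAt.mpr fun x => (hw x).continuousAt
  rw [← integral_form_linComb (hφ.continuous_pot₁ hα) huc hu' hwc hw']
  refine hmin.secondVariation_nonneg hL hα hτ hφ
    (fun x => ((hu x).const_mul s).fun_add ((hw x).const_mul t))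
    ((continuous_const.mul hu').add (continuous_const.mul hw')) ?_
  rw [integral_mul_linComb (continuous_weight hφ hα) huc hwc, h]

/-- Odd eigenfunctions of `𝓛₁` with negative eigenvalue vanish. On the half period both such an
eigenfunction `y` and `φ'` satisfy Dirichlet conditions, and the quadratic form is nonpositive on
their span; some combination is orthogonal to `φ^(α+1)`, hence is a null vector of a nonnegative
form. It would then be a multiple of `φ'` satisfying the natural boundary condition `φ'' = 0`. -/
theorem dirichlet_eq_zero (hmin : IsEvenMinimizer L ω α τ (fun x => (φ x : ℂ))
    (fun x => ((deriv φ x : ℝ) : ℂ))) (hL : 0 < L) (hα : 0 < α) (hτ : 0 < τ)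
    (hφ : IsEvenPositiveWave L ω α φ) (hnc : ∃ x y, φ x ≠ φ y) {μ : ℝ} (hμ : μ < 0)
    {y y' : ℝ → ℝ} (hy : IsSol (L / 2) (fun x => pot₁ ω α φ x - μ) y y') (h0 : y 0 = 0)
    (h1 : y (L / 2) = 0) : ∀ x ∈ Icc 0 (L / 2), y x = 0 := by
  have hℓ : 0 < L / 2 := by linarith
  by_contra! hne
  have hpos := hy.integral_sq_pos hℓ hne
  have hq := hφ.continuous_pot₁ hα
  have hd := hφ.isSol_deriv (L / 2)
  have hf0 := hφ.force_ne_zero hL hα hnc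
  set p := ∫ x in (0 : ℝ)..(L / 2), φ x ^ (α + 1) * y x with hp
  set r := ∫ x in (0 : ℝ)..(L / 2), φ x ^ (α + 1) * deriv φ x with hr
  have q11 := hy.form_eq hℓ.le hq hy.hasDerivAt hy.continuous_deriv
  have q12 := hy.form_eq hℓ.le hq hd.hasDerivAt hd.continuous_deriv
  have q12' := hd.integral_eq hℓ.le hq hy.hasDerivAt hy.continuous_deriv
  have q22 := hd.integral_eq hℓ.le hq hd.hasDerivAt hd.continuous_deriv
  have q12c : ∫ x in (0 : ℝ)..(L / 2), (y' x * -force α ω (φ x) +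
      pot₁ ω α φ x * (y x * deriv φ x)) = 0 := by
    have : ∫ x in (0 : ℝ)..(L / 2), (y' x * -force α ω (φ x) +
        pot₁ ω α φ x * (y x * deriv φ x)) = ∫ x in (0 : ℝ)..(L / 2),
        (-force α ω (φ x) * y' x + pot₁ ω α φ x * (deriv φ x * y x)) :=
      intervalIntegral.integral_congr fun x _ => by ring
    rw [this, q12', h0, h1]; ring
  rw [hφ.deriv_zero, hφ.deriv_half] at q22
  have hsq : ∫ x in (0 : ℝ)..(L / 2), y x * y x = ∫ x in (0 : ℝ)..(L / 2), y x ^ 2 :=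
    intervalIntegral.integral_congr fun x _ => by ring
  rw [h0, h1, hsq] at q11
  by_cases hr0 : r = 0
  · -- `r = 0` means that `φ` takes the same value at both ends of the half period
    have hends : φ (L / 2) = φ 0 := by
      have hF : ∀ x, HasDerivAt (fun x => φ x ^ (α + 2) / (α + 2)) (φ x ^ (α + 1) * deriv φ x) x := by
        intro x
        refine (((hφ.hasDerivAt x).rpow_const (p := α + 2) (Or.inl (hφ.pos x).ne')).div_const
          (α + 2)).congr_deriv ?_
        rw [show α + 2 - 1 = α + 1 by ring]
        field_simp
      have h := intervalIntegral.integral_eq_sub_of_hasDerivAt (a := 0) (b := L / 2)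
        (fun x _ => hF x) (((continuous_weight hφ hα).mul
          hφ.continuous_deriv).intervalIntegrable _ _)
      rw [← hr, hr0] at h
      have h2 : φ (L / 2) ^ (α + 2) = φ 0 ^ (α + 2) := by
        have h3 : α + 2 ≠ 0 := by linarith
        field_simp at h
        linarith
      exact (Real.rpow_left_inj (hφ.pos _).le (hφ.pos _).le (by linarith)).mp h2
    -- test `φ'` against `x - s φ`, with `s` chosen to satisfy the constraint
    have hm : 0 < ∫ x in (0 : ℝ)..(L / 2), φ x ^ (α + 1) * φ x :=
      intervalIntegral.intervalIntegral_pos_of_pos_on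
        (((continuous_weight hφ hα).mul hφ.continuous).intervalIntegrable _ _)
        (fun x _ => mul_pos (Real.rpow_pos_of_pos (hφ.pos x) _) (hφ.pos x)) hℓ
    set m := ∫ x in (0 : ℝ)..(L / 2), φ x ^ (α + 1) * φ x
    set n := ∫ x in (0 : ℝ)..(L / 2), φ x ^ (α + 1) * x
    have hw : ∀ x, HasDerivAt (fun x => 1 * x + (-(n / m)) * φ x) (1 * 1 + (-(n / m)) * deriv φ x) x :=
      fun x => ((hasDerivAt_id x).const_mul 1).fun_add ((hφ.hasDerivAt x).const_mul _)
    have hw' : Continuous fun x => (1 : ℝ) * 1 + (-(n / m)) * deriv φ x :=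
      continuous_const.add (continuous_const.mul hφ.continuous_deriv)
    have horth : ∫ x in (0 : ℝ)..(L / 2), φ x ^ (α + 1) * (1 * x + (-(n / m)) * φ x) = 0 := by
      rw [integral_mul_linComb (u := fun x => x) (continuous_weight hφ hα) continuous_id
        hφ.continuous]
      change 1 * n + -(n / m) * m = 0
      field_simp
      ring
    have qw := hd.integral_eq hℓ.le hq hw hw'
    rw [hends] at qw
    set Qw := ∫ x in (0 : ℝ)..(L / 2), ((1 * 1 + (-(n / m)) * deriv φ x) *
      (1 * 1 + (-(n / m)) * deriv φ x) + pot₁ ω α φ x * ((1 * x + (-(n / m)) * φ x) *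
      (1 * x + (-(n / m)) * φ x)))
    have key : ∀ t : ℝ, 0 ≤ 2 * t * (-force α ω (φ 0) * (L / 2)) + t ^ 2 * Qw := by
      intro t
      have h := hmin.form_linComb_nonneg hL hα hτ hφ hd.hasDerivAt hd.continuous_deriv hw hw'
        (s := 1) (t := t) (by rw [← hr, hr0, horth]; ring)
      rw [q22, qw] at h
      change 0 ≤ _ + t ^ 2 * Qw at h
      linarith
    -- a quadratic polynomial without constant term cannot be nonnegative near `0`
    have hlin : -force α ω (φ 0) * (L / 2) = 0 := by
      set c := -force α ω (φ 0) * (L / 2)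
      by_contra hc
      have hK : 0 < |Qw| + 1 := by positivity
      have h := key (-c / (|Qw| + 1))
      have e : 2 * (-c / (|Qw| + 1)) * c + (-c / (|Qw| + 1)) ^ 2 * Qw =
          c ^ 2 / (|Qw| + 1) ^ 2 * (Qw - 2 * (|Qw| + 1)) := by
        field_simp
        ring
      rw [e] at h
      have h2 : 0 < c ^ 2 / (|Qw| + 1) ^ 2 := by positivity
      nlinarith [le_abs_self Qw, abs_nonneg Qw]
    rcases mul_eq_zero.mp hlin with h | h
    · exact hf0 (by linarith)
    · linarith
  · have h := hmin.form_linComb_nonneg hL hα hτ hφ hy.hasDerivAt hy.continuous_deriv hd.hasDerivAt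
      hd.continuous_deriv (s := 1) (t := -(p / r)) (by rw [← hp, ← hr]; field_simp; ring)
    rw [q11, q12c, q22] at h
    nlinarith [mul_neg_of_neg_of_pos hμ hpos]

/-- Neumann eigenfunctions of `𝓛₁` on the half period with distinct negative eigenvalues do not
coexist, since the constraint has codimension one. -/
theorem neumann_unique (hmin : IsEvenMinimizer L ω α τ (fun x => (φ x : ℂ))
    (fun x => ((deriv φ x : ℝ) : ℂ))) (hL : 0 < L) (hα : 0 < α) (hτ : 0 < τ)
    (hφ : IsEvenPositiveWave L ω α φ) {μ ν : ℝ} (hμ : μ < 0) (hν : ν < 0) (hne : μ ≠ ν)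
    {y y' z z' : ℝ → ℝ} (hy : IsSol (L / 2) (fun x => pot₁ ω α φ x - μ) y y')
    (hz : IsSol (L / 2) (fun x => pot₁ ω α φ x - ν) z z')
    (hy0 : y' 0 = 0) (hy1 : y' (L / 2) = 0) (hz0 : z' 0 = 0) (hz1 : z' (L / 2) = 0)
    (hyn : ∃ x ∈ Icc 0 (L / 2), y x ≠ 0) (hzn : ∃ x ∈ Icc 0 (L / 2), z x ≠ 0) : False := by
  have hℓ : 0 < L / 2 := by linarith
  have hq := hφ.continuous_pot₁ hα
  have hY := hy.integral_sq_pos hℓ hyn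
  have hZ := hz.integral_sq_pos hℓ hzn
  have q11 := hy.form_eq hℓ.le hq hy.hasDerivAt hy.continuous_deriv
  have q12 := hy.form_eq hℓ.le hq hz.hasDerivAt hz.continuous_deriv
  have q21 := hz.form_eq hℓ.le hq hy.hasDerivAt hy.continuous_deriv
  have q22 := hz.form_eq hℓ.le hq hz.hasDerivAt hz.continuous_deriv
  rw [hy0, hy1] at q11 q12
  rw [hz0, hz1] at q21 q22
  have e1 : ∫ x in (0 : ℝ)..(L / 2), (z' x * y' x + pot₁ ω α φ x * (z x * y x)) =
      ∫ x in (0 : ℝ)..(L / 2), (y' x * z' x + pot₁ ω α φ x * (y x * z x)) :=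
    intervalIntegral.integral_congr fun x _ => by ring
  have e2 : ∫ x in (0 : ℝ)..(L / 2), z x * y x = ∫ x in (0 : ℝ)..(L / 2), y x * z x :=
    intervalIntegral.integral_congr fun x _ => by ring
  have e3 : ∫ x in (0 : ℝ)..(L / 2), y x * y x = ∫ x in (0 : ℝ)..(L / 2), y x ^ 2 :=
    intervalIntegral.integral_congr fun x _ => by ring
  have e4 : ∫ x in (0 : ℝ)..(L / 2), z x * z x = ∫ x in (0 : ℝ)..(L / 2), z x ^ 2 :=
    intervalIntegral.integral_congr fun x _ => by ring
  rw [e1, e2, q12] at q21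
  have hyz : ∫ x in (0 : ℝ)..(L / 2), y x * z x = 0 := by
    have : (μ - ν) * ∫ x in (0 : ℝ)..(L / 2), y x * z x = 0 := by linarith
    exact (mul_eq_zero.mp this).resolve_left (sub_ne_zero.mpr hne)
  rw [e3] at q11
  rw [e4] at q22
  rw [hyz] at q12
  have hform : ∀ s t : ℝ, s * (∫ x in (0 : ℝ)..(L / 2), φ x ^ (α + 1) * y x) +
      t * (∫ x in (0 : ℝ)..(L / 2), φ x ^ (α + 1) * z x) = 0 → s = 0 ∧ t = 0 := by
    intro s t hst
    have h := hmin.form_linComb_nonneg hL hα hτ hφ hy.hasDerivAt hy.continuous_deriv hz.hasDerivAt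
      hz.continuous_deriv hst
    rw [q11, q12, q22] at h
    have h1 := mul_neg_of_neg_of_pos hμ hY
    have h2 := mul_neg_of_neg_of_pos hν hZ
    have hs : s ^ 2 = 0 := by nlinarith [sq_nonneg s, sq_nonneg t]
    have ht : t ^ 2 = 0 := by nlinarith [sq_nonneg s, sq_nonneg t]
    exact ⟨pow_eq_zero_iff two_ne_zero |>.mp hs, pow_eq_zero_iff two_ne_zero |>.mp ht⟩
  have h1 := hform (∫ x in (0 : ℝ)..(L / 2), φ x ^ (α + 1) * z x)
    (-∫ x in (0 : ℝ)..(L / 2), φ x ^ (α + 1) * y x) (by ring)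
  have h2 := hform 1 0 (by rw [neg_eq_zero.mp h1.2]; ring)
  exact one_ne_zero h2.1

/-- A periodic eigenfunction of `𝓛₁` with negative eigenvalue satisfies Neumann conditions on the
half period. -/
theorem neumann_of_negative (hmin : IsEvenMinimizer L ω α τ (fun x => (φ x : ℂ))
    (fun x => ((deriv φ x : ℝ) : ℂ))) (hL : 0 < L) (hα : 0 < α) (hτ : 0 < τ)
    (hφ : IsEvenPositiveWave L ω α φ) (hnc : ∃ x y, φ x ≠ φ y) {μ : ℝ} (hμ : μ < 0)
    {y y' : ℝ → ℝ} (hy : IsSol L (fun x => pot₁ ω α φ x - μ) y y') (h0 : y L = y 0)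
    (h1 : y' L = y' 0) : y' 0 = 0 ∧ y' (L / 2) = 0 := by
  have hodd := hy.linComb 1 (-1) (hy.reflect fun x => by rw [hφ.pot₁_sub])
  have hz := hmin.dirichlet_eq_zero hL hα hτ hφ hnc hμ (hodd.mono (by linarith))
    (by simp [h0]) (by simp [sub_half])
  have hd := (hodd.mono (show L / 2 ≤ L by linarith)).deriv_zero_eq_zero (by linarith) hz
  have hall := (hodd.eq_zero ((hφ.continuous_pot₁ hα).sub continuous_const) (by simp [h0]) hd
    (L / 2) ⟨by linarith, by linarith⟩).2
  simp only [sub_zero, h1, sub_half] at hd hall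
  constructor <;> linarith

/-- There is at most one negative periodic eigenvalue of `𝓛₁`, and it is simple. -/
theorem negative_unique (hmin : IsEvenMinimizer L ω α τ (fun x => (φ x : ℂ))
    (fun x => ((deriv φ x : ℝ) : ℂ))) (hL : 0 < L) (hα : 0 < α) (hτ : 0 < τ)
    (hφ : IsEvenPositiveWave L ω α φ) (hnc : ∃ x y, φ x ≠ φ y) {μ ν : ℝ} (hμ : μ < 0)
    (hν : ν < 0) {y y' z z' : ℝ → ℝ} (hy : IsSol L (fun x => pot₁ ω α φ x - μ) y y')
    (hyp : y L = y 0) (hyp' : y' L = y' 0)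
    (hz : IsSol L (fun x => pot₁ ω α φ x - ν) z z') (hzp : z L = z 0) (hzp' : z' L = z' 0)
    (hyn : ∃ x ∈ Icc 0 L, y x ≠ 0) :
    (∃ c : ℝ, ∀ x ∈ Icc 0 L, z x = c * y x) ∧ ((∃ x ∈ Icc 0 L, z x ≠ 0) → μ = ν) := by
  have hℓ : (0 : ℝ) ≤ L / 2 := by linarith
  obtain ⟨a0, a1⟩ := hmin.neumann_of_negative hL hα hτ hφ hnc hμ hy hyp hyp'
  obtain ⟨b0, b1⟩ := hmin.neumann_of_negative hL hα hτ hφ hnc hν hz hzp hzp'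
  have hq : ∀ c : ℝ, Continuous fun x => pot₁ ω α φ x - c := fun c =>
    (hφ.continuous_pot₁ hα).sub continuous_const
  have hy0 : y 0 ≠ 0 := by
    intro h
    obtain ⟨x, hx, hne⟩ := hyn
    exact hne (hy.eq_zero (hq μ) h a0 x hx).1
  by_cases hzn : ∃ x ∈ Icc 0 L, z x ≠ 0
  · have hz0 : z 0 ≠ 0 := by
      intro h
      obtain ⟨x, hx, hne⟩ := hzn
      exact hne (hz.eq_zero (hq ν) h b0 x hx).1
    have hμν : μ = ν := by
      by_contra hne
      exact hmin.neumann_unique hL hα hτ hφ hμ hν hne (hy.mono (by linarith))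
        (hz.mono (by linarith)) a0 a1 b0 b1 ⟨0, ⟨le_rfl, hℓ⟩, hy0⟩ ⟨0, ⟨le_rfl, hℓ⟩, hz0⟩
    subst hμν
    refine ⟨⟨z 0 / y 0, fun x hx => ?_⟩, fun _ => rfl⟩
    have h := ((hz.linComb 1 (-(z 0 / y 0)) hy).eq_zero (hq μ) (by field_simp; ring)
      (by simp [a0, b0]) x hx).1
    linarith
  · refine ⟨⟨0, fun x hx => ?_⟩, fun h => absurd h hzn⟩
    push Not at hzn
    rw [hzn x hx, zero_mul]

end IsEvenMinimizer

namespace IsEvenPositiveWave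

variable {L ω α : ℝ} {φ : ℝ → ℝ}

/-- `𝓛₂` has no negative periodic eigenvalue: with `φ > 0` in its kernel, its quadratic form is
`∫ (y' - y φ'/φ)²`. -/
theorem pot₂_negative_eq_zero (hφ : IsEvenPositiveWave L ω α φ) (hL : 0 < L)
    {μ : ℝ} (hμ : μ < 0) {y y' : ℝ → ℝ} (hy : IsSol L (fun x => pot₂ ω α φ x - μ) y y')
    (h0 : y L = y 0) (h1 : y' L = y' 0) : ∀ x ∈ Icc 0 L, y x = 0 := by
  by_contra! hne
  obtain ⟨c, hc, hyc⟩ := hne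
  have hne' : ∀ x, φ x ≠ 0 := fun x => (hφ.pos x).ne'
  have hd : ∀ x ∈ uIcc 0 L, HasDerivAt (fun x => y x * y' x - y x ^ 2 * deriv φ x / φ x)
      ((y' x - y x * deriv φ x / φ x) ^ 2 - μ * y x ^ 2) x := by
    intro x hx
    rw [uIcc_of_le hL.le] at hx
    have hs := (hφ.isSol_self L).hasDerivAt_deriv x hx
    refine (((hy.hasDerivAt x).fun_mul (hy.hasDerivAt_deriv x hx)).fun_sub
      ((((hy.hasDerivAt x).fun_pow 2).fun_mul hs).fun_div (hφ.hasDerivAt x)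
        (hne' x))).congr_deriv ?_
    have := hne' x
    push_cast
    field_simp
    ring
  have hcont : Continuous fun x => (y' x - y x * deriv φ x / φ x) ^ 2 - μ * y x ^ 2 :=
    ((hy.continuous_deriv.sub ((hy.continuous.mul hφ.continuous_deriv).div hφ.continuous
      hne')).pow 2).sub (continuous_const.mul (hy.continuous.pow 2))
  have h := intervalIntegral.integral_eq_sub_of_hasDerivAt hd (hcont.intervalIntegrable _ _)
  have hp : φ L = φ 0 := by simpa using hφ.periodic 0
  have hp' : deriv φ L = deriv φ 0 := by simpa using hφ.deriv_periodic 0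
  rw [h0, h1, hp, hp', sub_self] at h
  have hpos := intervalIntegral.integral_pos hL hcont.continuousOn
    (fun x _ => by nlinarith [sq_nonneg (y' x - y x * deriv φ x / φ x), sq_nonneg (y x)])
    ⟨c, hc, by
      have : 0 < y c ^ 2 := by positivity
      nlinarith [sq_nonneg (y' c - y c * deriv φ c / φ c)]⟩
  linarith

/-- The periodic kernel of `𝓛₂` consists of the multiples of `φ`. -/
theorem pot₂_kernel (hφ : IsEvenPositiveWave L ω α φ) (hL : 0 < L) (hα : 0 < α)
    {y y' : ℝ → ℝ} (hy : IsSol L (pot₂ ω α φ) y y') (h0 : y L = y 0) :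
    ∃ c : ℝ, ∀ x ∈ Icc 0 L, y x = c * φ x := by
  have hs := hφ.isSol_self L
  have hp : φ L = φ 0 := by simpa using hφ.periodic 0
  have hd : ∀ x, HasDerivAt (fun x => y x / φ x) ((y' x * φ x - y x * deriv φ x) / φ x ^ 2) x :=
    fun x => (hy.hasDerivAt x).fun_div (hφ.hasDerivAt x) (hφ.pos x).ne'
  obtain ⟨c, hc, hc0⟩ := exists_hasDerivAt_eq_zero hL
    (fun x _ => (hd x).continuousAt.continuousWithinAt) (by simp only [h0, hp]) fun x _ => hd x
  have hw := hy.wronskian_eq hs c (Ioo_subset_Icc_self hc)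
  rw [div_eq_zero_iff, or_iff_left (pow_ne_zero 2 (hφ.pos c).ne')] at hc0
  rw [hc0, hφ.deriv_zero, mul_zero, sub_zero] at hw
  have hy' : y' 0 = 0 := (mul_eq_zero.mp hw.symm).resolve_right (hφ.pos 0).ne'
  refine ⟨y 0 / φ 0, fun x hx => ?_⟩
  have := (hφ.pos 0).ne'
  have h := ((hy.linComb 1 (-(y 0 / φ 0)) hs).eq_zero (hφ.continuous_pot₂ hα)
    (by field_simp; ring) (by simp [hy', hφ.deriv_zero]) x hx).1
  linarith

end IsEvenPositiveWave

/-! ### Multiplication operators and continuous representatives -/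

section Multiplication

variable {𝕜 : Type*} [RCLike 𝕜] {L : ℝ}

theorem mulPot_coeFn {q : ℝ → ℝ} (hq : Continuous q) (f : L2per 𝕜 L) :
    mulPot 𝕜 L hq f =ᵐ[volume.restrict (Ioc (0 : ℝ) L)] fun x => q x • f x :=
  (memLp_mul hq f).coeFn_toLp

/-- Multiplication by a continuous function, as a bounded operator. -/
noncomputable def mulCLM (𝕜 : Type*) [RCLike 𝕜] (L : ℝ) {q : ℝ → ℝ} (hq : Continuous q) :
    L2per 𝕜 L →L[𝕜] L2per 𝕜 L :=
  (mulPot 𝕜 L hq).mkContinuousOfExistsBound (by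
    obtain ⟨C, hC⟩ := (isCompact_Icc (a := (0 : ℝ)) (b := L)).exists_bound_of_continuousOn
      hq.continuousOn
    refine ⟨C, fun f => Lp.norm_le_mul_norm_of_ae_le_mul ?_⟩
    filter_upwards [mulPot_coeFn hq f, ae_restrict_mem measurableSet_Ioc] with x hx hxI
    rw [hx, norm_smul]
    exact mul_le_mul_of_nonneg_right (hC x (Ioc_subset_Icc_self hxI)) (norm_nonneg _))

theorem mulCLM_coeFn {q : ℝ → ℝ} (hq : Continuous q) (f : L2per 𝕜 L) :
    mulCLM 𝕜 L hq f =ᵐ[volume.restrict (Ioc (0 : ℝ) L)] fun x => q x • f x :=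
  mulPot_coeFn hq f

theorem memLp_of_continuous {g : ℝ → 𝕜} (hg : Continuous g) :
    MemLp g 2 (volume.restrict (Ioc (0 : ℝ) L)) := by
  obtain ⟨C, hC⟩ := (isCompact_Icc (a := (0 : ℝ)) (b := L)).exists_bound_of_continuousOn
    hg.continuousOn
  refine MemLp.of_bound hg.aestronglyMeasurable C ?_
  filter_upwards [ae_restrict_mem measurableSet_Ioc] with x hx
  exact hC x (Ioc_subset_Icc_self hx)

/-- The element of `L²_per` given by a continuous function. -/
noncomputable def contLp (L : ℝ) {g : ℝ → 𝕜} (hg : Continuous g) : L2per 𝕜 L :=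
  (memLp_of_continuous hg).toLp g

theorem contLp_coeFn {g : ℝ → 𝕜} (hg : Continuous g) :
    contLp L hg =ᵐ[volume.restrict (Ioc (0 : ℝ) L)] g :=
  (memLp_of_continuous hg).coeFn_toLp

theorem continuous_ofReal_comp {g : ℝ → ℝ} (hg : Continuous g) :
    Continuous fun x => (g x : 𝕜) :=
  RCLike.continuous_ofReal.comp hg

theorem inner_contLp_ofReal (hL : 0 < L) {g : ℝ → ℝ} (hg : Continuous g) (f : L2per 𝕜 L) :
    inner 𝕜 (contLp L (continuous_ofReal_comp (𝕜 := 𝕜) hg)) f = ∫ x in (0 : ℝ)..L, g x • f x := by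
  rw [L2.inner_def, intervalIntegral.integral_of_le hL.le]
  refine integral_congr_ae ?_
  filter_upwards [contLp_coeFn (L := L) (continuous_ofReal_comp (𝕜 := 𝕜) hg)] with x hx
  rw [hx, RCLike.inner_apply, RCLike.conj_ofReal, RCLike.real_smul_eq_coe_mul, mul_comm]

theorem contLp_injOn (hL : 0 < L) {g h : ℝ → 𝕜} (hg : Continuous g) (hh : Continuous h)
    (e : g =ᵐ[volume.restrict (Ioc (0 : ℝ) L)] h) : EqOn g h (Icc 0 L) := by
  have h1 : g =ᵐ[volume.restrict (Icc (0 : ℝ) L)] h := by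
    rwa [Measure.restrict_congr_set Ioc_ae_eq_Icc] at e
  exact Measure.eqOn_Icc_of_ae_eq volume hL.ne h1 hg.continuousOn hh.continuousOn

end Multiplication

/-! ### Compactness of integral operators with continuous kernel -/

section Kernel

variable {𝕜 : Type*} [RCLike 𝕜] {L : ℝ} {Φ : ℝ → L2per 𝕜 L}

theorem continuous_inner_kernel (hΦ : Continuous Φ) (f : L2per 𝕜 L) :
    Continuous fun x => inner 𝕜 (Φ x) f := hΦ.inner continuous_const

/-- The operator `f ↦ ⟪Φ ·, f⟫` defined by a continuous `L²`-valued kernel `Φ`. -/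
noncomputable def kernelOp (hΦ : Continuous Φ) : L2per 𝕜 L →L[𝕜] L2per 𝕜 L :=
  LinearMap.mkContinuousOfExistsBound
    { toFun := fun f => contLp L (continuous_inner_kernel hΦ f)
      map_add' := fun f g => by
        simp only [contLp]
        rw [← MemLp.toLp_add]
        exact (MemLp.toLp_eq_toLp_iff _ _).mpr (Filter.Eventually.of_forall fun x =>
          inner_add_right _ _ _)
      map_smul' := fun c f => by
        simp only [contLp, RingHom.id_apply]
        rw [← MemLp.toLp_const_smul]
        exact (MemLp.toLp_eq_toLp_iff _ _).mpr (Filter.Eventually.of_forall fun x =>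
          inner_smul_right _ _ _) } (by
    obtain ⟨C, hC⟩ := (isCompact_Icc (a := (0 : ℝ)) (b := L)).exists_bound_of_continuousOn
      hΦ.continuousOn
    refine ⟨(measureUnivNNReal (volume.restrict (Ioc (0 : ℝ) L)) : ℝ) ^ (2 : ENNReal).toReal⁻¹ *
      max C 0, fun f => ?_⟩
    rw [mul_assoc]
    refine Lp.norm_le_of_ae_bound (by positivity) ?_
    filter_upwards [contLp_coeFn (L := L) (continuous_inner_kernel hΦ f),
      ae_restrict_mem measurableSet_Ioc] with x hx hxI
    simp only [LinearMap.coe_mk, AddHom.coe_mk]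
    rw [hx]
    exact (norm_inner_le_norm _ _).trans (mul_le_mul_of_nonneg_right
      ((hC x (Ioc_subset_Icc_self hxI)).trans (le_max_left _ _)) (norm_nonneg _)))

theorem kernelOp_coeFn (hΦ : Continuous Φ) (f : L2per 𝕜 L) :
    kernelOp hΦ f =ᵐ[volume.restrict (Ioc (0 : ℝ) L)] fun x => inner 𝕜 (Φ x) f :=
  contLp_coeFn (continuous_inner_kernel hΦ f)

theorem memLp_step (n : ℕ) (h : ℝ) (a : Fin (n + 1) → 𝕜) :
    MemLp (fun x => a (Fin.ofNat (n + 1) ⌊x / h⌋₊)) 2 (volume.restrict (Ioc (0 : ℝ) L)) := by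
  refine MemLp.of_bound (C := ∑ i, ‖a i‖) ?_ (Filter.Eventually.of_forall fun x =>
    Finset.single_le_sum (f := fun i => ‖a i‖) (fun i _ => norm_nonneg _) (Finset.mem_univ _))
  have h1 : Measurable fun x : ℝ => ⌊x / h⌋₊ := Nat.measurable_floor.comp (measurable_id.div_const h)
  have h2 : Measurable fun k : ℕ => a (Fin.ofNat (n + 1) k) := measurable_from_top
  exact (h2.comp h1).aestronglyMeasurable

/-- The step function with values `a k` on the intervals `[k h, (k+1) h)`, as an element of `L²_per`
depending linearly on the `n + 1` values. -/
noncomputable def stepMap (𝕜 : Type*) [RCLike 𝕜] (L : ℝ) (n : ℕ) (h : ℝ) :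
    (Fin (n + 1) → 𝕜) →ₗ[𝕜] L2per 𝕜 L where
  toFun a := (memLp_step n h a).toLp _
  map_add' a b := by rw [← MemLp.toLp_add]; rfl
  map_smul' c a := by rw [RingHom.id_apply, ← MemLp.toLp_const_smul]; rfl

/-- An operator with continuous kernel is compact, as a norm limit of the finite rank operators
obtained by sampling the kernel. -/
theorem isCompactOperator_kernelOp (hL : 0 < L) (hΦ : Continuous Φ) :
    IsCompactOperator (kernelOp hΦ) := by
  refine isClosed_setOfPred_isCompactOperator.closure_subset (Metric.mem_closure_iff.mpr ?_)
  intro ε hε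
  set M : ℝ := (measureUnivNNReal (volume.restrict (Ioc (0 : ℝ) L)) : ℝ) ^ (2 : ENNReal).toReal⁻¹
    with hM
  have hM0 : 0 ≤ M := by positivity
  have hη : 0 < ε / (2 * (M + 1)) := by positivity
  have huc := isCompact_Icc.uniformContinuousOn_of_continuous
    (hΦ.continuousOn (s := Icc (0 : ℝ) L))
  obtain ⟨δ, hδ, hd⟩ := Metric.uniformContinuousOn_iff.mp huc _ hη
  obtain ⟨n, hn⟩ := exists_nat_gt (L / δ)
  have hn0 : (0 : ℝ) < n := (by positivity : 0 < L / δ).trans hn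
  have hh : 0 < L / n := by positivity
  have hhδ : L / n < δ := by
    rw [div_lt_iff₀ hδ] at hn
    rw [div_lt_iff₀ hn0]; linarith
  let A : L2per 𝕜 L →L[𝕜] (Fin (n + 1) → 𝕜) :=
    ContinuousLinearMap.pi fun k => innerSL 𝕜 (Φ (k * (L / n)))
  let B : (Fin (n + 1) → 𝕜) →L[𝕜] L2per 𝕜 L := (stepMap 𝕜 L n (L / n)).toContinuousLinearMap
  refine ⟨B.comp A, ?_, ?_⟩
  · have hB : IsCompactOperator B := isCompactOperator_of_locallyCompactSpace_rng B
    exact hB.comp_clm A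
  · rw [dist_eq_norm]
    refine lt_of_le_of_lt (ContinuousLinearMap.opNorm_le_bound _
      (show 0 ≤ M * (ε / (2 * (M + 1))) by positivity) fun f => ?_) ?_
    · rw [mul_assoc]
      refine Lp.norm_le_of_ae_bound (by positivity) ?_
      have hB : B (A f) =ᵐ[volume.restrict (Ioc (0 : ℝ) L)]
          fun x => A f (Fin.ofNat (n + 1) ⌊x / (L / n)⌋₊) := (memLp_step n (L / n) (A f)).coeFn_toLp
      filter_upwards [Lp.coeFn_sub (kernelOp hΦ f) (B (A f)), kernelOp_coeFn hΦ f, hB,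
        ae_restrict_mem measurableSet_Ioc] with x h1 h2 h3 hx
      have e : (kernelOp hΦ - B.comp A) f = kernelOp hΦ f - B (A f) := rfl
      rw [e, h1, Pi.sub_apply, h2, h3]
      have hxh : 0 ≤ x / (L / n) := by have := hx.1; positivity
      have hfl := Nat.floor_le hxh
      have hfl2 := Nat.lt_floor_add_one (x / (L / n))
      rw [le_div_iff₀ hh] at hfl
      rw [div_lt_iff₀ hh] at hfl2
      have hk : ⌊x / (L / n)⌋₊ < n + 1 := by
        rw [Nat.lt_add_one_iff, ← Nat.cast_le (α := ℝ)]
        have : (⌊x / (L / n)⌋₊ : ℝ) * (L / n) ≤ n * (L / n) := by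
          rw [mul_div_cancel₀ _ hn0.ne']; exact hfl.trans hx.2
        exact le_of_mul_le_mul_right this hh
      have hval : ((Fin.ofNat (n + 1) ⌊x / (L / n)⌋₊ : Fin (n + 1)) : ℕ) = ⌊x / (L / n)⌋₊ := by
        simp [Fin.ofNat, Nat.mod_eq_of_lt hk]
      simp only [A, ContinuousLinearMap.coe_pi', innerSL_apply_apply, hval]
      rw [← inner_sub_left]
      refine (norm_inner_le_norm _ _).trans (mul_le_mul_of_nonneg_right ?_ (norm_nonneg _))
      rw [← dist_eq_norm]
      refine (hd x ⟨hx.1.le, hx.2⟩ _ ⟨by positivity, hfl.trans hx.2⟩ ?_).le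
      rw [Real.dist_eq, abs_lt]
      constructor <;> linarith
    · have : M * (ε / (2 * (M + 1))) = ε * (M / (2 * (M + 1))) := by ring
      rw [this]
      refine mul_lt_of_lt_one_right hε ?_
      rw [div_lt_one (by positivity)]
      linarith

end Kernel

/-! ### Primitives of square integrable functions -/

section Primitive

variable {𝕜 : Type*} [RCLike 𝕜] {L : ℝ}

/-- The indicator function of `(-∞, x]`, as an element of `L²_per`. -/
noncomputable def cutoff (𝕜 : Type*) [RCLike 𝕜] (L x : ℝ) : L2per 𝕜 L :=
  indicatorConstLp 2 (measurableSet_Iic (a := x)) (measure_ne_top _ _) (1 : 𝕜)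

theorem continuous_cutoff : Continuous (cutoff 𝕜 L) := by
  refine continuous_indicatorConstLp_set (by norm_num) fun x => ?_
  refine tendsto_of_tendsto_of_tendsto_of_le_of_le (g := fun _ => 0)
    (h := fun y => ENNReal.ofReal |y - x|) tendsto_const_nhds ?_ (fun _ => zero_le)
    fun y => ?_
  · have h : Continuous fun y : ℝ => ENNReal.ofReal |y - x| :=
      ENNReal.continuous_ofReal.comp ((continuous_id.sub continuous_const).abs)
    simpa using h.tendsto x
  · refine (Measure.restrict_apply_le _ _).trans ?_
    have hs : symmDiff (Iic y) (Iic x) ⊆ uIoc x y := by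
      intro t ht
      rw [mem_symmDiff, mem_Iic, mem_Iic, not_le, not_le] at ht
      rw [mem_uIoc]
      rcases ht with h | h
      · exact Or.inl ⟨h.2, h.1⟩
      · exact Or.inr ⟨h.2, h.1⟩
    refine (measure_mono hs).trans ?_
    rw [uIoc, Real.volume_Ioc, max_sub_min_eq_abs]

/-- The primitive `x ↦ ∫₀ˣ g` of an `L²_per` function, defined on the whole line (constant outside
the period) as an inner product with a cut-off function. -/
noncomputable def primitive (g : L2per 𝕜 L) (x : ℝ) : 𝕜 := inner 𝕜 (cutoff 𝕜 L x) g

theorem continuous_primitive (g : L2per 𝕜 L) : Continuous (primitive g) :=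
  continuous_cutoff.inner continuous_const

theorem primitive_eq (g : L2per 𝕜 L) {x : ℝ} (hx : x ∈ Icc 0 L) :
    primitive g x = ∫ t in (0 : ℝ)..x, g t := by
  rw [primitive, cutoff, L2.inner_indicatorConstLp_one, Measure.restrict_restrict measurableSet_Iic,
    intervalIntegral.integral_of_le hx.1]
  congr 2
  ext t
  simp only [mem_inter_iff, mem_Iic, mem_Ioc]
  constructor
  · rintro ⟨h1, h2, -⟩; exact ⟨h2, h1⟩
  · rintro ⟨h1, h2⟩; exact ⟨h2, h1, h2.trans hx.2⟩

theorem primitive_eq_of_ae (g : L2per 𝕜 L) {h : ℝ → 𝕜}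
    (e : g =ᵐ[volume.restrict (Ioc (0 : ℝ) L)] h) {x : ℝ} (hx : x ∈ Icc 0 L) :
    primitive g x = ∫ t in (0 : ℝ)..x, h t := by
  rw [primitive_eq g hx, intervalIntegral.integral_of_le hx.1, intervalIntegral.integral_of_le hx.1]
  exact integral_congr_ae (ae_restrict_of_ae_restrict_of_subset (Ioc_subset_Ioc_right hx.2) e)

theorem integral_deriv_smul_of_hasDerivAt (hL : 0 < L) {ψ : ℝ → ℝ} (hψ : ContDiff ℝ 1 ψ)
    {u u' : ℝ → 𝕜} (hu : Continuous u) (hu' : Continuous u')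
    (hd : ∀ x ∈ Icc 0 L, HasDerivAt u (u' x) x) :
    ∫ x in (0 : ℝ)..L, deriv ψ x • u x =
      ψ L • u L - ψ 0 • u 0 - ∫ x in (0 : ℝ)..L, ψ x • u' x := by
  have hψ' : Continuous (deriv ψ) := hψ.continuous_deriv (by norm_num)
  have c1 : Continuous fun x => deriv ψ x • u x := hψ'.smul hu
  have c2 : Continuous fun x => ψ x • u' x := hψ.continuous.smul hu'
  rw [eq_sub_iff_add_eq, ← intervalIntegral.integral_add (c1.intervalIntegrable _ _)
    (c2.intervalIntegrable _ _)]
  refine intervalIntegral.integral_eq_sub_of_hasDerivAt (f := fun x => ψ x • u x) (fun x hx => ?_)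
    ((c1.add c2).intervalIntegrable _ _)
  rw [uIcc_of_le hL.le] at hx
  exact ((((hψ.differentiable (by norm_num)) x).hasDerivAt).fun_smul (hd x hx)).congr_deriv
    (add_comm _ _)

theorem dense_contLp (𝕜 : Type*) [RCLike 𝕜] (L : ℝ) :
    Dense {f : L2per 𝕜 L | ∃ (g : ℝ → 𝕜) (hg : Continuous g), f = contLp L hg} := by
  refine (BoundedContinuousFunction.toLp_denseRange (E := 𝕜) (p := 2)
    (μ := volume.restrict (Ioc (0 : ℝ) L)) 𝕜 (by norm_num)).mono ?_
  rintro _ ⟨g, rfl⟩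
  refine ⟨g, g.continuous, Lp.ext ?_⟩
  filter_upwards [BoundedContinuousFunction.coeFn_toLp (p := 2) (𝕜 := 𝕜)
    (volume.restrict (Ioc (0 : ℝ) L)) g, contLp_coeFn (L := L) g.continuous] with x h1 h2
  rw [h1, h2]

/-- Integration by parts against the primitive of an `L²_per` function; it extends from continuous
functions by density. -/
theorem integral_deriv_smul_primitive (hL : 0 < L) {ψ : ℝ → ℝ} (hψ : ContDiff ℝ 1 ψ)
    (g : L2per 𝕜 L) :
    ∫ x in (0 : ℝ)..L, deriv ψ x • primitive g x =
      ψ L • primitive g L - ∫ x in (0 : ℝ)..L, ψ x • g x := by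
  have hψ' : Continuous (deriv ψ) := hψ.continuous_deriv (by norm_num)
  let V := kernelOp (continuous_cutoff (𝕜 := 𝕜) (L := L))
  have e1 : ∀ g : L2per 𝕜 L, ∫ x in (0 : ℝ)..L, deriv ψ x • primitive g x =
      inner 𝕜 (contLp L (continuous_ofReal_comp (𝕜 := 𝕜) hψ')) (V g) := fun g => by
    rw [inner_contLp_ofReal hL hψ']
    exact (integral_smul_congr hL _ (kernelOp_coeFn continuous_cutoff g)).symm
  simp only [e1, ← inner_contLp_ofReal hL hψ.continuous]
  refine (isClosed_eq ?_ ?_ : IsClosed {g : L2per 𝕜 L | inner 𝕜 (contLp L (continuous_ofReal_comp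
    (𝕜 := 𝕜) hψ')) (V g) = ψ L • primitive g L - inner 𝕜 (contLp L (continuous_ofReal_comp (𝕜 := 𝕜)
      hψ.continuous)) g}).closure_subset_iff.mpr ?_ (dense_contLp 𝕜 L g)
  · exact continuous_const.inner V.continuous
  · exact (((continuous_const (y := cutoff 𝕜 L L)).inner continuous_id).const_smul _).sub
      (continuous_const.inner continuous_id)
  · rintro _ ⟨h, hh, rfl⟩
    have hd : ∀ x, HasDerivAt (fun x => ∫ t in (0 : ℝ)..x, h t) (h x) x := fun x =>
      intervalIntegral.integral_hasDerivAt_right (hh.intervalIntegrable _ _)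
        (hh.stronglyMeasurableAtFilter _ _) hh.continuousAt
    have hc : Continuous fun x => ∫ t in (0 : ℝ)..x, h t :=
      continuous_iff_continuousAt.mpr fun x => (hd x).continuousAt
    have h1 := integral_deriv_smul_of_hasDerivAt hL hψ hc hh fun x _ => hd x
    have hp : ∀ x ∈ Icc 0 L, primitive (contLp L hh) x = ∫ t in (0 : ℝ)..x, h t := fun x hx =>
      primitive_eq_of_ae _ (contLp_coeFn hh) hx
    rw [mem_ofPred_eq, ← e1, inner_contLp_ofReal hL hψ.continuous, integral_smul_congr hL _ (contLp_coeFn hh),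
      hp L ⟨hL.le, le_rfl⟩]
    rw [intervalIntegral.integral_same, smul_zero, sub_zero] at h1
    rw [← h1]
    refine intervalIntegral.integral_congr fun x hx => ?_
    rw [uIcc_of_le hL.le] at hx
    simp only [hp x hx]

open scoped ContDiff in
/-- A function orthogonal to the derivatives of all periodic test functions is constant. -/
theorem eq_const_of_periodic_tests (hL : 0 < L) (w : L2per 𝕜 L)
    (hw : ∀ ψ : ℝ → ℝ, ContDiff ℝ ∞ ψ → Function.Periodic ψ L →
      ∫ x in (0 : ℝ)..L, deriv ψ x • w x = 0) :
    w = contLp L (continuous_const (y := (1 / L) • ∫ x in (0 : ℝ)..L, w x)) := by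
  rw [← sub_eq_zero]
  refine eq_zero_of_periodic_tests hL _ fun χ hχ hP => ?_
  set m : ℝ := (1 / L) * ∫ x in (0 : ℝ)..L, χ x with hm
  set c : 𝕜 := (1 / L) • ∫ x in (0 : ℝ)..L, w x with hc
  have hcont : Continuous fun x => χ x - m := hχ.continuous.sub continuous_const
  have hd : ∀ x, HasDerivAt (fun x => ∫ t in (0 : ℝ)..x, (χ t - m)) (χ x - m) x := fun x =>
    intervalIntegral.integral_hasDerivAt_right (hcont.intervalIntegrable _ _)
      (hcont.stronglyMeasurableAtFilter _ _) hcont.continuousAt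
  have hderiv : deriv (fun x => ∫ t in (0 : ℝ)..x, (χ t - m)) = fun x => χ x - m :=
    funext fun x => (hd x).deriv
  have h0 : ∫ t in (0 : ℝ)..L, (χ t - m) = 0 := by
    rw [intervalIntegral.integral_sub (hχ.continuous.intervalIntegrable _ _)
      (continuous_const.intervalIntegrable _ _), intervalIntegral.integral_const, hm, smul_eq_mul]
    field_simp
    ring
  -- test against the primitive of `χ` minus its mean, which is periodic
  have h := hw (fun x => ∫ t in (0 : ℝ)..x, (χ t - m)) (contDiff_infty_iff_deriv.mpr
    ⟨fun x => (hd x).differentiableAt, by rw [hderiv]; exact hχ.sub contDiff_const⟩) (fun x => by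
      have hp : Function.Periodic (fun x => χ x - m) L := fun x => by simp only [hP x]
      have h1 := hp.intervalIntegral_add_eq 0 x
      rw [zero_add, h0] at h1
      have h2 := intervalIntegral.integral_add_adjacent_intervals (hcont.intervalIntegrable 0 x)
        (hcont.intervalIntegrable (μ := volume) x (x + L))
      rw [← h1, add_zero] at h2
      exact h2.symm)
  simp only [hderiv, sub_smul] at h
  rw [intervalIntegral.integral_sub (intervalIntegrable_smul hL hχ.continuous w)
    (intervalIntegrable_smul hL continuous_const w), intervalIntegral.integral_smul] at h
  have h2 := integral_smul_add hL hχ.continuous (w - contLp L (continuous_const (y := c)))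
    (contLp L (continuous_const (y := c)))
  rw [sub_add_cancel, integral_smul_congr hL χ (contLp_coeFn (continuous_const (y := c))),
    intervalIntegral.integral_smul_const] at h2
  have h3 : m • ∫ x in (0 : ℝ)..L, w x = (∫ x in (0 : ℝ)..L, χ x) • c := by
    rw [hm, hc, smul_smul, mul_comm]
  rw [h3, h2] at h
  simpa using h

/-- The projection of `L²_per` onto the constants, `w ↦ L⁻¹ ∫₀ᴸ w`. -/
noncomputable def meanOp (𝕜 : Type*) [RCLike 𝕜] (L : ℝ) : L2per 𝕜 L →L[𝕜] L2per 𝕜 L :=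
  (innerSL 𝕜 (cutoff 𝕜 L L)).smulRight (contLp L (continuous_const (y := ((1 / L : ℝ) : 𝕜))))

theorem meanOp_apply (hL : 0 < L) (w : L2per 𝕜 L) :
    meanOp 𝕜 L w = contLp L (continuous_const (y := (1 / L) • ∫ x in (0 : ℝ)..L, w x)) := by
  have e : meanOp 𝕜 L w = primitive w L • contLp L (continuous_const (y := ((1 / L : ℝ) : 𝕜))) := rfl
  rw [e, primitive_eq w ⟨hL.le, le_rfl⟩]
  refine Lp.ext ?_
  filter_upwards [Lp.coeFn_smul (∫ x in (0 : ℝ)..L, w x)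
      (contLp L (continuous_const (y := ((1 / L : ℝ) : 𝕜)))),
    contLp_coeFn (L := L) (continuous_const (y := ((1 / L : ℝ) : 𝕜))),
    contLp_coeFn (L := L) (continuous_const (y := (1 / L) • ∫ x in (0 : ℝ)..L, w x))]
    with x h1 h2 h3
  rw [h1, h3, Pi.smul_apply, h2, smul_eq_mul, mul_comm, RCLike.real_smul_eq_coe_mul]

theorem isCompactOperator_meanOp : IsCompactOperator (meanOp 𝕜 L) := by
  have h : IsCompactOperator (innerSL 𝕜 (cutoff 𝕜 L L)) :=
    isCompactOperator_of_locallyCompactSpace_dom _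
  exact h.clm_comp (ContinuousLinearMap.toSpanSingleton 𝕜
    (contLp L (continuous_const (y := ((1 / L : ℝ) : 𝕜)))))

/-- An `L²_per` function with weak derivative `g` is, up to a constant, the primitive of `g`. -/
theorem HasPerWeakDeriv.eq_meanOp_add_primitive (hL : 0 < L) {f g : L2per 𝕜 L}
    (h : HasPerWeakDeriv L f g) : primitive g L = 0 ∧
      f = meanOp 𝕜 L (f - kernelOp continuous_cutoff g) + kernelOp continuous_cutoff g := by
  have h0 : primitive g L = 0 := by
    have h1 := h (fun _ => 1) contDiff_const fun _ => rfl
    simp only [deriv_const', zero_smul, intervalIntegral.integral_zero, one_smul] at h1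
    rw [primitive_eq g ⟨hL.le, le_rfl⟩, ← neg_eq_zero, ← h1]
  rw [meanOp_apply hL]
  refine ⟨h0, sub_eq_iff_eq_add.mp (eq_const_of_periodic_tests hL _ fun ψ hψ hP => ?_)⟩
  have hψ' : Continuous (deriv ψ) := hψ.continuous_deriv (by norm_num)
  have h2 := integral_smul_add hL hψ' (f - kernelOp continuous_cutoff g)
    (kernelOp continuous_cutoff g)
  rw [sub_add_cancel, integral_smul_congr hL _ (kernelOp_coeFn continuous_cutoff g)] at h2
  have h3 := integral_deriv_smul_primitive hL (hψ.of_le (by norm_cast)) g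
  rw [h0, smul_zero, zero_sub] at h3
  rw [h ψ hψ hP] at h2
  simp only [primitive] at h3
  rw [h3] at h2
  simpa using h2

theorem hasPerWeakDeriv_contLp (hL : 0 < L) {u u' : ℝ → 𝕜} (hu : Continuous u)
    (hu' : Continuous u') (hd : ∀ x ∈ Icc 0 L, HasDerivAt u (u' x) x) (hp : u L = u 0) :
    HasPerWeakDeriv L (contLp L hu) (contLp L hu') := by
  intro ψ hψ hP
  rw [integral_smul_congr hL _ (contLp_coeFn hu), integral_smul_congr hL _ (contLp_coeFn hu'),
    integral_deriv_smul_of_hasDerivAt hL (hψ.of_le (by norm_cast)) hu hu' hd, hp,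
    hP.eq]
  simp

end Primitive

/-! ### Regularity of the domain of a Hill operator -/

section Regularity

variable {𝕜 : Type*} [RCLike 𝕜] {L : ℝ}

theorem hill_eq_iff (hL : 0 < L) {q : ℝ → ℝ} (hq : Continuous q) (f g : L2per 𝕜 L) :
    (∃ h : f ∈ (hill 𝕜 hL hq).domain, hill 𝕜 hL hq ⟨f, h⟩ = g) ↔
      HasSecondDeriv f (mulPot 𝕜 L hq f - g) := by
  constructor
  · rintro ⟨h, rfl⟩
    rw [← secondDeriv_eq_iff hL ⟨f, h⟩]
    change _ = mulPot 𝕜 L hq f - (-secondDeriv 𝕜 hL ⟨f, h⟩ + mulPot 𝕜 L hq f)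
    abel
  · intro h
    refine ⟨⟨_, h⟩, ?_⟩
    change -secondDeriv 𝕜 hL ⟨f, _⟩ + mulPot 𝕜 L hq f = g
    rw [(secondDeriv_eq_iff hL ⟨f, ⟨_, h⟩⟩ _).mpr h]
    abel

theorem HasPerWeakDeriv.exists_ae_eq (hL : 0 < L) {f g : L2per 𝕜 L}
    (h : HasPerWeakDeriv L f g) : primitive g L = 0 ∧
      ∃ a : 𝕜, f =ᵐ[volume.restrict (Ioc (0 : ℝ) L)] fun x => a + primitive g x := by
  obtain ⟨h0, h1⟩ := h.eq_meanOp_add_primitive hL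
  have h2 := Lp.coeFn_add (meanOp 𝕜 L (f - kernelOp continuous_cutoff g))
    (kernelOp continuous_cutoff g)
  rw [← h1, meanOp_apply hL] at h2
  refine ⟨h0, (1 / L) • ∫ x in (0 : ℝ)..L, (f - kernelOp continuous_cutoff g : L2per 𝕜 L) x, ?_⟩
  filter_upwards [h2, contLp_coeFn (L := L) (continuous_const (y := (1 / L) • ∫ x in (0 : ℝ)..L,
    (f - kernelOp continuous_cutoff g : L2per 𝕜 L) x)), kernelOp_coeFn continuous_cutoff g]
    with x e1 e2 e3
  rw [e1, Pi.add_apply, e2, e3]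
  rfl

theorem hasDerivAt_add_integral {h : ℝ → 𝕜} (hh : Continuous h) (a : 𝕜) (x : ℝ) :
    HasDerivAt (fun x => a + ∫ t in (0 : ℝ)..x, h t) (h x) x :=
  (intervalIntegral.integral_hasDerivAt_right (hh.intervalIntegrable _ _)
    (hh.stronglyMeasurableAtFilter _ _) hh.continuousAt).const_add a

/-- A weak solution of `f'' = q f` is a classical one. -/
theorem HasSecondDeriv.exists_classical (hL : 0 < L) {q : ℝ → ℝ} (hq : Continuous q)
    {f f₂ : L2per 𝕜 L} (hf : HasSecondDeriv f f₂)
    (he : f₂ =ᵐ[volume.restrict (Ioc (0 : ℝ) L)] fun x => q x • f x) :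
    ∃ Y Y' : ℝ → 𝕜, (∀ x, HasDerivAt Y (Y' x) x) ∧ Continuous Y' ∧
      (∀ x ∈ Icc 0 L, HasDerivAt Y' (q x • Y x) x) ∧ Y L = Y 0 ∧ Y' L = Y' 0 ∧
      f =ᵐ[volume.restrict (Ioc (0 : ℝ) L)] Y := by
  obtain ⟨f₁, h1, h2⟩ := hf
  obtain ⟨p1, a, ha⟩ := h1.exists_ae_eq hL
  obtain ⟨p2, b, hb⟩ := h2.exists_ae_eq hL
  have hF : Continuous fun x => q x • (a + primitive f₁ x) :=
    hq.smul (continuous_const.add (continuous_primitive f₁))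
  have hY'd := hasDerivAt_add_integral hF b
  have hY' : Continuous fun x => b + ∫ t in (0 : ℝ)..x, q t • (a + primitive f₁ t) :=
    continuous_iff_continuousAt.mpr fun x => (hY'd x).continuousAt
  have e2 : ∀ x ∈ Icc 0 L, primitive f₂ x = ∫ t in (0 : ℝ)..x, q t • (a + primitive f₁ t) :=
    fun x hx => primitive_eq_of_ae _ (by
      filter_upwards [he, ha] with t h3 h4
      rw [h3, h4]) hx
  have e1 : ∀ x ∈ Icc 0 L, primitive f₁ x = ∫ t in (0 : ℝ)..x,
      (b + ∫ s in (0 : ℝ)..t, q s • (a + primitive f₁ s)) :=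
    fun x hx => primitive_eq_of_ae _ (by
      filter_upwards [hb, ae_restrict_mem measurableSet_Ioc] with t h3 h4
      rw [h3, e2 t (Ioc_subset_Icc_self h4)]) hx
  have hLm : L ∈ Icc 0 L := ⟨hL.le, le_rfl⟩
  refine ⟨_, _, hasDerivAt_add_integral hY' a, hY', fun x hx => ?_, ?_, ?_, ?_⟩
  · rw [← e1 x hx]
    exact hY'd x
  · simp only [← e1 L hLm, p1, intervalIntegral.integral_same]
  · simp only [← e2 L hLm, p2, intervalIntegral.integral_same]
  · filter_upwards [ha, ae_restrict_mem measurableSet_Ioc] with t h3 h4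
    rw [h3, e1 t (Ioc_subset_Icc_self h4)]

/-- A real or complex weak solution of `f'' = q f` consists of one or two real classical periodic
solutions, its real and imaginary parts. -/
theorem HasSecondDeriv.exists_isSol (hL : 0 < L) {q : ℝ → ℝ} (hq : Continuous q)
    {f f₂ : L2per 𝕜 L} (hf : HasSecondDeriv f f₂)
    (he : f₂ =ᵐ[volume.restrict (Ioc (0 : ℝ) L)] fun x => q x • f x) :
    ∃ y y' z z' : ℝ → ℝ, IsSol L q y y' ∧ y L = y 0 ∧ y' L = y' 0 ∧
      IsSol L q z z' ∧ z L = z 0 ∧ z' L = z' 0 ∧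
      f =ᵐ[volume.restrict (Ioc (0 : ℝ) L)] fun x => (y x : 𝕜) + (z x : 𝕜) * RCLike.I := by
  obtain ⟨Y, Y', h1, h2, h3, h4, h5, h6⟩ := hf.exists_classical hL hq he
  refine ⟨fun x => RCLike.re (Y x), fun x => RCLike.re (Y' x), fun x => RCLike.im (Y x),
    fun x => RCLike.im (Y' x),
    ⟨fun x => ?_, RCLike.continuous_re.comp h2, fun x hx => ?_⟩, congrArg _ h4, congrArg _ h5,
    ⟨fun x => ?_, RCLike.continuous_im.comp h2, fun x hx => ?_⟩, congrArg _ h4, congrArg _ h5, ?_⟩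
  · exact (RCLike.reCLM (K := 𝕜)).hasFDerivAt.comp_hasDerivAt x (h1 x)
  · exact ((RCLike.reCLM (K := 𝕜)).hasFDerivAt.comp_hasDerivAt x (h3 x hx)).congr_deriv
      (RCLike.smul_re _ _)
  · exact (RCLike.imCLM (K := 𝕜)).hasFDerivAt.comp_hasDerivAt x (h1 x)
  · exact ((RCLike.imCLM (K := 𝕜)).hasFDerivAt.comp_hasDerivAt x (h3 x hx)).congr_deriv
      (RCLike.smul_im _ _)
  · filter_upwards [h6] with x hx
    rw [hx, RCLike.re_add_im]

/-- Classical periodic solutions of `y'' = r y` lie in `H²_per`. -/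
theorem IsSol.hill_contLp (hL : 0 < L) {q r y y' : ℝ → ℝ} (hq : Continuous q) (hr : Continuous r)
    (hy : IsSol L r y y') (h0 : y L = y 0) (h1 : y' L = y' 0)
    (hc : Continuous fun x => (q x - r x) * y x) :
    ∃ h : contLp L (continuous_ofReal_comp (𝕜 := 𝕜) hy.continuous) ∈ (hill 𝕜 hL hq).domain,
      hill 𝕜 hL hq ⟨_, h⟩ = contLp L (continuous_ofReal_comp (𝕜 := 𝕜) hc) := by
  rw [hill_eq_iff]
  have c2 : Continuous fun x => r x * y x := hr.mul hy.continuous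
  have e : mulPot 𝕜 L hq (contLp L (continuous_ofReal_comp (𝕜 := 𝕜) hy.continuous)) -
      contLp L (continuous_ofReal_comp (𝕜 := 𝕜) hc) =
        contLp L (continuous_ofReal_comp (𝕜 := 𝕜) c2) := by
    refine Lp.ext ?_
    filter_upwards [Lp.coeFn_sub (mulPot 𝕜 L hq (contLp L (continuous_ofReal_comp (𝕜 := 𝕜)
      hy.continuous))) (contLp L (continuous_ofReal_comp (𝕜 := 𝕜) hc)),
      mulPot_coeFn hq (contLp L (continuous_ofReal_comp (𝕜 := 𝕜) hy.continuous)),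
      contLp_coeFn (L := L) (continuous_ofReal_comp (𝕜 := 𝕜) hy.continuous),
      contLp_coeFn (L := L) (continuous_ofReal_comp (𝕜 := 𝕜) hc),
      contLp_coeFn (L := L) (continuous_ofReal_comp (𝕜 := 𝕜) c2)] with x e1 e2 e3 e4 e5
    rw [e1, Pi.sub_apply, e2, e3, e4, e5, RCLike.real_smul_eq_coe_mul]
    push_cast
    ring
  rw [e]
  have hd : ∀ x, HasDerivAt (fun x => (y x : 𝕜)) (y' x : 𝕜) x := fun x =>
    (RCLike.ofRealCLM (K := 𝕜)).hasFDerivAt.comp_hasDerivAt x (hy.hasDerivAt x)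
  have hd' : ∀ x ∈ Icc 0 L, HasDerivAt (fun x => (y' x : 𝕜)) ((r x * y x : ℝ) : 𝕜) x :=
    fun x hx => (RCLike.ofRealCLM (K := 𝕜)).hasFDerivAt.comp_hasDerivAt x (hy.hasDerivAt_deriv x hx)
  exact ⟨contLp L (continuous_ofReal_comp (𝕜 := 𝕜) hy.continuous_deriv),
    hasPerWeakDeriv_contLp hL _ _ (fun x _ => hd x) (by rw [h0]),
    hasPerWeakDeriv_contLp hL _ _ hd' (by rw [h1])⟩

/-- The eigenfunctions of a Hill operator to a real eigenvalue are those with classical real and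
imaginary parts. -/
theorem mem_eigenspaceOp_hill (hL : 0 < L) {q : ℝ → ℝ} (hq : Continuous q) {μ : ℝ}
    {f : L2per 𝕜 L} : f ∈ eigenspaceOp (hill 𝕜 hL hq) (μ : 𝕜) ↔
      ∃ y y' z z' : ℝ → ℝ, IsSol L (fun x => q x - μ) y y' ∧ y L = y 0 ∧ y' L = y' 0 ∧
        IsSol L (fun x => q x - μ) z z' ∧ z L = z 0 ∧ z' L = z' 0 ∧
        f =ᵐ[volume.restrict (Ioc (0 : ℝ) L)] fun x => (y x : 𝕜) + (z x : 𝕜) * RCLike.I := by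
  have hqμ : Continuous fun x => q x - μ := hq.sub continuous_const
  constructor
  · intro h
    rw [mem_eigenspaceOp, hill_eq_iff] at h
    refine h.exists_isSol hL hqμ ?_
    filter_upwards [Lp.coeFn_sub (mulPot 𝕜 L hq f) ((μ : 𝕜) • f), mulPot_coeFn hq f,
      Lp.coeFn_smul (μ : 𝕜) f] with x e1 e2 e3
    rw [e1, Pi.sub_apply, e2, e3, Pi.smul_apply, sub_smul, RCLike.real_smul_eq_coe_smul (K := 𝕜) μ]
  · rintro ⟨y, y', z, z', hy, hy0, hy1, hz, hz0, hz1, he⟩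
    have key : ∀ {y y' : ℝ → ℝ} (hy : IsSol L (fun x => q x - μ) y y'), y L = y 0 → y' L = y' 0 →
        contLp L (continuous_ofReal_comp (𝕜 := 𝕜) hy.continuous) ∈
          eigenspaceOp (hill 𝕜 hL hq) (μ : 𝕜) := by
      intro y y' hy h0 h1
      have hc : Continuous fun x => (q x - (q x - μ)) * y x := (hq.sub hqμ).mul hy.continuous
      rw [mem_eigenspaceOp]
      obtain ⟨h, e⟩ := hy.hill_contLp (𝕜 := 𝕜) hL hq hqμ h0 h1 hc
      refine ⟨h, e.trans (Lp.ext ?_)⟩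
      filter_upwards [contLp_coeFn (L := L) (continuous_ofReal_comp (𝕜 := 𝕜) hc),
        contLp_coeFn (L := L) (continuous_ofReal_comp (𝕜 := 𝕜) hy.continuous),
        Lp.coeFn_smul (μ : 𝕜) (contLp L (continuous_ofReal_comp (𝕜 := 𝕜) hy.continuous))]
        with x e1 e2 e3
      rw [e1, e3, Pi.smul_apply, e2, smul_eq_mul]
      push_cast
      ring
    have : f = contLp L (continuous_ofReal_comp (𝕜 := 𝕜) hy.continuous) +
        (RCLike.I : 𝕜) • contLp L (continuous_ofReal_comp (𝕜 := 𝕜) hz.continuous) := by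
      refine Lp.ext ?_
      filter_upwards [he, contLp_coeFn (L := L) (continuous_ofReal_comp (𝕜 := 𝕜) hy.continuous),
        contLp_coeFn (L := L) (continuous_ofReal_comp (𝕜 := 𝕜) hz.continuous),
        Lp.coeFn_smul (RCLike.I : 𝕜) (contLp L (continuous_ofReal_comp (𝕜 := 𝕜) hz.continuous)),
        Lp.coeFn_add (contLp L (continuous_ofReal_comp (𝕜 := 𝕜) hy.continuous))
        ((RCLike.I : 𝕜) • contLp L (continuous_ofReal_comp (𝕜 := 𝕜) hz.continuous))]
        with x e1 e2 e3 e4 e5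
      rw [e1, e5, Pi.add_apply, e4, Pi.smul_apply, e2, e3, smul_eq_mul, mul_comm (RCLike.I : 𝕜)]
    rw [this]
    exact Submodule.add_mem _ (key hy hy0 hy1) (Submodule.smul_mem _ _ (key hz hz0 hz1))

/-- A Hill operator with potential at least one is injective: the hypothesis is `-f'' + q f = 0`. -/
theorem HasSecondDeriv.eq_zero_of_one_le (hL : 0 < L) {q : ℝ → ℝ} (hq : Continuous q)
    (h1 : ∀ x, 1 ≤ q x) {f : L2per 𝕜 L} (hf : HasSecondDeriv f (mulPot 𝕜 L hq f)) : f = 0 := by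
  obtain ⟨y, y', z, z', hy, hy0, hy1, hz, hz0, hz1, he⟩ :=
    hf.exists_isSol hL hq (mulPot_coeFn hq f)
  rw [Lp.eq_zero_iff_ae_eq_zero]
  filter_upwards [he, ae_restrict_mem measurableSet_Ioc] with x e hx
  rw [e, hy.eq_zero_of_one_le hL hq h1 hy0 hy1 x (Ioc_subset_Icc_self hx),
    hz.eq_zero_of_one_le hL hq h1 hz0 hz1 x (Ioc_subset_Icc_self hx)]
  simp

end Regularity

/-! ### Compact resolvent of a Hill operator -/

section Resolvent

variable {𝕜 : Type*} [RCLike 𝕜] {L : ℝ}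

theorem mulCLM_contLp {q g : ℝ → ℝ} (hq : Continuous q) (hg : Continuous g)
    (hm : Continuous fun x => q x * g x) :
    mulCLM 𝕜 L hq (contLp L (continuous_ofReal_comp (𝕜 := 𝕜) hg)) =
      contLp L (continuous_ofReal_comp (𝕜 := 𝕜) hm) := by
  refine Lp.ext ?_
  filter_upwards [mulCLM_coeFn hq (contLp L (continuous_ofReal_comp (𝕜 := 𝕜) hg)),
    contLp_coeFn (L := L) (continuous_ofReal_comp (𝕜 := 𝕜) hg),
    contLp_coeFn (L := L) (continuous_ofReal_comp (𝕜 := 𝕜) hm)] with x e1 e2 e3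
  rw [e1, e2, e3, RCLike.real_smul_eq_coe_mul]
  push_cast
  rfl

/-- The energy space of `-∂ₓ² + p` as a closed subspace of `L² × L²`: the function `f` is represented
by the pair `(√p f, f')`, whose squared norm is the quadratic form `∫ |f'|² + p |f|²`. The
argument `m` is the function `1 / √p`. -/
noncomputable def energySpace (𝕜 : Type*) [RCLike 𝕜] (hL : 0 < L) {m : ℝ → ℝ}
    (hm : Continuous m) : Submodule 𝕜 (WithLp 2 (L2per 𝕜 L × L2per 𝕜 L)) where
  carrier := {w | HasPerWeakDeriv L (mulCLM 𝕜 L hm w.fst) w.snd}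
  add_mem' := fun {v w} hv hw => by
    have h := HasPerWeakDeriv.add hL hv hw
    rwa [← map_add] at h
  zero_mem' := by
    change HasPerWeakDeriv L (mulCLM 𝕜 L hm 0) (0 : L2per 𝕜 L)
    rw [map_zero]
    exact HasPerWeakDeriv.zero hL
  smul_mem' := fun c w hw => by
    have h := HasPerWeakDeriv.smul hL c hw
    rwa [← map_smul] at h

open scoped ContDiff in
theorem isClosed_energySpace (hL : 0 < L) {m : ℝ → ℝ} (hm : Continuous m) :
    IsClosed (energySpace 𝕜 hL hm : Set (WithLp 2 (L2per 𝕜 L × L2per 𝕜 L))) := by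
  have e : (energySpace 𝕜 hL hm : Set (WithLp 2 (L2per 𝕜 L × L2per 𝕜 L))) =
      ⋂ (ψ : ℝ → ℝ) (hψ : ContDiff ℝ ∞ ψ) (_ : Function.Periodic ψ L),
        {w | inner 𝕜 (contLp L (continuous_ofReal_comp (𝕜 := 𝕜)
          (hψ.continuous_deriv (by norm_num)))) (mulCLM 𝕜 L hm w.fst) =
            -inner 𝕜 (contLp L (continuous_ofReal_comp (𝕜 := 𝕜) hψ.continuous)) w.snd} := by
    ext w
    simp only [mem_iInter, mem_ofPred_eq]
    refine forall_congr' fun ψ => forall_congr' fun hψ => forall_congr' fun _ => ?_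
    rw [inner_contLp_ofReal hL (hψ.continuous_deriv (by norm_num)),
      inner_contLp_ofReal hL hψ.continuous]
  rw [e]
  refine isClosed_iInter fun ψ => isClosed_iInter fun hψ => isClosed_iInter fun _ => isClosed_eq ?_ ?_
  · exact continuous_const.inner ((mulCLM 𝕜 L hm).continuous.comp
      (WithLp.fstL 2 𝕜 (L2per 𝕜 L) (L2per 𝕜 L)).continuous)
  · exact (continuous_const.inner (WithLp.sndL 2 𝕜 (L2per 𝕜 L) (L2per 𝕜 L)).continuous).neg

/-- The embedding of the energy space into `L²_per`. -/
noncomputable def energyEmbedding (𝕜 : Type*) [RCLike 𝕜] (hL : 0 < L) {m : ℝ → ℝ}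
    (hm : Continuous m) : energySpace 𝕜 hL hm →L[𝕜] L2per 𝕜 L :=
  (mulCLM 𝕜 L hm).comp ((WithLp.fstL 2 𝕜 (L2per 𝕜 L) (L2per 𝕜 L)).comp
    (energySpace 𝕜 hL hm).subtypeL)

theorem isCompactOperator_energyEmbedding (hL : 0 < L) {m : ℝ → ℝ} (hm : Continuous m) :
    IsCompactOperator (energyEmbedding 𝕜 hL hm) := by
  let V := kernelOp (continuous_cutoff (𝕜 := 𝕜) (L := L))
  let D : energySpace 𝕜 hL hm →L[𝕜] L2per 𝕜 L :=
    (WithLp.sndL 2 𝕜 (L2per 𝕜 L) (L2per 𝕜 L)).comp (energySpace 𝕜 hL hm).subtypeL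
  have e : energyEmbedding 𝕜 hL hm =
      (meanOp 𝕜 L).comp (energyEmbedding 𝕜 hL hm - V.comp D) + V.comp D :=
    ContinuousLinearMap.ext fun w => (HasPerWeakDeriv.eq_meanOp_add_primitive hL w.2).2
  have hV : IsCompactOperator V := isCompactOperator_kernelOp hL _
  rw [e]
  exact ((isCompactOperator_meanOp (𝕜 := 𝕜) (L := L)).comp_clm _).add (hV.comp_clm D)

/-- A Hill operator whose potential is bounded below by one has a compact positive inverse. It is
`ι ι†`, where `ι` is the compact embedding of the energy space. -/
theorem exists_inverse_hill (hL : 0 < L) {p : ℝ → ℝ} (hp : Continuous p) (h1 : ∀ x, 1 ≤ p x) :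
    ∃ S : L2per 𝕜 L →L[𝕜] L2per 𝕜 L, IsCompactOperator S ∧ S.IsPositive ∧
      (∀ f, HasSecondDeriv (S f) (mulPot 𝕜 L hp (S f) - f)) ∧
      ∀ f g, HasSecondDeriv f (mulPot 𝕜 L hp f - g) → S g = f := by
  have hsq : ∀ x, 0 < √(p x) := fun x => Real.sqrt_pos.mpr (lt_of_lt_of_le one_pos (h1 x))
  have hs : Continuous fun x => √(p x) := hp.sqrt
  have hm : Continuous fun x => (√(p x))⁻¹ := hs.inv₀ fun x => (hsq x).ne'
  have : CompleteSpace (energySpace 𝕜 hL hm) :=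
    (isClosed_energySpace hL hm).completeSpace_coe
  set ι := energyEmbedding 𝕜 hL hm with hι
  have hS : ∀ f, HasSecondDeriv ((ι.comp ι.adjoint) f) (mulPot 𝕜 L hp ((ι.comp ι.adjoint) f) - f) := by
    intro f
    set w := ι.adjoint f with hw
    refine ⟨(w : WithLp 2 (L2per 𝕜 L × L2per 𝕜 L)).snd, w.2, fun ψ hψ hP => ?_⟩
    have hψ' : Continuous (deriv ψ) := hψ.continuous_deriv (by norm_num)
    have hsψ : Continuous fun x => √(p x) * ψ x := hs.mul hψ.continuous
    have hmsψ : Continuous fun x => (√(p x))⁻¹ * (√(p x) * ψ x) := hm.mul hsψ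
    have e1 : mulCLM 𝕜 L hm (contLp L (continuous_ofReal_comp (𝕜 := 𝕜) hsψ)) =
        contLp L (continuous_ofReal_comp (𝕜 := 𝕜) hψ.continuous) := by
      rw [mulCLM_contLp hm hsψ hmsψ]
      congr 1
      funext x
      rw [inv_mul_cancel_left₀ (hsq x).ne']
    -- the weak equation, tested against the element of the energy space given by `ψ`
    let v : energySpace 𝕜 hL hm := ⟨WithLp.toLp 2
      (contLp L (continuous_ofReal_comp (𝕜 := 𝕜) hsψ), contLp L (continuous_ofReal_comp (𝕜 := 𝕜) hψ')),
      by
        change HasPerWeakDeriv L (mulCLM 𝕜 L hm (contLp L (continuous_ofReal_comp (𝕜 := 𝕜) hsψ))) _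
        rw [e1]
        refine hasPerWeakDeriv_contLp hL _ (continuous_ofReal_comp hψ') (fun x _ => ?_) (by rw [hP.eq])
        exact (RCLike.ofRealCLM (K := 𝕜)).hasFDerivAt.comp_hasDerivAt x
          ((hψ.differentiable (by norm_num)) x).hasDerivAt⟩
    have h := ContinuousLinearMap.adjoint_inner_right ι v f
    rw [← hw, Submodule.coe_inner, WithLp.prod_inner_apply] at h
    change inner 𝕜 (contLp L (continuous_ofReal_comp (𝕜 := 𝕜) hsψ)) w.1.fst +
      inner 𝕜 (contLp L (continuous_ofReal_comp (𝕜 := 𝕜) hψ')) w.1.snd =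
        inner 𝕜 (mulCLM 𝕜 L hm (contLp L (continuous_ofReal_comp (𝕜 := 𝕜) hsψ))) f at h
    rw [e1, inner_contLp_ofReal hL hsψ, inner_contLp_ofReal hL hψ',
      inner_contLp_ofReal hL hψ.continuous] at h
    have e2 : ∫ x in (0 : ℝ)..L, (√(p x) * ψ x) • w.1.fst x =
        ∫ x in (0 : ℝ)..L, ψ x • mulPot 𝕜 L hp (ι w) x := by
      have : (fun x => √(p x) • w.1.fst x) =ᵐ[volume.restrict (Ioc (0 : ℝ) L)]
          mulPot 𝕜 L hp (ι w) := by
        filter_upwards [mulPot_coeFn hp (ι w), mulCLM_coeFn hm w.1.fst] with x e3 e4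
        rw [e3]
        change _ = p x • mulCLM 𝕜 L hm w.1.fst x
        rw [e4, smul_smul]
        congr 1
        rw [← div_eq_mul_inv, eq_div_iff (hsq x).ne',
          Real.mul_self_sqrt (zero_le_one.trans (h1 x))]
      rw [← integral_smul_congr hL ψ this]
      simp only [smul_smul, mul_comm (ψ _)]
    have h3 := integral_smul_add hL hψ.continuous (mulPot 𝕜 L hp (ι w) - f) f
    rw [sub_add_cancel, ← e2, ← h] at h3
    rw [eq_neg_iff_add_eq_zero]
    change _ + ∫ x in (0 : ℝ)..L, ψ x • (mulPot 𝕜 L hp (ι w) - f : L2per 𝕜 L) x = 0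
    linear_combination -h3
  refine ⟨ι.comp ι.adjoint, (isCompactOperator_energyEmbedding hL hm).comp_clm _,
    ContinuousLinearMap.isPositive_self_comp_adjoint ι, hS, fun f g hf => ?_⟩
  rw [← sub_eq_zero]
  refine HasSecondDeriv.eq_zero_of_one_le hL hp h1 ?_
  have h := (hS g).add hL (hf.smul hL (-1))
  have e1 : (ι.comp ι.adjoint) g + (-1 : 𝕜) • f = (ι.comp ι.adjoint) g - f := by
    rw [neg_one_smul, sub_eq_add_neg]
  rw [e1] at h
  convert h using 1
  rw [map_sub, neg_one_smul]
  abel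

/-- A Hill operator has a compact positive resolvent at every point far enough to the left. -/
theorem exists_resolvent_hill (hL : 0 < L) {q : ℝ → ℝ} (hq : Continuous q) {c : ℝ}
    (hc : ∀ x, 1 ≤ q x + c) :
    ∃ S : L2per 𝕜 L →L[𝕜] L2per 𝕜 L, IsCompactOperator S ∧ S.IsPositive ∧
      (∀ f, ∃ h : S f ∈ (hill 𝕜 hL hq).domain, hill 𝕜 hL hq ⟨S f, h⟩ = f - (c : 𝕜) • S f) ∧
      ∀ x : (hill 𝕜 hL hq).domain, S (hill 𝕜 hL hq x + (c : 𝕜) • (x : L2per 𝕜 L)) = x := by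
  have hp : Continuous fun x => q x + c := hq.add continuous_const
  obtain ⟨S, h1, h2, h3, h4⟩ := exists_inverse_hill (𝕜 := 𝕜) hL hp hc
  have e : ∀ f : L2per 𝕜 L, mulPot 𝕜 L hp f = mulPot 𝕜 L hq f + (c : 𝕜) • f := fun f => by
    refine Lp.ext ?_
    filter_upwards [mulPot_coeFn hp f, mulPot_coeFn hq f, Lp.coeFn_smul (c : 𝕜) f,
      Lp.coeFn_add (mulPot 𝕜 L hq f) ((c : 𝕜) • f)] with x e1 e2 e3 e4
    rw [e1, e4, Pi.add_apply, e2, e3, add_smul, Pi.smul_apply,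
      RCLike.real_smul_eq_coe_smul (K := 𝕜) c]
  refine ⟨S, h1, h2, fun f => ?_, fun x => h4 _ _ ?_⟩
  · rw [hill_eq_iff]
    convert h3 f using 1
    rw [e]
    abel
  · have := (hill_eq_iff hL hq (x : L2per 𝕜 L) (hill 𝕜 hL hq x)).mp ⟨x.2, rfl⟩
    convert this using 1
    rw [e]
    abel

end Resolvent

/-! ### Spectrum of an operator with compact positive resolvent -/

section CompactResolvent

open Module.End

variable {𝕜 E : Type*} [RCLike 𝕜] [NormedAddCommGroup E] [InnerProductSpace 𝕜 E]

/-- `S` is a compact positive operator, inverse to `A + c`. -/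
structure HasCompactResolvent (A : E →ₗ.[𝕜] E) (c : ℝ) (S : E →L[𝕜] E) : Prop where
  isCompactOperator : IsCompactOperator S
  isPositive : S.IsPositive
  apply_resolvent : ∀ f, ∃ h : S f ∈ A.domain, A ⟨S f, h⟩ = f - (c : 𝕜) • S f
  resolvent_apply : ∀ x : A.domain, S (A x + (c : 𝕜) • (x : E)) = x

namespace HasCompactResolvent

variable {A : E →ₗ.[𝕜] E} {c : ℝ} {S : E →L[𝕜] E}

theorem neg_mem_resolventSetOp (h : HasCompactResolvent A c S) : -(c : 𝕜) ∈ resolventSetOp A := by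
  refine ⟨S, fun y => ?_, fun x => ?_⟩
  · obtain ⟨h1, h2⟩ := h.apply_resolvent y
    exact ⟨h1, by rw [h2, neg_smul]; abel⟩
  · rw [neg_smul, sub_neg_eq_add, h.resolvent_apply]

theorem add_ne_zero (h : HasCompactResolvent A c S) {z : 𝕜} (hz : IsEigenvalueOp A z) :
    z + c ≠ 0 := by
  intro h0
  refine hz ((Submodule.eq_bot_iff _).mpr fun x hx => ?_)
  obtain ⟨h1, h2⟩ := mem_eigenspaceOp.mp hx
  have h3 := h.resolvent_apply ⟨x, h1⟩
  rw [h2, ← add_smul, h0, zero_smul, map_zero] at h3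
  exact h3.symm

theorem eigenspaceOp_eq (h : HasCompactResolvent A c S) {z : 𝕜} (hz : z + c ≠ 0) :
    eigenspaceOp A z = eigenspace (S : E →ₗ[𝕜] E) (z + c)⁻¹ := by
  ext x
  rw [mem_eigenspaceOp, mem_eigenspace_iff, ContinuousLinearMap.coe_coe]
  constructor
  · rintro ⟨h1, h2⟩
    have h3 := h.resolvent_apply ⟨x, h1⟩
    rw [h2, ← add_smul, map_smul] at h3
    rw [eq_inv_smul_iff₀ hz]
    exact h3
  · intro h1
    obtain ⟨h2, h3⟩ := h.apply_resolvent x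
    have h4 : x = (z + c) • S x := by rw [h1, smul_inv_smul₀ hz]
    have h5 : x ∈ A.domain := by rw [h4]; exact A.domain.smul_mem _ h2
    refine ⟨h5, ?_⟩
    have h6 : (⟨x, h5⟩ : A.domain) = (z + c) • ⟨S x, h2⟩ := Subtype.ext h4
    rw [h6, A.map_smul, h3, smul_sub, smul_comm, ← h4, ← sub_smul, add_sub_cancel_right]

theorem hasEigenvalue (h : HasCompactResolvent A c S) {z : 𝕜} (hz : IsEigenvalueOp A z) :
    HasEigenvalue (S : E →ₗ[𝕜] E) (z + c)⁻¹ := by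
  rw [hasEigenvalue_iff, ← h.eigenspaceOp_eq (h.add_ne_zero hz)]
  exact hz

/-- The eigenvalues are real and lie to the right of `-c`. -/
theorem exists_eq_ofReal (h : HasCompactResolvent A c S) {z : 𝕜} (hz : IsEigenvalueOp A z) :
    ∃ μ : ℝ, z = μ ∧ 0 < μ + c := by
  have h0 := h.add_ne_zero hz
  have h1 := h.hasEigenvalue hz
  have h2 := RCLike.conj_eq_iff_re.mp (h.isPositive.isSymmetric.conj_eigenvalue_eq_self h1)
  rw [← h2] at h1
  have h3 := eigenvalue_nonneg_of_nonneg h1 fun x => h.isPositive.re_inner_nonneg_right x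
  set κ := RCLike.re (z + (c : 𝕜))⁻¹ with hκ
  have h4 : z + c = ((κ⁻¹ : ℝ) : 𝕜) := by rw [RCLike.ofReal_inv, h2, inv_inv]
  refine ⟨κ⁻¹ - c, by rw [RCLike.ofReal_sub, ← h4, add_sub_cancel_right], ?_⟩
  rw [sub_add_cancel]
  refine lt_of_le_of_ne (inv_nonneg.mpr h3) fun h5 => h0 ?_
  rw [h4, ← h5, RCLike.ofReal_zero]

/-- There are only finitely many eigenvalues in a bounded set: orthonormal eigenvectors to such
eigenvalues have images under the resolvent whose mutual distances are bounded below. -/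
theorem finite_eigenvalues (h : HasCompactResolvent A c S) (r : ℝ) :
    ({z | IsEigenvalueOp A z} ∩ Metric.closedBall (0 : 𝕜) r).Finite := by
  by_contra hinf
  let f := Set.Infinite.natEmbedding _ hinf
  have hev : ∀ n, IsEigenvalueOp A (f n : 𝕜) := fun n => (f n).2.1
  have hx : ∀ n, ∃ x : E, S x = ((f n : 𝕜) + c)⁻¹ • x ∧ ‖x‖ = 1 := fun n => by
    obtain ⟨v, hv⟩ := (h.hasEigenvalue (hev n)).exists_hasEigenvector
    have hv0 : ‖v‖ ≠ 0 := norm_ne_zero_iff.mpr hv.2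
    refine ⟨((‖v‖⁻¹ : ℝ) : 𝕜) • v, ?_, ?_⟩
    · have := hv.apply_eq_smul
      rw [ContinuousLinearMap.coe_coe] at this
      rw [map_smul, this, smul_comm]
    · rw [norm_smul, RCLike.norm_ofReal, abs_inv, abs_norm, inv_mul_cancel₀ hv0]
  choose x hSx hx1 using hx
  set δ : ℝ := (|r| + |c|+ 1)⁻¹ with hδ
  have hδ0 : 0 < δ := by positivity
  have hκ : ∀ n, δ ≤ ‖((f n : 𝕜) + c)⁻¹‖ := fun n => by
    rw [norm_inv, hδ]
    refine inv_anti₀ (norm_pos_iff.mpr (h.add_ne_zero (hev n))) ?_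
    have h1 := norm_add_le (f n : 𝕜) (c : 𝕜)
    have h2 : ‖(f n : 𝕜)‖ ≤ r := mem_closedBall_zero_iff.mp (f n).2.2
    rw [RCLike.norm_ofReal] at h1
    linarith [le_abs_self r]
  have hdist : ∀ m n, m ≠ n → δ ≤ ‖S (x m) - S (x n)‖ := fun m n hmn => by
    have hne : ((f m : 𝕜) + c)⁻¹ ≠ ((f n : 𝕜) + c)⁻¹ := fun e =>
      hmn (f.injective (Subtype.ext (add_right_cancel (inv_injective e))))
    have horth : inner 𝕜 (x m) (x n) = 0 :=
      h.isPositive.isSymmetric.orthogonalFamily_eigenspaces hne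
        ⟨x m, mem_eigenspace_iff.mpr (hSx m)⟩ ⟨x n, mem_eigenspace_iff.mpr (hSx n)⟩
    have h1 : ‖S (x m) - S (x n)‖ * ‖S (x m) - S (x n)‖ =
        ‖S (x m)‖ * ‖S (x m)‖ + ‖S (x n)‖ * ‖S (x n)‖ := by
      rw [sub_eq_add_neg, norm_add_sq_eq_norm_sq_add_norm_sq_of_inner_eq_zero (𝕜 := 𝕜), norm_neg]
      rw [inner_neg_right, hSx, hSx, inner_smul_left, inner_smul_right, horth, mul_zero, mul_zero,
        neg_zero]
    have h2 : δ ≤ ‖S (x m)‖ := by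
      rw [hSx, norm_smul, hx1, mul_one]
      exact hκ m
    nlinarith [norm_nonneg (S (x m) - S (x n)), mul_self_nonneg ‖S (x n)‖]
  have hK := h.isCompactOperator.isCompact_closure_image_closedBall 1
  obtain ⟨a, -, φ, hφ, hlim⟩ := hK.tendsto_subseq (x := fun n => S (x n)) fun n =>
    subset_closure ⟨x n, by simp [hx1 n], rfl⟩
  obtain ⟨N, hN⟩ := Metric.cauchySeq_iff'.mp hlim.cauchySeq δ hδ0
  have h1 := hN (N + 1) (Nat.le_succ N)
  rw [dist_eq_norm] at h1
  exact absurd h1 (not_lt.mpr (hdist _ _ (hφ (Nat.lt_succ_self N)).ne'))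

variable [CompleteSpace E]

theorem finiteDimensional (h : HasCompactResolvent A c S) (z : 𝕜) :
    FiniteDimensional 𝕜 (eigenspaceOp A z) := by
  by_cases hz : IsEigenvalueOp A z
  swap
  · rw [not_ne_iff.mp hz]
    infer_instance
  have h0 := h.add_ne_zero hz
  rw [h.eigenspaceOp_eq h0]
  exact ContinuousLinearMap.finite_dimensional_eigenspace h.isCompactOperator _ (inv_ne_zero h0)

/-- The Fredholm alternative, transferred from the compact resolvent. -/
theorem isEigenvalueOp_of_mem_spectrumOp (h : HasCompactResolvent A c S) {z : 𝕜}
    (hz : z ∈ spectrumOp A) : IsEigenvalueOp A z := by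
  by_cases h0 : z + c = 0
  · rw [eq_neg_of_add_eq_zero_left h0] at hz
    exact (hz h.neg_mem_resolventSetOp).elim
  by_contra hne
  refine hz ?_
  set κ := (z + (c : 𝕜))⁻¹ with hκ
  have hκ0 : κ ≠ 0 := inv_ne_zero h0
  have h1 : ¬ HasEigenvalue (S : E →ₗ[𝕜] E) κ := by
    rw [hasEigenvalue_iff, ← h.eigenspaceOp_eq h0]
    exact hne
  obtain ⟨T, hT1, hT2⟩ := isUnit_iff_exists.mp (spectrum.mem_resolventSet_iff.mp
    ((h.isCompactOperator.hasEigenvalue_or_mem_resolventSet hκ0).resolve_left h1))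
  have e1 : ∀ y, κ • T y - S (T y) = y := fun y => by
    have := DFunLike.congr_fun hT1 y
    simpa [Algebra.algebraMap_eq_smul_one] using this
  have e2 : ∀ y, T (κ • y - S y) = y := fun y => by
    have := DFunLike.congr_fun hT2 y
    simpa [Algebra.algebraMap_eq_smul_one] using this
  -- the resolvent of `A` at `z` is `κ S T`
  refine ⟨S.comp (κ • T), fun y => ?_, fun x => ?_⟩
  · obtain ⟨h2, h3⟩ := h.apply_resolvent (κ • T y)
    refine ⟨h2, ?_⟩
    change A ⟨S (κ • T y), h2⟩ - z • S (κ • T y) = y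
    rw [h3, sub_sub, ← add_smul, add_comm (c : 𝕜), map_smul, smul_smul, hκ, mul_inv_cancel₀ h0,
      one_smul, ← hκ, e1]
  · have h2 := h.resolvent_apply x
    have h3 : ∀ y, S (T y) = T (S y) := fun y => by
      have h4 := e2 (S (T y))
      rw [← map_smul, ← map_sub, e1] at h4
      exact h4.symm
    change S (κ • T (A x - z • (x : E))) = x
    rw [map_smul, h3]
    have h4 : A x - z • (x : E) = (A x + (c : 𝕜) • (x : E)) - (z + c) • (x : E) := by
      rw [add_smul]; abel
    rw [h4, map_sub, h2, map_smul, ← map_smul, smul_sub, smul_smul, hκ, inv_mul_cancel₀ h0,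
      one_smul, ← hκ, e2]

/-- If the quadratic form of `A` takes a negative value then `A` has a negative eigenvalue:
otherwise the spectral radius, which is the norm, of the resolvent at `-c` is at most `1 / c`. -/
theorem exists_neg_eigenvalue (h : HasCompactResolvent A c S) (hc : 0 < c) (x : A.domain)
    (hx : RCLike.re (inner 𝕜 (A x) (x : E)) < 0) : ∃ μ : ℝ, μ < 0 ∧ IsEigenvalueOp A (μ : 𝕜) := by
  by_contra! hno
  have hnorm : ‖S‖ ≤ c⁻¹ := by
    have h1 := S.spectralRadius_eq_nnnorm h.isPositive.isSelfAdjoint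
    have h2 : spectralRadius 𝕜 S ≤ ENNReal.ofReal c⁻¹ := by
      refine iSup₂_le fun κ hκ => ?_
      rw [← enorm_eq_nnnorm, ← ofReal_norm]
      refine ENNReal.ofReal_le_ofReal ?_
      by_cases h0 : κ = 0
      · rw [h0, norm_zero]; positivity
      have h3 := (h.isCompactOperator.hasEigenvalue_iff_mem_spectrum h0).mpr hκ
      have h4 : (κ⁻¹ - c + (c : 𝕜)) = κ⁻¹ := sub_add_cancel _ _
      have h5 : IsEigenvalueOp A (κ⁻¹ - c : 𝕜) := by
        rw [IsEigenvalueOp, h.eigenspaceOp_eq (by rw [h4]; exact inv_ne_zero h0), h4, inv_inv]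
        exact hasEigenvalue_iff.mp h3
      obtain ⟨μ, h6, h7⟩ := h.exists_eq_ofReal h5
      have h8 : 0 ≤ μ := by
        by_contra h9
        exact hno μ (not_le.mp h9) (h6 ▸ h5)
      have h10 : κ = (((μ + c)⁻¹ : ℝ) : 𝕜) := by
        rw [RCLike.ofReal_inv, RCLike.ofReal_add, ← h6, h4, inv_inv]
      rw [h10, RCLike.norm_ofReal, abs_of_pos (inv_pos.mpr h7)]
      exact inv_anti₀ hc (by linarith)
    rw [h1, ← enorm_eq_nnnorm, ← ofReal_norm] at h2
    exact (ENNReal.ofReal_le_ofReal_iff (by positivity)).mp h2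
  set g := A x + (c : 𝕜) • (x : E) with hg
  have hSg : S g = x := h.resolvent_apply x
  -- positivity of `S` at `g - c S g` together with `‖S‖ ≤ 1 / c`
  have h1 := h.isPositive.re_inner_nonneg_left (g - (c : 𝕜) • (x : E))
  rw [map_sub, map_smul, hSg] at h1
  have h2 : RCLike.re (inner 𝕜 (S (x : E)) (x : E)) ≤ c⁻¹ * ‖(x : E)‖ ^ 2 := by
    have h3 := RCLike.re_le_norm (inner 𝕜 (S (x : E)) (x : E))
    have h4 := norm_inner_le_norm (𝕜 := 𝕜) (S (x : E)) (x : E)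
    have h5 := S.le_of_opNorm_le hnorm (x : E)
    have h6 := mul_le_mul_of_nonneg_right h5 (norm_nonneg (x : E))
    nlinarith
  have h3 : inner 𝕜 (S (x : E)) g = inner 𝕜 (x : E) (x : E) := by
    rw [show inner 𝕜 (S (x : E)) g = inner 𝕜 (x : E) (S g) from h.isPositive.isSymmetric _ _, hSg]
  have h4 : RCLike.re (inner 𝕜 (x : E) g) =
      RCLike.re (inner 𝕜 (A x) (x : E)) + c * ‖(x : E)‖ ^ 2 := by
    rw [hg, inner_add_right, inner_smul_right, map_add, RCLike.re_ofReal_mul,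
      inner_self_eq_norm_sq, inner_re_symm]
  rw [inner_sub_left, inner_sub_right, inner_sub_right, inner_smul_left, inner_smul_left,
    inner_smul_right, inner_smul_right, h3, RCLike.conj_ofReal, map_sub, map_sub, map_sub,
    RCLike.re_ofReal_mul, RCLike.re_ofReal_mul, RCLike.re_ofReal_mul,
    inner_self_eq_norm_sq, h4] at h1
  have h5 : c * (c * RCLike.re (inner 𝕜 (S (x : E)) (x : E))) ≤ c * ‖(x : E)‖ ^ 2 := by
    have := mul_le_mul_of_nonneg_left h2 hc.le
    rw [mul_inv_cancel_left₀ hc.ne'] at this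
    exact mul_le_mul_of_nonneg_left this hc.le
  linarith

end HasCompactResolvent

end CompactResolvent

/-! ### Diagonal operators -/

section Diagonal

variable {𝕜 E F : Type*} [RCLike 𝕜] [NormedAddCommGroup E] [NormedSpace 𝕜 E]
  [NormedAddCommGroup F] [NormedSpace 𝕜 F] {A : E →ₗ.[𝕜] E} {B : F →ₗ.[𝕜] F}

theorem eigenspaceOp_diagOp (z : 𝕜) :
    eigenspaceOp (diagOp A B) z = (eigenspaceOp A z).prod (eigenspaceOp B z) := by
  ext ⟨x, y⟩
  rw [Submodule.mem_prod, mem_eigenspaceOp, mem_eigenspaceOp, mem_eigenspaceOp]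
  constructor
  · rintro ⟨h, e⟩
    exact ⟨⟨h.1, congrArg Prod.fst e⟩, h.2, congrArg Prod.snd e⟩
  · rintro ⟨⟨h1, e1⟩, h2, e2⟩
    exact ⟨⟨h1, h2⟩, Prod.ext e1 e2⟩

theorem isEigenvalueOp_diagOp {z : 𝕜} :
    IsEigenvalueOp (diagOp A B) z ↔ IsEigenvalueOp A z ∨ IsEigenvalueOp B z := by
  rw [IsEigenvalueOp, IsEigenvalueOp, IsEigenvalueOp, eigenspaceOp_diagOp, ne_eq,
    Submodule.prod_eq_bot_iff, not_and_or]

theorem spectrumOp_diagOp_subset :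
    spectrumOp (diagOp A B) ⊆ spectrumOp A ∪ spectrumOp B := by
  intro z hz
  by_contra hne
  rw [mem_union, not_or, spectrumOp, spectrumOp, notMem_compl_iff, notMem_compl_iff] at hne
  obtain ⟨⟨R, h1, h2⟩, T, h3, h4⟩ := hne
  refine hz ⟨R.prodMap T, fun y => ?_, fun x => ?_⟩
  · obtain ⟨h5, e5⟩ := h1 y.1
    obtain ⟨h6, e6⟩ := h3 y.2
    exact ⟨⟨h5, h6⟩, Prod.ext e5 e6⟩
  · exact Prod.ext (h2 ⟨x.1.1, x.2.1⟩) (h4 ⟨x.1.2, x.2.2⟩)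

end Diagonal

/-! ### Eigenspaces of Hill operators in terms of real classical solutions -/

section HillSpectrum

variable {𝕜 : Type*} [RCLike 𝕜] {L : ℝ}

theorem exists_hasCompactResolvent_hill (𝕜 : Type*) [RCLike 𝕜] (hL : 0 < L) {q : ℝ → ℝ}
    (hq : Continuous q) (hP : Function.Periodic q L) :
    ∃ c : ℝ, 0 < c ∧ ∃ S, HasCompactResolvent (hill 𝕜 hL hq) c S := by
  obtain ⟨C, hC⟩ := (isCompact_Icc (a := (0 : ℝ)) (b := L)).exists_bound_of_continuousOn
    hq.continuousOn
  have hb : ∀ x, 1 ≤ q x + (|C| + 1) := fun x => by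
    obtain ⟨y, hy, e⟩ := hP.exists_mem_Ico₀ hL x
    have h := hC y (Ico_subset_Icc_self hy)
    rw [Real.norm_eq_abs] at h
    rw [e]
    linarith [neg_abs_le (q y), le_abs_self C]
  obtain ⟨S, h1, h2, h3, h4⟩ := exists_resolvent_hill (𝕜 := 𝕜) hL hq hb
  exact ⟨|C| + 1, by positivity, S, h1, h2, h3, h4⟩

theorem contLp_ne_zero (hL : 0 < L) {y : ℝ → ℝ} (hy : Continuous y)
    (h : ∃ x ∈ Icc 0 L, y x ≠ 0) : contLp L (continuous_ofReal_comp (𝕜 := 𝕜) hy) ≠ 0 := by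
  intro h0
  obtain ⟨x, hx, hxy⟩ := h
  have h1 := contLp_coeFn (L := L) (continuous_ofReal_comp (𝕜 := 𝕜) hy)
  rw [h0] at h1
  have h2 := contLp_injOn hL (continuous_ofReal_comp (𝕜 := 𝕜) hy) (continuous_const (y := (0 : 𝕜)))
    (h1.symm.trans (Lp.coeFn_zero 𝕜 2 _)) hx
  exact hxy (RCLike.ofReal_eq_zero.mp h2)

/-- If all real periodic solutions of `y'' = (q - μ) y` are multiples of `e`, then the real or
complex eigenspace is spanned by `e`. -/
theorem eigenspaceOp_hill_eq_span (hL : 0 < L) {q : ℝ → ℝ} (hq : Continuous q) {μ : ℝ}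
    {e e' : ℝ → ℝ} (he : IsSol L (fun x => q x - μ) e e') (h0 : e L = e 0) (h1 : e' L = e' 0)
    (hu : ∀ {y y' : ℝ → ℝ}, IsSol L (fun x => q x - μ) y y' → y L = y 0 → y' L = y' 0 →
      ∃ c : ℝ, ∀ x ∈ Icc 0 L, y x = c * e x) :
    eigenspaceOp (hill 𝕜 hL hq) (μ : 𝕜) =
      Submodule.span 𝕜 {contLp L (continuous_ofReal_comp (𝕜 := 𝕜) he.continuous)} := by
  refine le_antisymm (fun f hf => ?_) ?_
  · obtain ⟨y, y', z, z', hy, hy0, hy1, hz, hz0, hz1, h⟩ := (mem_eigenspaceOp_hill hL hq).mp hf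
    obtain ⟨a, ha⟩ := hu hy hy0 hy1
    obtain ⟨b, hb⟩ := hu hz hz0 hz1
    refine Submodule.mem_span_singleton.mpr ⟨(a : 𝕜) + (b : 𝕜) * RCLike.I, Lp.ext ?_⟩
    filter_upwards [h, Lp.coeFn_smul ((a : 𝕜) + (b : 𝕜) * RCLike.I)
      (contLp L (continuous_ofReal_comp (𝕜 := 𝕜) he.continuous)),
      contLp_coeFn (L := L) (continuous_ofReal_comp (𝕜 := 𝕜) he.continuous),
      ae_restrict_mem measurableSet_Ioc] with x e1 e2 e3 hx
    rw [e1, e2, Pi.smul_apply, e3, ha x (Ioc_subset_Icc_self hx), hb x (Ioc_subset_Icc_self hx),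
      smul_eq_mul]
    push_cast
    ring
  · rw [Submodule.span_singleton_le_iff_mem, mem_eigenspaceOp_hill]
    refine ⟨e, e', fun _ => 0, fun _ => 0, he, h0, h1, ⟨fun x => hasDerivAt_const x 0,
      continuous_const, fun x _ => (hasDerivAt_const x 0).congr_deriv (by ring)⟩, rfl, rfl, ?_⟩
    filter_upwards [contLp_coeFn (L := L) (continuous_ofReal_comp (𝕜 := 𝕜) he.continuous)] with x hx
    rw [hx]
    simp

theorem exists_isSol_of_isEigenvalueOp (hL : 0 < L) {q : ℝ → ℝ} (hq : Continuous q) {μ : ℝ}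
    (h : IsEigenvalueOp (hill 𝕜 hL hq) (μ : 𝕜)) :
    ∃ y y' : ℝ → ℝ, IsSol L (fun x => q x - μ) y y' ∧ y L = y 0 ∧ y' L = y' 0 ∧
      ∃ x ∈ Icc 0 L, y x ≠ 0 := by
  obtain ⟨f, hf, hf0⟩ := Submodule.exists_mem_ne_zero_of_ne_bot h
  obtain ⟨y, y', z, z', hy, hy0, hy1, hz, hz0, hz1, he⟩ := (mem_eigenspaceOp_hill hL hq).mp hf
  by_contra! hno
  refine hf0 ?_
  rw [Lp.eq_zero_iff_ae_eq_zero]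
  filter_upwards [he, ae_restrict_mem measurableSet_Ioc] with x e hx
  rw [e, hno y y' hy hy0 hy1 x (Ioc_subset_Icc_self hx),
    hno z z' hz hz0 hz1 x (Ioc_subset_Icc_self hx)]
  simp

end HillSpectrum

/-! ### Spectrum of the linearized operators -/

namespace IsEvenPositiveWave

variable {𝕜 : Type*} [RCLike 𝕜] {L ω α : ℝ} {φ : ℝ → ℝ}

theorem eigenspaceOp_opL1_zero (hφ : IsEvenPositiveWave L ω α φ) (hL : 0 < L) (hω : 0 < ω)
    (hα : 0 < α) (hnc : ∃ x y, φ x ≠ φ y) :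
    eigenspaceOp (opL1 𝕜 hL ω hα hφ.contDiff.continuous) 0 =
      Submodule.span 𝕜 {contLp L (continuous_ofReal_comp (𝕜 := 𝕜) hφ.continuous_deriv)} := by
  have hq : (fun x => pot₁ ω α φ x - 0) = pot₁ ω α φ := funext fun x => sub_zero _
  have hd : IsSol L (fun x => pot₁ ω α φ x - 0) (deriv φ) (fun x => -force α ω (φ x)) := by
    rw [hq]
    exact hφ.isSol_deriv L
  have hp := hφ.periodic 0
  have hdp := hφ.deriv_periodic 0
  rw [zero_add] at hp hdp
  have h := eigenspaceOp_hill_eq_span (𝕜 := 𝕜) hL (hφ.continuous_pot₁ hα) hd hdp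
    (by simp only [hp]) fun {y y'} hy h0 h1 => by
      rw [hq] at hy
      exact hφ.kernel_linearization hL hω hα hnc hy h0 h1
  rwa [RCLike.ofReal_zero] at h

theorem eigenspaceOp_opL2_zero (hφ : IsEvenPositiveWave L ω α φ) (hL : 0 < L) (hα : 0 < α) :
    eigenspaceOp (opL2 𝕜 hL ω hα hφ.contDiff.continuous) 0 =
      Submodule.span 𝕜 {contLp L (continuous_ofReal_comp (𝕜 := 𝕜) hφ.continuous)} := by
  have hq : (fun x => pot₂ ω α φ x - 0) = pot₂ ω α φ := funext fun x => sub_zero _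
  have hs : IsSol L (fun x => pot₂ ω α φ x - 0) φ (deriv φ) := by
    rw [hq]
    exact hφ.isSol_self L
  have hp := hφ.periodic 0
  have hdp := hφ.deriv_periodic 0
  rw [zero_add] at hp hdp
  have h := eigenspaceOp_hill_eq_span (𝕜 := 𝕜) hL (hφ.continuous_pot₂ hα) hs hp hdp
    fun {y y'} hy h0 _ => by
      rw [hq] at hy
      exact hφ.pot₂_kernel hL hα hy h0
  rwa [RCLike.ofReal_zero] at h

theorem not_isEigenvalueOp_opL2 (hφ : IsEvenPositiveWave L ω α φ) (hL : 0 < L) (hα : 0 < α)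
    {μ : ℝ} (hμ : μ < 0) :
    ¬ IsEigenvalueOp (opL2 𝕜 hL ω hα hφ.contDiff.continuous) (μ : 𝕜) := by
  intro h
  obtain ⟨y, y', hy, h0, h1, x, hx, hne⟩ :=
    exists_isSol_of_isEigenvalueOp hL (hφ.continuous_pot₂ hα) h
  exact hne (hφ.pot₂_negative_eq_zero hL hμ hy h0 h1 x hx)

/-- The quadratic form of `𝓛₁` is negative at `φ`, because `𝓛₁ φ = -α |φ|^α φ`. -/
theorem exists_neg_eigenvalue_opL1 (hφ : IsEvenPositiveWave L ω α φ) (hL : 0 < L) (hα : 0 < α) :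
    ∃ μ : ℝ, μ < 0 ∧ IsEigenvalueOp (opL1 𝕜 hL ω hα hφ.contDiff.continuous) (μ : 𝕜) := by
  have hper : Function.Periodic (pot₁ ω α φ) L := fun x => by simp only [pot₁, hφ.periodic x]
  obtain ⟨c, hc, S, hS⟩ := exists_hasCompactResolvent_hill 𝕜 hL (hφ.continuous_pot₁ hα) hper
  have hp := hφ.periodic 0
  have hdp := hφ.deriv_periodic 0
  rw [zero_add] at hp hdp
  have hcont : Continuous fun x => (pot₁ ω α φ x - pot₂ ω α φ x) * φ x :=
    ((hφ.continuous_pot₁ hα).sub (hφ.continuous_pot₂ hα)).mul hφ.continuous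
  obtain ⟨h, e⟩ := (hφ.isSol_self L).hill_contLp (𝕜 := 𝕜) hL (hφ.continuous_pot₁ hα)
    (hφ.continuous_pot₂ hα) hp hdp hcont
  refine hS.exists_neg_eigenvalue hc ⟨_, h⟩ ?_
  rw [e, inner_contLp_ofReal hL hcont]
  have e2 : ∫ x in (0 : ℝ)..L, ((pot₁ ω α φ x - pot₂ ω α φ x) * φ x) •
      contLp L (continuous_ofReal_comp (𝕜 := 𝕜) hφ.continuous) x =
        ((∫ x in (0 : ℝ)..L, (pot₁ ω α φ x - pot₂ ω α φ x) * φ x * φ x : ℝ) : 𝕜) := by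
    rw [integral_smul_congr hL _ (contLp_coeFn (continuous_ofReal_comp (𝕜 := 𝕜) hφ.continuous)),
      intervalIntegral.integral_of_le hL.le, intervalIntegral.integral_of_le hL.le,
      ← integral_ofReal]
    refine integral_congr_ae (Filter.Eventually.of_forall fun x => ?_)
    simp only [RCLike.real_smul_eq_coe_mul]
    push_cast
    rfl
  change RCLike.re (∫ x in (0 : ℝ)..L, ((pot₁ ω α φ x - pot₂ ω α φ x) * φ x) •
    contLp L (continuous_ofReal_comp (𝕜 := 𝕜) hφ.continuous) x) < 0
  rw [e2, RCLike.ofReal_re, ← neg_pos, ← intervalIntegral.integral_neg]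
  refine intervalIntegral.intervalIntegral_pos_of_pos
    ((hcont.mul hφ.continuous).neg.intervalIntegrable _ _) (fun x => ?_) hL
  have h1 : 0 < |φ x| ^ α := Real.rpow_pos_of_pos (abs_pos.mpr (hφ.pos x).ne') α
  have h2 := hφ.pos x
  have : -((pot₁ ω α φ x - pot₂ ω α φ x) * φ x * φ x) = α * |φ x| ^ α * (φ x * φ x) := by
    simp only [pot₁, pot₂]; ring
  rw [this]
  positivity

end IsEvenPositiveWave

/-- `𝓛₁` has exactly one negative eigenvalue and it is simple. -/
theorem IsEvenMinimizer.exists_unique_neg_eigenvalue (𝕜 : Type*) [RCLike 𝕜] {L ω α τ : ℝ}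
    {φ : ℝ → ℝ} (hmin : IsEvenMinimizer L ω α τ (fun x => (φ x : ℂ))
      (fun x => ((deriv φ x : ℝ) : ℂ))) (hL : 0 < L) (hα : 0 < α) (hτ : 0 < τ)
    (hφ : IsEvenPositiveWave L ω α φ) (hnc : ∃ x y, φ x ≠ φ y) :
    ∃ μ : ℝ, μ < 0 ∧
      (∀ ν : ℝ, ν < 0 →
        (IsEigenvalueOp (opL1 𝕜 hL ω hα hφ.contDiff.continuous) (ν : 𝕜) ↔ ν = μ)) ∧
      ∃ f : L2per 𝕜 L, f ≠ 0 ∧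
        eigenspaceOp (opL1 𝕜 hL ω hα hφ.contDiff.continuous) (μ : 𝕜) = Submodule.span 𝕜 {f} := by
  obtain ⟨μ, hμ, hev⟩ := hφ.exists_neg_eigenvalue_opL1 (𝕜 := 𝕜) hL hα
  obtain ⟨y, y', hy, h0, h1, hne⟩ :=
    exists_isSol_of_isEigenvalueOp hL (hφ.continuous_pot₁ hα) hev
  refine ⟨μ, hμ, fun ν hν => ⟨fun h => ?_, fun h => h ▸ hev⟩, _,
    contLp_ne_zero hL hy.continuous hne, ?_⟩
  · obtain ⟨z, z', hz, hz0, hz1, hzne⟩ :=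
      exists_isSol_of_isEigenvalueOp hL (hφ.continuous_pot₁ hα) h
    exact ((hmin.negative_unique hL hα hτ hφ hnc hμ hν hy h0 h1 hz hz0 hz1 hne).2 hzne).symm
  · exact eigenspaceOp_hill_eq_span hL (hφ.continuous_pot₁ hα) hy h0 h1 fun hz hz0 hz1 =>
      (hmin.negative_unique hL hα hτ hφ hnc hμ hμ hy h0 h1 hz hz0 hz1 hne).1

/-! ### Products of lines -/

theorem span_singleton_prod_bot {𝕜 E F : Type*} [Ring 𝕜] [AddCommGroup E] [Module 𝕜 E]
    [AddCommGroup F] [Module 𝕜 F] (f : E) :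
    (Submodule.span 𝕜 {f}).prod (⊥ : Submodule 𝕜 F) = Submodule.span 𝕜 {((f, 0) : E × F)} := by
  ext ⟨x, y⟩
  simp only [Submodule.mem_prod, Submodule.mem_span_singleton, Submodule.mem_bot, Prod.smul_mk,
    smul_zero, Prod.mk.injEq]
  constructor
  · rintro ⟨⟨a, ha⟩, rfl⟩
    exact ⟨a, ha, rfl⟩
  · rintro ⟨a, ha, rfl⟩
    exact ⟨⟨a, ha⟩, rfl⟩

theorem span_singleton_prod_span_singleton {𝕜 E F : Type*} [Ring 𝕜] [AddCommGroup E] [Module 𝕜 E]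
    [AddCommGroup F] [Module 𝕜 F] (f : E) (g : F) :
    (Submodule.span 𝕜 {f}).prod (Submodule.span 𝕜 {g}) =
      Submodule.span 𝕜 {((f, 0) : E × F), (0, g)} := by
  ext ⟨x, y⟩
  simp only [Submodule.mem_prod, Submodule.mem_span_singleton, Submodule.mem_span_pair,
    Prod.smul_mk, smul_zero, Prod.mk_add_mk, add_zero, zero_add, Prod.mk.injEq]
  constructor
  · rintro ⟨⟨a, ha⟩, b, hb⟩
    exact ⟨a, b, ha, hb⟩
  · rintro ⟨a, b, ha, hb⟩
    exact ⟨⟨a, ha⟩, b, hb⟩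

theorem finrank_span_pair_prod {𝕜 E F : Type*} [Field 𝕜] [AddCommGroup E] [Module 𝕜 E]
    [AddCommGroup F] [Module 𝕜 F] {f : E} {g : F} (hf : f ≠ 0) (hg : g ≠ 0) :
    Module.finrank 𝕜 (Submodule.span 𝕜 {((f, 0) : E × F), (0, g)}) = 2 := by
  have hli : LinearIndependent 𝕜 ![((f, 0) : E × F), (0, g)] := by
    rw [LinearIndependent.pair_iff]
    intro s t h
    simp only [Prod.smul_mk, smul_zero, Prod.mk_add_mk, add_zero, zero_add, Prod.mk_eq_zero,
      smul_eq_zero, hf, hg, or_false] at h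
    exact h
  have h := finrank_span_eq_card hli
  rwa [Matrix.range_cons, Matrix.range_cons, Matrix.range_empty, union_empty, Fintype.card_fin]
    at h

end TransverseNLS

open TransverseNLS in
theorem proposition3p3 {𝕜 : Type*} [RCLike 𝕜] {L ω α τ : ℝ} (hL : 0 < L) (hω : 0 < ω)
    (hα : 0 < α) (hτ : 0 < τ) {φ : ℝ → ℝ} (hφ : IsEvenPositiveWave L ω α φ)
    (hmin : IsEvenMinimizer L ω α τ (fun x => (φ x : ℂ)) (fun x => ((deriv φ x : ℝ) : ℂ)))
    (hnonconst : ∃ x y, φ x ≠ φ y) :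
    ∃ lam : ℝ, 0 < lam ∧
      -- exactly one negative eigenvalue, and it is simple
      (∀ μ : ℝ, μ < 0 →
        (IsEigenvalueOp (opL 𝕜 hL ω hα hφ.contDiff.continuous) (μ : 𝕜) ↔ μ = -lam)) ∧
      Module.finrank 𝕜
        (eigenspaceOp (opL 𝕜 hL ω hα hφ.contDiff.continuous) ((-lam : ℝ) : 𝕜)) = 1 ∧
      -- zero is a double eigenvalue with eigenfunctions `(φ', 0)` and `(0, φ)`
      (∃ p d : L2per 𝕜 L,
        p =ᵐ[MeasureTheory.volume.restrict (Set.Ioc (0 : ℝ) L)] (fun x => (φ x : 𝕜)) ∧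
        d =ᵐ[MeasureTheory.volume.restrict (Set.Ioc (0 : ℝ) L)] (fun x => ((deriv φ x : ℝ) : 𝕜)) ∧
        eigenspaceOp (opL 𝕜 hL ω hα hφ.contDiff.continuous) 0 =
          Submodule.span 𝕜 {((d, 0) : L2per 𝕜 L × L2per 𝕜 L), (0, p)}) ∧
      Module.finrank 𝕜 (eigenspaceOp (opL 𝕜 hL ω hα hφ.contDiff.continuous) 0) = 2 ∧
      -- the rest of the spectrum consists of positive eigenvalues of finite multiplicity
      (∀ z ∈ spectrumOp (opL 𝕜 hL ω hα hφ.contDiff.continuous),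
        z ≠ ((-lam : ℝ) : 𝕜) → z ≠ 0 →
          (∃ μ : ℝ, 0 < μ ∧ z = (μ : 𝕜)) ∧
          IsEigenvalueOp (opL 𝕜 hL ω hα hφ.contDiff.continuous) z ∧
          FiniteDimensional 𝕜 (eigenspaceOp (opL 𝕜 hL ω hα hφ.contDiff.continuous) z)) ∧
      -- and the spectrum is discrete: only finitely many points in every bounded set
      (∀ r : ℝ, (spectrumOp (opL 𝕜 hL ω hα hφ.contDiff.continuous) ∩
        Metric.closedBall 0 r).Finite) := by
  obtain ⟨μ₀, hμ₀, huniq, f, hf, hspan⟩ :=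
    hmin.exists_unique_neg_eigenvalue 𝕜 hL hα hτ hφ hnonconst
  have hper₁ : Function.Periodic (pot₁ ω α φ) L := fun x => by simp only [pot₁, hφ.periodic x]
  have hper₂ : Function.Periodic (pot₂ ω α φ) L := fun x => by simp only [pot₂, hφ.periodic x]
  obtain ⟨c₁, -, S₁, hS₁⟩ := exists_hasCompactResolvent_hill 𝕜 hL (hφ.continuous_pot₁ hα) hper₁
  obtain ⟨c₂, -, S₂, hS₂⟩ := exists_hasCompactResolvent_hill 𝕜 hL (hφ.continuous_pot₂ hα) hper₂
  have hneg : ∀ μ : ℝ, μ < 0 →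
      (IsEigenvalueOp (opL 𝕜 hL ω hα hφ.contDiff.continuous) (μ : 𝕜) ↔ μ = μ₀) := fun μ hμ => by
    rw [opL, isEigenvalueOp_diagOp, huniq μ hμ, or_iff_left (hφ.not_isEigenvalueOp_opL2 hL hα hμ)]
  have hspec : ∀ z ∈ spectrumOp (opL 𝕜 hL ω hα hφ.contDiff.continuous),
      IsEigenvalueOp (opL1 𝕜 hL ω hα hφ.contDiff.continuous) z ∨
        IsEigenvalueOp (opL2 𝕜 hL ω hα hφ.contDiff.continuous) z := fun z hz =>
    (spectrumOp_diagOp_subset hz).imp hS₁.isEigenvalueOp_of_mem_spectrumOp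
      hS₂.isEigenvalueOp_of_mem_spectrumOp
  have hzero : eigenspaceOp (opL 𝕜 hL ω hα hφ.contDiff.continuous) 0 =
      Submodule.span 𝕜
        {((contLp L (continuous_ofReal_comp (𝕜 := 𝕜) hφ.continuous_deriv), 0) :
          L2per 𝕜 L × L2per 𝕜 L),
          (0, contLp L (continuous_ofReal_comp (𝕜 := 𝕜) hφ.continuous))} := by
    rw [opL, eigenspaceOp_diagOp, hφ.eigenspaceOp_opL1_zero hL hω hα hnonconst,
      hφ.eigenspaceOp_opL2_zero hL hα, span_singleton_prod_span_singleton]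
  have hd : ∃ x ∈ Set.Icc 0 L, deriv φ x ≠ 0 := by
    by_contra! h
    exact hφ.force_ne_zero hL hα hnonconst
      (neg_eq_zero.mp ((hφ.isSol_deriv L).deriv_zero_eq_zero hL h))
  refine ⟨-μ₀, neg_pos.mpr hμ₀, ?_, ?_, ⟨_, _, contLp_coeFn _, contLp_coeFn _, hzero⟩, ?_, ?_, ?_⟩
  · simpa only [neg_neg] using hneg
  · rw [neg_neg, opL, eigenspaceOp_diagOp, hspan,
      not_ne_iff.mp (hφ.not_isEigenvalueOp_opL2 (𝕜 := 𝕜) hL hα hμ₀), span_singleton_prod_bot]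
    exact finrank_span_singleton fun h => hf (Prod.mk_eq_zero.mp h).1
  · rw [hzero]
    exact finrank_span_pair_prod (contLp_ne_zero hL hφ.continuous_deriv hd)
      (contLp_ne_zero hL hφ.continuous ⟨0, ⟨le_rfl, hL.le⟩, (hφ.pos 0).ne'⟩)
  · intro z hz h1 h2
    have hev := isEigenvalueOp_diagOp.mpr (hspec z hz)
    refine ⟨?_, hev, ?_⟩
    · obtain ⟨μ, rfl⟩ : ∃ μ : ℝ, z = μ := by
        rcases hspec z hz with h | h
        · exact (hS₁.exists_eq_ofReal h).imp fun _ h => h.1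
        · exact (hS₂.exists_eq_ofReal h).imp fun _ h => h.1
      refine ⟨μ, ?_, rfl⟩
      by_contra h3
      rcases (not_lt.mp h3).lt_or_eq with h4 | h4
      · exact h1 (by rw [neg_neg, (hneg μ h4).mp hev])
      · exact h2 (by rw [h4, RCLike.ofReal_zero])
    · rw [opL, eigenspaceOp_diagOp]
      exact Module.Finite.iff_fg.mpr (Submodule.FG.prod
        (Module.Finite.iff_fg.mp (hS₁.finiteDimensional z))
        (Module.Finite.iff_fg.mp (hS₂.finiteDimensional z)))
  · intro r
    refine ((hS₁.finite_eigenvalues r).union (hS₂.finite_eigenvalues r)).subset ?_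
    rintro z ⟨hz, hr⟩
    exact (hspec z hz).imp (fun h => ⟨h, hr⟩) fun h => ⟨h, hr⟩
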